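/- For every integer $k\ge 2$ and all reals $0<\delta'\le d<1$ there exist $\delta_0,\delta_1,\varepsilon>0$ with $\delta'\ge\delta_0>2\delta_1$ and $C>0$ such that the following holds. Let $V,U_1,\dots,U_k$ be pairwise disjoint finite sets of vertices of a graph $G$ with $|V|=n+4$, $(1-\delta_0)n\le|U_1|=\dots=|U_k|\le(1-\delta_1)n$ and $n-|U_1|\equiv 0\pmod{6k-2}$. Suppose that for each $i=1,\dots,k$ the pair $(V,U_i)$ is $(\varepsilon,d)$-super-regular in $G$; that is, $e_G(X,Y)\ge d|X||Y|$ for all $X\subseteq V$, $Y\subseteq U_i$ with $|X|\ge\varepsilon|V|$, $|Y|\ge\varepsilon|U_i|$, every $v\in V$ has at least $d|U_i|$ neighbours in $U_i$, and every $u\in U_i$ has at least $d|V|$ neighbours in $V$. Let $(x,x')$ and $(y,y')$ be two tuples formed by four distinct vertices $x,x',y,y'\in V$, such that for each $i$ the vertices $x,x'$ have at least $\tfrac12d^2n$ common neighbours in $U_i$, and so do $y,y'$. Let $p\in[0,1]$ with $p\ge Cn^{-(k-1)/(2k-3)}$, let $G(V,p)$ be the random graph on $V$ in which each pair of vertices is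 an edge with probability $p$, independently, and let $G(U_1,\dots,U_k,p)$ be the random $k$-partite graph in which each pair of vertices from two different sets $U_i,U_j$ is an edge with probability $p$, independently of all other pairs and of $G(V,p)$. Then a.a.s. the graph $G[V,U_1,\dots,U_k]\cup G(V,p)\cup G(U_1,\dots,U_k,p)$, where $G[V,U_1,\dots,U_k]$ consists of the edges of $G$ between two different sets among $V,U_1,\dots,U_k$, contains the square of a Hamilton path with end-tuples $(x,x')$ and $(y,y')$, except that the edges $xx'$ and $yy'$ are not required. That is, there is an ordering $v_1,\dots,v_N$ of all the vertices of $V\cup U_1\cup\dots\cup U_k$ with $(v_2,v_1)=(x,x')$ and $(v_{N-1},v_N)=(y,y')$ such that $v_iv_j$ is an edge whenever $1\le j-i\le 2$ and $v_iv_j\notin\{xx',yy'\}$. Here "a.a.s." means that for every $\eta>0$ there is $n_0=n_0(k,\delta',d,\eta)$ such that for all $n\ge n_0$ and all choices of the objects above the probability is at least $1-\eta$. -/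

import Mathlib

open Finset

/-- The pair `(A, B)` is `(ε, d)`-super-regular in `G`: every pair of subsets `X ⊆ A`, `Y ⊆ B` with
`|X| ≥ ε|A|` and `|Y| ≥ ε|B|` has density at least `d`, every `a ∈ A` has at least `d|B|` neighbours
in `B`, and every `b ∈ B` has at least `d|A|` neighbours in `A`. -/
structure IsSuperRegular {W : Type*} (G : SimpleGraph W) [DecidableRel G.Adj] (ε d : ℝ)
    (A B : Finset W) : Prop where
  density : ∀ X ⊆ A, ∀ Y ⊆ B, ε * (#A : ℝ) ≤ (#X : ℝ) → ε * (#B : ℝ) ≤ (#Y : ℝ) →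
    d ≤ ((G.edgeDensity X Y : ℚ) : ℝ)
  deg_left : ∀ a ∈ A, d * (#B : ℝ) ≤ (#{b ∈ B | G.Adj a b} : ℝ)
  deg_right : ∀ b ∈ B, d * (#A : ℝ) ≤ (#{a ∈ A | G.Adj a b} : ℝ)

/-- The complete graph on the vertex set `A`, as a graph on the ambient vertex type. -/
def completeOn {W : Type*} (A : Finset W) : SimpleGraph W where
  Adj a b := a ≠ b ∧ a ∈ A ∧ b ∈ A
  symm := ⟨fun _ _ h => ⟨h.1.symm, h.2.2, h.2.1⟩⟩
  loopless := ⟨fun _ h => h.1 rfl⟩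

/-- The complete multipartite graph with the (pairwise disjoint) parts `P i`, as a graph on the
ambient vertex type. -/
def completeBetween {W ι : Type*} (P : ι → Finset W) : SimpleGraph W where
  Adj a b := a ≠ b ∧ ∃ i j, i ≠ j ∧ a ∈ P i ∧ b ∈ P j
  symm := ⟨fun _ _ h => ⟨h.1.symm, by
    obtain ⟨i, j, hij, ha, hb⟩ := h.2
    exact ⟨j, i, hij.symm, hb, ha⟩⟩⟩
  loopless := ⟨fun _ h => h.1 rfl⟩

/-- The law of the random subgraph of `H` in which every edge of `H` is kept with probability `p`,
independently of all other edges. For `H = ⊤` this is Mathlib's `SimpleGraph.binomialRandom`. With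
`H = completeOn V` it is `G(V, p)`, and with `H = completeBetween U` it is the random multipartite
graph `G(U₁, …, Uₖ, p)`. -/
noncomputable def randomSubgraph {W : Type*} (H : SimpleGraph W) (p : unitInterval) :
    MeasureTheory.Measure (SimpleGraph W) :=
  (ProbabilityTheory.setBernoulli H.edgeSet p).comap SimpleGraph.edgeSet

/-- `Γ` contains the square of a path `v₁, …, v_N` visiting every vertex of `S` exactly once and no
other vertex, with end-tuples `(v₂, v₁) = (x, x')` and `(v_{N-1}, v_N) = (y, y')`, where the two
edges `xx'` and `yy'` need not be present in `Γ`. -/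
def HasSquareHamPath {W : Type*} (Γ : SimpleGraph W) (S : Finset W) (x x' y y' : W) : Prop :=
  ∃ l : List W, l.Nodup ∧ (∀ w, w ∈ l ↔ w ∈ S) ∧ [x', x] <+: l ∧ [y, y'] <:+ l ∧
    ∀ (i j : ℕ) (hi : i < l.length) (hj : j < l.length), i < j → j ≤ i + 2 →
      s(l[i], l[j]) ≠ s(x, x') → s(l[i], l[j]) ≠ s(y, y') → Γ.Adj l[i] l[j]

/-! Call the square of a path with one vertex in each `U i`, in the order of the indices, a block;
it has `2k - 3` edges, all of them random. Let `p, q` be the last two vertices of one block and `f,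
f'` the first two of the next. A vertex of `V` that is adjacent in `G` to all four can be put
between the blocks, provided that `qf` is an edge. If it is not, an edge of `G(V, p)` inside the
common neighbourhood does the same job. A vertex `u` of some `U i` that lies in no block is absorbed
by a gap `a b u c d`, where `abcd` is a path of `G(V, p)` in the common neighbourhood and in the
neighbourhood of `u`. The three kinds of gap use one, two and four vertices of `V`. Since `n`
exceeds `m` by a linear amount, their numbers can be chosen so that `V` is used up exactly.

Blocks. At the given `p` the number `n ^ k * p ^ (2k - 3)` is a large multiple of `n`, so Janson's
inequality (`janson`, `bexp_no_block_le`) survives a union bound over all boxes whose sides have a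
small linear size `t`. A greedy choice then gives blocks covering all but `t` vertices of each `U
i`, and merging paths orders them with at most `2t` missing links (`BlockRich.exists_cover`).

Compatibility with `G`. The law of the random multipartite graph is invariant under permutations of
each `U i`, so any property of almost all arrangements of the `U i` in rows may be imposed on the
blocks (`bexp_le_of_average`, `bexp_not_exists_cover_le`). The property needed is `IsSpread`: the
sets `Z` of vertices of `V` that fit between consecutive rows meet every large `X` in the expected
proportion with at most `t` exceptions, and each vertex of `V` is in linearly many of them. The
first part must hold for all of up to `2 ^ n` sets `X`. By regularity a pair of rows is bad for `X`
with probability at most `4ε`, so more than `t` bad pairs have probability at most about `(4ε) ^ (t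
/ 2)` times an exponential in `n`, and a small `ε` wins (`card_many_pairs_le`, `card_few_pairs_le`,
`card_not_isSpread_le`).

Assembly. Atypical rows are discarded and the order is repaired by exchanging segments
(`exists_block_order`). Hall's theorem then distributes the leftover vertices and the rest of `V`
over the gaps (`exists_separators`). -/

/-! ### Rearranging lists with few breaks of a relation -/

section Lists

variable {α : Type*}

open Classical in
/-- The number of consecutive pairs of a list that are not in the relation `S`. -/
noncomputable def breaks (S : α → α → Prop) : List α → ℕ
  | [] => 0
  | [_] => 0
  | a :: b :: l => (if S a b then 0 else 1) + breaks S (b :: l)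

open Classical in
theorem breaks_append (S : α → α → Prop) (A B : List α) (a b : α) :
    breaks S (A ++ [a] ++ b :: B) =
      breaks S (A ++ [a]) + (if S a b then 0 else 1) + breaks S (b :: B) := by
  induction A with
  | nil => simp [breaks]
  | cons c A ih =>
    cases A with
    | nil => simp [breaks]; ring
    | cons d A => simp only [List.cons_append, breaks] at ih ⊢; rw [ih]; ring

open Classical in
theorem breaks_cons_le (S : α → α → Prop) (a : α) (l : List α) :
    breaks S (a :: l) ≤ 1 + breaks S l := by
  cases l with
  | nil => simp [breaks]
  | cons b l => simp only [breaks]; split_ifs <;> omega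

theorem breaks_le_cons (S : α → α → Prop) (a : α) (l : List α) :
    breaks S l ≤ breaks S (a :: l) := by
  cases l with
  | nil => simp [breaks]
  | cons b l => simp only [breaks]; omega

theorem breaks_append_le (S : α → α → Prop) (A B : List α) :
    breaks S (A ++ B) ≤ breaks S A + 1 + breaks S B := by
  rcases List.eq_nil_or_concat A with rfl | ⟨A, a, rfl⟩
  · simp [breaks]
  · cases B with
    | nil => simp; omega
    | cons b B =>
      rw [List.concat_eq_append, breaks_append]
      split_ifs <;> omega

theorem breaks_mono {R S : α → α → Prop} (h : ∀ a b, S a b → R a b) (l : List α) :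
    breaks R l ≤ breaks S l := by
  induction l with
  | nil => simp [breaks]
  | cons a l ih =>
    cases l with
    | nil => simp [breaks]
    | cons b l =>
      simp only [breaks]
      have := h a b
      split_ifs <;> first | omega | tauto

open Classical in
theorem breaks_reverse (S : α → α → Prop) (l : List α) :
    breaks S l.reverse = breaks (fun a b => S b a) l := by
  induction l with
  | nil => simp [breaks]
  | cons a l ih =>
    cases l with
    | nil => simp [breaks]
    | cons b l =>
      simp only [List.reverse_cons] at ih ⊢
      rw [breaks_append, ih]
      simp [breaks]; ring

/-- Deleting an entry replaces two consecutive pairs by one, so it creates at most one break.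
Keeping the head `a` fixed makes the induction go through. -/
theorem breaks_filter_cons_le (S : α → α → Prop) (p : α → Bool) (a : α) (l : List α) :
    breaks S (a :: l.filter p) ≤ breaks S (a :: l) + l.countP (fun b => !p b) := by
  induction l generalizing a with
  | nil => simp
  | cons b l ih =>
    by_cases hb : p b
    · have := ih b
      simp only [List.filter_cons, hb, if_true, breaks, List.countP_cons] at this ⊢
      simp; omega
    · have h1 := ih a
      have h2 := breaks_cons_le S a l
      have h3 := breaks_le_cons S b l
      simp only [List.filter_cons, hb, breaks, List.countP_cons] at h1 ⊢
      simp at h1 ⊢; omega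

theorem breaks_filter_le (S : α → α → Prop) (p : α → Bool) (l : List α) :
    breaks S (l.filter p) ≤ breaks S l + l.countP (fun b => !p b) := by
  cases l with
  | nil => simp
  | cons a l =>
    by_cases ha : p a
    · have := breaks_filter_cons_le S p a l
      simp only [List.filter_cons, ha, if_true, List.countP_cons]
      simp; omega
    · have h1 := breaks_filter_cons_le S p a l
      have h2 := breaks_le_cons S a (l.filter p)
      simp only [List.filter_cons, ha, List.countP_cons]
      simp; omega

/-- Pigeonhole over the `w.length - 1` consecutive pairs: an unsuitable pair is charged to its first
entry satisfying `p` or its second entry satisfying `q`. -/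
theorem exists_consecutive_of_countP {p q : α → Bool} (w : List α)
    (h : w.countP p + w.tail.countP q + 1 < w.length) :
    ∃ w₁ u v w₂, w = w₁ ++ [u] ++ v :: w₂ ∧ p u = false ∧ q v = false := by
  induction w with
  | nil => simp at h
  | cons u w ih =>
    cases w with
    | nil => simp at h
    | cons v w =>
      by_cases hu : p u
      · obtain ⟨w₁, a, b, w₂, h1, h2, h3⟩ := ih (by
          have h4 := List.countP_cons (p := q) (a := v) (l := w)
          simp only [List.countP_cons, hu, List.tail_cons, List.length_cons, if_true] at h ⊢
          omega)
        exact ⟨u :: w₁, a, b, w₂, by simp [h1], h2, h3⟩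
      · by_cases hv : q v
        · obtain ⟨w₁, a, b, w₂, h1, h2, h3⟩ := ih (by
            simp only [List.countP_cons, hv, List.tail_cons, List.length_cons, if_true] at h ⊢
            omega)
          exact ⟨u :: w₁, a, b, w₂, by simp [h1], h2, h3⟩
        · exact ⟨[], u, v, w, by simp, by simpa using hu, by simpa using hv⟩

open Classical in
/-- A break of `R` with enough elements after it is repaired by swapping two segments. -/
theorem exists_swap_right {R S : α → α → Prop} {t : ℕ} {l₀ r : List α} {a q : α}
    (hout : ∀ b ∈ l₀ ++ [a] ++ q :: r, (l₀ ++ [a] ++ q :: r).countP (fun c => ¬ R b c) ≤ t)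
    (hin : ∀ b ∈ l₀ ++ [a] ++ q :: r, (l₀ ++ [a] ++ q :: r).countP (fun c => ¬ R c b) ≤ t)
    (haq : ¬ R a q) (hlen : 3 * t + 2 ≤ r.length) :
    ∃ l', l'.Perm (l₀ ++ [a] ++ q :: r) ∧ l'.head? = (l₀ ++ [a] ++ q :: r).head? ∧
      l'.getLast? = (l₀ ++ [a] ++ q :: r).getLast? ∧
      breaks R l' < breaks R (l₀ ++ [a] ++ q :: r) ∧
      breaks S l' ≤ breaks S (l₀ ++ [a] ++ q :: r) + 3 := by
  set l := l₀ ++ [a] ++ q :: r with hl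
  have hsub : ∀ m : List α, m.Sublist (q :: r) → m.Sublist l := fun m hm =>
    hm.trans (by rw [hl]; exact List.sublist_append_right _ _)
  -- View the list as `l₀ a | q … z | h … u | v …` and exchange the two middle segments: the pairs
  -- `aq, zh, uv` become `ah, uq, zv`. The entry `h` is sought among the `t + 1` entries after `q`,
  -- of which at most `t` are unsuitable; `z` is just its predecessor.
  obtain ⟨s, z, h, s', hs, -, hR1⟩ := exists_consecutive_of_countP (p := fun _ => false)
    (q := fun c => ¬ R a c) ((q :: r).take (t + 2)) (by
      have h1 := hout a (by simp [hl])
      have h2 : ((q :: r).take (t + 2)).tail.countP (fun c => ¬ R a c) ≤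
        l.countP (fun c => ¬ R a c) := List.Sublist.countP_le
          (hsub _ ((List.tail_sublist _).trans (List.take_sublist _ _)))
      have h3 : ((q :: r).take (t + 2)).length = t + 2 := by simp; omega
      rw [h3, List.countP_false, Function.const_apply]; omega)
  have hslen : s.length ≤ t := by
    have := congrArg List.length hs
    simp at this; omega
  set w := h :: (s' ++ (q :: r).drop (t + 2)) with hw
  have hqr : q :: r = s ++ [z] ++ w := by
    conv_lhs => rw [← List.take_append_drop (t + 2) (q :: r), hs]
    simp [hw]
  have hwl : 2 * t + 2 ≤ w.length := by
    have := congrArg List.length hqr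
    simp only [List.length_append, List.length_cons, List.length_nil] at this; omega
  have hwsub : w.Sublist l := hsub _ (by rw [hqr]; exact List.sublist_append_right _ _)
  have hzl : z ∈ l := (hsub [z] (by rw [hqr]; simp)).subset (by simp)
  -- The conditions `R u q` and `R z v` exclude at most `t` entries each, and `w` has at least `2t +
  -- 2`.
  obtain ⟨w₁, u, v, w₂, hw', hR2, hR3⟩ := exists_consecutive_of_countP
    (p := fun c => ¬ R c q) (q := fun c => ¬ R z c) w (by
      have h1 := hin q (by simp [hl])
      have h2 := hout z hzl
      have h3 : w.countP (fun c => ¬ R c q) ≤ l.countP (fun c => ¬ R c q) :=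
        List.Sublist.countP_le hwsub
      have h4 : w.tail.countP (fun c => ¬ R z c) ≤ l.countP (fun c => ¬ R z c) :=
        List.Sublist.countP_le ((List.tail_sublist _).trans hwsub)
      omega)
  simp only [decide_eq_false_iff_not, not_not] at hR1 hR2 hR3
  obtain ⟨Q', hQ⟩ : ∃ Q', s ++ [z] = q :: Q' := by
    cases s with
    | nil => simp at hqr; exact ⟨[], by simp [hqr.1]⟩
    | cons c s => simp at hqr; exact ⟨s ++ [z], by simp [hqr.1]⟩
  obtain ⟨S', hS⟩ : ∃ S', w₁ ++ [u] = h :: S' := by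
    cases w₁ with
    | nil => rw [hw] at hw'; simp at hw'; exact ⟨[], by simp [hw'.1]⟩
    | cons c s => rw [hw] at hw'; simp at hw'; exact ⟨s ++ [u], by simp [hw'.1]⟩
  have hle : l = (l₀ ++ [a]) ++ ((s ++ [z]) ++ ((w₁ ++ [u]) ++ v :: w₂)) := by
    rw [hl, hqr, hw']
  -- The balance is taken for any relation: for `R` the three new pairs are good and the old pair
  -- `aq` was bad, while for `S` at most three pairs get lost.
  have key : ∀ T : α → α → Prop, breaks T l + (if T a h then 0 else 1) +
      (if T u q then 0 else 1) + (if T z v then 0 else 1) =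
      breaks T ((l₀ ++ [a]) ++ ((w₁ ++ [u]) ++ ((s ++ [z]) ++ v :: w₂))) +
      (if T a q then 0 else 1) + (if T z h then 0 else 1) + (if T u v then 0 else 1) := by
    intro T
    have e1 : breaks T l = breaks T (l₀ ++ [a]) + (if T a q then 0 else 1) +
        (breaks T (s ++ [z]) + (if T z h then 0 else 1) +
        (breaks T (w₁ ++ [u]) + (if T u v then 0 else 1) + breaks T (v :: w₂))) := by
      rw [hle, ← breaks_append T w₁, hS, List.cons_append, ← breaks_append T s, hQ,
        List.cons_append, breaks_append]
    have e2 : breaks T ((l₀ ++ [a]) ++ ((w₁ ++ [u]) ++ ((s ++ [z]) ++ v :: w₂))) =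
        breaks T (l₀ ++ [a]) + (if T a h then 0 else 1) +
        (breaks T (w₁ ++ [u]) + (if T u q then 0 else 1) +
        (breaks T (s ++ [z]) + (if T z v then 0 else 1) + breaks T (v :: w₂))) := by
      rw [← breaks_append T s, hQ, List.cons_append, ← breaks_append T w₁, hS,
        List.cons_append, breaks_append]
    rw [e1, e2]; ring
  refine ⟨(l₀ ++ [a]) ++ ((w₁ ++ [u]) ++ ((s ++ [z]) ++ v :: w₂)), ?_, ?_, ?_, ?_, ?_⟩
  · rw [hle]
    refine List.Perm.append_left _ ?_
    rw [← List.append_assoc (w₁ ++ [u]), ← List.append_assoc (s ++ [z]) (w₁ ++ [u])]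
    exact List.Perm.append_right _ List.perm_append_comm
  · rw [hle]; cases l₀ <;> simp
  · rw [hle]; simp only [List.getLast?_append, List.getLast?_cons]; simp
  · have := key R
    simp only [hR1, hR2, hR3, haq, if_true, if_false] at this
    split_ifs at this <;> omega
  · have := key S
    split_ifs at this <;> omega

theorem exists_break {R : α → α → Prop} {l : List α} (h : 0 < breaks R l) :
    ∃ l₀ a q r, l = l₀ ++ [a] ++ q :: r ∧ ¬ R a q := by
  induction l with
  | nil => simp [breaks] at h
  | cons a l ih =>
    cases l with
    | nil => simp [breaks] at h
    | cons b l =>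
      by_cases hab : R a b
      · simp only [breaks, hab, if_true, zero_add] at h
        obtain ⟨l₀, c, q, r, h1, h2⟩ := ih h
        exact ⟨a :: l₀, c, q, r, by simp [h1], h2⟩
      · exact ⟨[], a, b, l, by simp, hab⟩

open Classical in
-- A list of this length has at least `3t + 2` entries after the break or before it; in the second
-- case the list and both relations are reversed.
theorem exists_swap_segments {R S : α → α → Prop} {t : ℕ} {l : List α}
    (hout : ∀ b ∈ l, l.countP (fun c => ¬ R b c) ≤ t)
    (hin : ∀ b ∈ l, l.countP (fun c => ¬ R c b) ≤ t)
    (hlen : 6 * t + 6 ≤ l.length) (hbr : 0 < breaks R l) :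
    ∃ l', l'.Perm l ∧ l'.head? = l.head? ∧ l'.getLast? = l.getLast? ∧
      breaks R l' < breaks R l ∧ breaks S l' ≤ breaks S l + 3 := by
  obtain ⟨l₀, a, q, r, rfl, haq⟩ := exists_break hbr
  by_cases hr : 3 * t + 2 ≤ r.length
  · exact exists_swap_right hout hin haq hr
  · have hrev : (l₀ ++ [a] ++ q :: r).reverse = r.reverse ++ [q] ++ a :: l₀.reverse := by simp
    have hc : ∀ p : α → Bool, (l₀ ++ [a] ++ q :: r).countP p =
        (r.reverse ++ [q] ++ a :: l₀.reverse).countP p := fun p => by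
      rw [← hrev, List.countP_reverse]
    have hm : ∀ b, b ∈ r.reverse ++ [q] ++ a :: l₀.reverse ↔ b ∈ l₀ ++ [a] ++ q :: r := fun b => by
      rw [← hrev, List.mem_reverse]
    obtain ⟨l', h1, h2, h3, h4, h5⟩ := exists_swap_right (R := fun a b => R b a)
      (S := fun a b => S b a) (t := t) (l₀ := r.reverse) (r := l₀.reverse) (a := q) (q := a)
      (fun b hb => by rw [← hc]; exact hin b ((hm b).1 hb))
      (fun b hb => by rw [← hc]; exact hout b ((hm b).1 hb)) haq
      (by simp at hlen ⊢; omega)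
    rw [← hrev] at h1 h2 h3 h4 h5
    rw [breaks_reverse] at h4 h5
    refine ⟨l'.reverse, (List.reverse_perm l').trans (h1.trans (List.reverse_perm _)), ?_, ?_, ?_, ?_⟩
    · rw [List.head?_reverse, h3, List.getLast?_reverse]
    · rw [List.getLast?_reverse, h2, List.head?_reverse]
    · rw [breaks_reverse]; exact h4
    · rw [breaks_reverse]; exact h5

open Classical in
/-- All breaks of a nearly complete relation can be removed by rearranging the list, keeping its
ends, and creating at most three new breaks of `S` for each of them. -/
theorem exists_perm_breaks_eq_zero {R S : α → α → Prop} {t : ℕ} {l : List α}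
    (hout : ∀ b ∈ l, l.countP (fun c => ¬ R b c) ≤ t)
    (hin : ∀ b ∈ l, l.countP (fun c => ¬ R c b) ≤ t)
    (hlen : 6 * t + 6 ≤ l.length) :
    ∃ l', l'.Perm l ∧ l'.head? = l.head? ∧ l'.getLast? = l.getLast? ∧
      breaks R l' = 0 ∧ breaks S l' ≤ breaks S l + 3 * breaks R l := by
  induction hn : breaks R l using Nat.strong_induction_on generalizing l with
  | _ n ih =>
    rcases Nat.eq_zero_or_pos n with rfl | hpos
    · exact ⟨l, List.Perm.refl _, rfl, rfl, hn, by omega⟩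
    · obtain ⟨l₁, h1, h2, h3, h4, h5⟩ := exists_swap_segments (S := S) hout hin hlen (hn ▸ hpos)
      obtain ⟨l₂, g1, g2, g3, g4, g5⟩ := ih (breaks R l₁) (hn ▸ h4) (l := l₁)
        (fun b hb => by rw [h1.countP_eq]; exact hout b (h1.subset hb))
        (fun b hb => by rw [h1.countP_eq]; exact hin b (h1.subset hb))
        (by rw [h1.length_eq]; exact hlen) rfl
      exact ⟨l₂, g1.trans h1, g2.trans h2, g3.trans h3, g4, by omega⟩

theorem breaks_flatten_le {R : α → α → Prop} (LL : List (List α))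
    (h : ∀ l ∈ LL, breaks R l = 0) : breaks R LL.flatten ≤ LL.length := by
  induction LL with
  | nil => simp [breaks]
  | cons l LL ih =>
    have h1 := breaks_append_le R l LL.flatten
    have h2 := ih fun l' hl' => h l' (by simp [hl'])
    have h3 := h l (by simp)
    simp only [List.flatten_cons, List.length_cons]
    omega

open Classical in
/-- If any two large disjoint sets of elements span a pair of `R`, then the elements can be arranged
with few breaks. -/
theorem exists_perm_breaks_le {R : α → α → Prop} {t : ℕ} {l : List α} (hl : l.Nodup)
    (hE : ∀ A B : List α, (A ++ B).Nodup → (∀ a ∈ A ++ B, a ∈ l) → t ≤ A.length → t ≤ B.length →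
      ∃ a ∈ A, ∃ b ∈ B, R a b) :
    ∃ l', l'.Perm l ∧ breaks R l' ≤ 2 * t := by
  -- Break-free lists are merged, starting from singletons. While more than `2t` lists remain, the
  -- last entry of one of the first `t` is related to the first entry of one of the others.
  -- Concatenating the final lists costs one break per list at most.
  suffices H : ∀ (n : ℕ) (LL : List (List α)), LL.length = n → (∀ m ∈ LL, m ≠ []) →
      (∀ m ∈ LL, breaks R m = 0) → LL.flatten.Perm l →
      ∃ l', l'.Perm l ∧ breaks R l' ≤ 2 * t by
    refine H _ (l.map fun a => [a]) rfl (by simp) (by simp [breaks]) ?_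
    rw [← List.flatMap_def, List.flatMap_singleton']
  intro n
  induction n with
  | zero =>
    intro LL h0 _ _ hp
    rw [List.length_eq_zero_iff] at h0
    subst h0
    exact ⟨[], hp, by simp [breaks]⟩
  | succ n ih =>
    intro LL hlen hne hbr hp
    by_cases hsmall : LL.length ≤ 2 * t
    · exact ⟨_, hp, (breaks_flatten_le LL hbr).trans hsmall⟩
    push Not at hsmall
    have hsplit := List.take_append_drop t LL
    set LA := LL.take t with hLA
    set LB := LL.drop t with hLB
    have lastsub : ∀ M : List (List α), (M.filterMap List.getLast?).Sublist M.flatten := by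
      intro M
      induction M with
      | nil => simp
      | cons m M ih =>
        rcases List.eq_nil_or_concat m with rfl | ⟨m, a, rfl⟩
        · exact ih
        · simp only [List.concat_eq_append, List.filterMap_cons, List.getLast?_append,
            List.getLast?_singleton, Option.some_or, List.flatten_cons, List.append_assoc,
            List.singleton_append]
          exact (List.Sublist.cons_cons a ih).trans (List.sublist_append_right _ _)
    have headsub : ∀ M : List (List α), (M.filterMap List.head?).Sublist M.flatten := by
      intro M
      induction M with
      | nil => simp
      | cons m M ih =>
        cases m with
        | nil => exact ih
        | cons a m =>
          simp only [List.filterMap_cons, List.head?_cons, List.flatten_cons, List.cons_append]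
          exact List.Sublist.cons_cons a (ih.trans (List.sublist_append_right _ _))
    have lastlen : ∀ M : List (List α), (∀ m ∈ M, m ≠ []) →
        (M.filterMap List.getLast?).length = M.length := by
      intro M hM
      induction M with
      | nil => simp
      | cons m M ih =>
        rcases List.eq_nil_or_concat m with rfl | ⟨m, a, rfl⟩
        · exact absurd rfl (hM [] (by simp))
        · simp [ih fun m hm => hM m (by simp [hm])]
    have headlen : ∀ M : List (List α), (∀ m ∈ M, m ≠ []) →
        (M.filterMap List.head?).length = M.length := by
      intro M hM
      induction M with
      | nil => simp
      | cons m M ih =>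
        cases m with
        | nil => exact absurd rfl (hM [] (by simp))
        | cons a m => simp [ih fun m hm => hM m (by simp [hm])]
    have hABsub : ((LA.filterMap List.getLast?) ++ (LB.filterMap List.head?)).Sublist
        LL.flatten := by
      rw [← hsplit, List.flatten_append]
      exact (lastsub LA).append (headsub LB)
    obtain ⟨a, ha, b, hb, hab⟩ := hE (LA.filterMap List.getLast?) (LB.filterMap List.head?)
      (hABsub.nodup (hp.nodup_iff.2 hl)) (fun c hc => hp.subset (hABsub.subset hc))
      (by rw [lastlen LA fun m hm => hne m (List.mem_of_mem_take hm), hLA, List.length_take]; omega)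
      (by rw [headlen LB fun m hm => hne m (List.mem_of_mem_drop hm), hLB, List.length_drop]; omega)
    obtain ⟨P, hP, hPa⟩ := List.mem_filterMap.1 ha
    obtain ⟨Q, hQ, hQb⟩ := List.mem_filterMap.1 hb
    obtain ⟨X, Y, hXY⟩ := List.append_of_mem hP
    obtain ⟨X', Y', hXY'⟩ := List.append_of_mem hQ
    have hLL : LL = X ++ P :: Y ++ (X' ++ Q :: Y') := by rw [← hsplit, hXY, hXY']
    have hsubset : ∀ m ∈ X ++ Y ++ (X' ++ Y'), m ∈ LL := by
      intro m hm
      rw [hLL]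
      simp only [List.mem_append, List.mem_cons] at hm ⊢
      tauto
    refine ih ((P ++ Q) :: (X ++ Y ++ (X' ++ Y'))) ?_ ?_ ?_ ?_
    · rw [hLL] at hlen
      simp only [List.length_append, List.length_cons] at hlen ⊢
      omega
    · intro m hm
      rcases List.mem_cons.1 hm with rfl | hm
      · have := hne P (by rw [hLL]; simp)
        simp [this]
      · exact hne m (hsubset m hm)
    · intro m hm
      rcases List.mem_cons.1 hm with rfl | hm
      · have hP0 := hbr P (by rw [hLL]; simp)
        have hQ0 := hbr Q (by rw [hLL]; simp)
        obtain ⟨P', rfl⟩ : ∃ P', P = P' ++ [a] := by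
          rcases List.eq_nil_or_concat P with rfl | ⟨P', c, rfl⟩
          · simp at hPa
          · simp at hPa; exact ⟨P', by simp [hPa]⟩
        obtain ⟨Q', rfl⟩ : ∃ Q', Q = b :: Q' := by
          cases Q with
          | nil => simp at hQb
          | cons c Q' => simp at hQb; exact ⟨Q', by simp [hQb]⟩
        rw [breaks_append, hP0, hQ0, if_pos hab]
      · exact hbr m (hsubset m hm)
    · refine List.Perm.trans ?_ hp
      rw [hLL]
      simp only [List.flatten_append, List.flatten_cons]
      rw [← Multiset.coe_eq_coe]
      simp only [← Multiset.coe_add]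
      abel

end Lists

/-! ### Filling the gaps between blocks by Hall's theorem -/

section Separators

variable {W : Type*} [DecidableEq W]

/-- Disjoint lists can be chosen one after the other. -/
theorem exists_disjoint_lists {ι : Type*} [DecidableEq ι] (I : Finset ι) (P : ι → List W → Prop)
    (wt : ι → ℕ) (K : ℕ) (hlen : ∀ i l, P i l → l.length = wt i) (hK : ∑ i ∈ I, wt i ≤ K)
    (h : ∀ i ∈ I, ∀ B : Finset W, #B ≤ K → ∃ l, P i l ∧ ∀ w ∈ l, w ∉ B) :
    ∃ f : ι → List W, (∀ i ∈ I, P i (f i)) ∧ ∀ i ∈ I, ∀ j ∈ I, i ≠ j → ∀ w ∈ f i, w ∉ f j := by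
  induction I using Finset.induction_on with
  | empty => exact ⟨fun _ => [], by simp, by simp⟩
  | insert i I hi ih =>
    rw [sum_insert hi] at hK
    obtain ⟨f, hf1, hf2⟩ := ih (by omega) fun j hj => h j (mem_insert_of_mem hj)
    obtain ⟨l, hl1, hl2⟩ := h i (mem_insert_self _ _) (I.biUnion fun j => (f j).toFinset) (by
      refine card_biUnion_le.trans (le_trans (sum_le_sum fun j hj => ?_) (by omega : ∑ i ∈ I, wt i ≤ K))
      rw [← hlen j _ (hf1 j hj)]
      exact List.toFinset_card_le _)
    have hne : ∀ j ∈ I, j ≠ i := fun j hj hji => hi (hji ▸ hj)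
    refine ⟨Function.update f i l, ?_, ?_⟩
    · intro j hj
      rcases mem_insert.1 hj with rfl | hj
      · simpa using hl1
      · rw [Function.update_of_ne (hne j hj)]; exact hf1 j hj
    · have key : ∀ j ∈ I, ∀ w ∈ l, w ∉ f j := fun j hj w hw hwj =>
        hl2 w hw (mem_biUnion.2 ⟨j, hj, List.mem_toFinset.2 hwj⟩)
      intro j hj j' hj' hjj'
      rcases mem_insert.1 hj with rfl | hjI <;> rcases mem_insert.1 hj' with rfl | hjI'
      · exact absurd rfl hjj'
      · rw [Function.update_self, Function.update_of_ne (hne j' hjI')]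
        exact key j' hjI'
      · rw [Function.update_self, Function.update_of_ne (hne j hjI)]
        exact fun w hw hwl => key j hjI w hwl hw
      · rw [Function.update_of_ne (hne j hjI), Function.update_of_ne (hne j' hjI')]
        exact hf2 j hjI j' hjI' hjj'

/-- Any two disjoint subsets of `V` with at least `t` elements are joined by an edge. -/
def JoinsLarge (H : SimpleGraph W) (V : Finset W) (t : ℕ) : Prop :=
  ∀ A B : Finset W, A ⊆ V → B ⊆ V → Disjoint A B → t ≤ #A → t ≤ #B → ∃ a ∈ A, ∃ b ∈ B, H.Adj a b

theorem JoinsLarge.exists_adj {H : SimpleGraph W} {V Z : Finset W} {t : ℕ} (h : JoinsLarge H V t)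
    (hZ : Z ⊆ V) (ht : 2 * t ≤ #Z) : ∃ a ∈ Z, ∃ b ∈ Z, H.Adj a b := by
  obtain ⟨A, hA, hAt⟩ := exists_subset_card_eq (s := Z) (n := t) (by omega)
  obtain ⟨a, ha, b, hb, hab⟩ := h A (Z \ A) (hA.trans hZ) (sdiff_subset.trans hZ) disjoint_sdiff
    hAt.ge (by rw [card_sdiff_of_subset hA]; omega)
  exact ⟨a, hA ha, b, sdiff_subset hb, hab⟩

open Classical in
-- The vertices of `B` without a neighbour in `A` number fewer than `t`, as they are not joined to
-- `A`.
theorem JoinsLarge.card_filter {H : SimpleGraph W} {V A B : Finset W} {t : ℕ}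
    (h : JoinsLarge H V t) (hA : A ⊆ V) (hB : B ⊆ V) (hAB : Disjoint A B) (hAt : t ≤ #A)
    (hBt : 2 * t ≤ #B) : t ≤ #{b ∈ B | ∃ a ∈ A, H.Adj a b} := by
  by_contra hc
  obtain ⟨a, ha, b, hb, hab⟩ := h A (B \ {b ∈ B | ∃ a ∈ A, H.Adj a b}) hA
    (sdiff_subset.trans hB) (hAB.mono_right sdiff_subset) hAt
    (by rw [card_sdiff_of_subset (filter_subset _ _)]; omega)
  simp only [mem_sdiff, mem_filter, not_and, not_exists] at hb
  exact hb.2 hb.1 a ha hab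

/-- A large set contains a path on four vertices. -/
theorem JoinsLarge.exists_path {H : SimpleGraph W} {V Z : Finset W} {t : ℕ}
    (h : JoinsLarge H V t) (hZ : Z ⊆ V) (ht : 6 * t ≤ #Z) :
    ∃ a b c d, a ∈ Z ∧ b ∈ Z ∧ c ∈ Z ∧ d ∈ Z ∧ [a, b, c, d].Nodup ∧
      H.Adj a b ∧ H.Adj b c ∧ H.Adj c d := by
  classical
  -- Disjoint sets `A, B, C, D` of sizes `t, 2t, 2t, t`: at least `t` vertices of `B` have a
  -- neighbour in `A` and at least `t` of `C` have one in `D`. An edge between these two sets is the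
  -- middle of the path.
  obtain ⟨A, hA, hAt⟩ := exists_subset_card_eq (s := Z) (n := t) (by omega)
  obtain ⟨B, hB, hBt⟩ := exists_subset_card_eq (s := Z \ A) (n := 2 * t) (by
    rw [card_sdiff_of_subset hA]; omega)
  obtain ⟨C, hC, hCt⟩ := exists_subset_card_eq (s := (Z \ A) \ B) (n := 2 * t) (by
    rw [card_sdiff_of_subset hB, card_sdiff_of_subset hA]; omega)
  obtain ⟨D, hD, hDt⟩ := exists_subset_card_eq (s := ((Z \ A) \ B) \ C) (n := t) (by
    rw [card_sdiff_of_subset hC, card_sdiff_of_subset hB, card_sdiff_of_subset hA]; omega)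
  have hBZ : B ⊆ Z := hB.trans sdiff_subset
  have hCZ : C ⊆ Z := hC.trans (sdiff_subset.trans sdiff_subset)
  have hDZ : D ⊆ Z := hD.trans (sdiff_subset.trans (sdiff_subset.trans sdiff_subset))
  have dis : ∀ {X Y : Finset W}, (∀ x ∈ X, x ∉ Y) → Disjoint X Y := fun h => disjoint_left.2 h
  have hB' := fun x (hx : x ∈ B) => mem_sdiff.1 (hB hx)
  have hC' := fun x (hx : x ∈ C) => mem_sdiff.1 (hC hx)
  have hC'' := fun x (hx : x ∈ C) => mem_sdiff.1 (hC' x hx).1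
  have hD' := fun x (hx : x ∈ D) => mem_sdiff.1 (hD hx)
  have hD'' := fun x (hx : x ∈ D) => mem_sdiff.1 (hD' x hx).1
  have hD3 := fun x (hx : x ∈ D) => mem_sdiff.1 (hD'' x hx).1
  have h1 := h.card_filter (hA.trans hZ) (hBZ.trans hZ)
    (dis fun x hx hxB => (hB' x hxB).2 hx) hAt.ge hBt.ge
  have h2 := h.card_filter (hDZ.trans hZ) (hCZ.trans hZ)
    (dis fun x hx hxC => (hD' x hx).2 hxC) hDt.ge hCt.ge
  obtain ⟨b, hb, c, hc, hbc⟩ := h _ _ ((filter_subset _ _).trans (hBZ.trans hZ))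
    ((filter_subset _ _).trans (hCZ.trans hZ))
    (dis fun x hx hxC => (hC' x (mem_filter.1 hxC).1).2 (mem_filter.1 hx).1) h1 h2
  obtain ⟨hbB, a, ha, hab⟩ := mem_filter.1 hb
  obtain ⟨hcC, d, hd, hdc⟩ := mem_filter.1 hc
  refine ⟨a, b, c, d, hA ha, hBZ hbB, hCZ hcC, hDZ hd, ?_, hab, hbc, hdc.symm⟩
  have e1 : a ≠ c := fun e => (hC'' c hcC).2 (e ▸ ha)
  have e2 : a ≠ d := fun e => (hD3 d hd).2 (e ▸ ha)
  have e3 : b ≠ d := fun e => (hD'' d hd).2 (e ▸ hbB)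
  simp [hab.ne, hbc.ne, hdc.ne.symm, e1, e2, e3]

/-- The three kinds of lists that are put at a position between two consecutive blocks: a single
vertex (only at the positions in `St`), an edge, or a path on four vertices around a vertex of
`Ex`. -/
def IsSeparator (H : SimpleGraph W) (Z : Finset W) (Nu : W → Finset W) (Ex : Finset W)
    (strong : Prop) (s : List W) : Prop :=
  (strong ∧ ∃ v ∈ Z, s = [v]) ∨
  (∃ v ∈ Z, ∃ v' ∈ Z, H.Adj v v' ∧ s = [v, v']) ∨
  (∃ u ∈ Ex, ∃ a ∈ Z ∩ Nu u, ∃ b ∈ Z ∩ Nu u, ∃ c ∈ Z ∩ Nu u, ∃ d ∈ Z ∩ Nu u,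
    H.Adj a b ∧ H.Adj b c ∧ H.Adj c d ∧ s = [a, b, u, c, d])

/-- Hall's theorem is used twice, with a greedy choice in between. Each vertex of `Ex` gets its own
gap in `St` and four vertices of `V`. Further `D` gaps get an edge, and every other gap gets one
vertex. The total `(r - #Ex - D) + 4 * #Ex + 2 * D` is the size of `V` in `hn`. By `hab`, each set
used stays larger than `6t` minus nothing: removing all vertices already taken leaves at least `6t`.
-/
theorem exists_separators {H : SimpleGraph W} {V Ex : Finset W} {Nu : W → Finset W}
    {r t a b D : ℕ} {Z : ℕ → Finset W} {St : Finset ℕ} (hSt : St ⊆ range r)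
    (hZ : ∀ i < r, Z i ⊆ V) (ha : ∀ i < r, a ≤ #(Z i)) (hV : JoinsLarge H V t)
    (hX : ∀ X ⊆ V, t ≤ #X → #{i ∈ St | Disjoint (Z i) X} ≤ t)
    (hu : ∀ u ∈ Ex, #{i ∈ St | #(Z i ∩ Nu u) < a} ≤ t)
    (hv : ∀ v ∈ V, b ≤ #{i ∈ St | v ∈ Z i})
    (hn : #V = r + 3 * #Ex + D) (hD : r ≤ #St + D) (hab : 4 * #Ex + 2 * D + 6 * t ≤ a)
    (hb : t + #Ex + D ≤ b) (hbS : b ≤ #St) :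
    ∃ sep : ℕ → List W, (∀ i < r, IsSeparator H (Z i) Nu Ex (i ∈ St) (sep i)) ∧
      (∀ v ∈ V ∪ Ex, ∃ i < r, v ∈ sep i) ∧ ∑ i ∈ range r, (sep i).length = #V + #Ex := by
  classical
  have hStr : #St ≤ r := by simpa using card_le_card hSt
  -- Each single `u` already has `#St - t ≥ #Ex` admissible gaps, which gives Hall's condition.
  obtain ⟨pos, hpinj, hpos⟩ := (all_card_le_biUnion_card_iff_exists_injective
    (fun u : Ex => {i ∈ St | a ≤ #(Z i ∩ Nu u)})).1 (by
      intro s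
      rcases s.eq_empty_or_nonempty with rfl | ⟨u, hus⟩
      · simp
      · have h1 : #s ≤ #Ex := by simpa using card_le_univ s
        have h2 := hu u u.2
        have h3 := card_filter_add_card_filter_not (s := St) (fun i => #(Z i ∩ Nu u) < a)
        simp only [not_lt] at h3
        exact le_trans (by omega) (card_le_card (subset_biUnion_of_mem
          (fun u : Ex => {i ∈ St | a ≤ #(Z i ∩ Nu u)}) hus)))
  set PG : Finset ℕ := univ.image pos with hPG
  have hPGcard : #PG = #Ex := by rw [hPG, card_image_of_injective _ hpinj]; simp
  have hPGSt : PG ⊆ St := by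
    intro i hi
    obtain ⟨u, -, rfl⟩ := mem_image.1 hi
    exact (mem_filter.1 (hpos u)).1
  -- The gaps that get an edge include all gaps outside `St`, where a single vertex is not allowed.
  obtain ⟨DD, hDD1, hDD2, hDDcard⟩ := exists_subsuperset_card_eq (s := range r \ St)
    (t := range r \ PG) (n := D) (sdiff_subset_sdiff subset_rfl hPGSt)
    (by rw [card_sdiff_of_subset hSt, card_range]; omega)
    (by rw [card_sdiff_of_subset (hPGSt.trans hSt), card_range]; omega)
  have hdisj : Disjoint PG DD := disjoint_left.2 fun i hi hiD => (mem_sdiff.1 (hDD2 hiD)).2 hi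
  set P : ℕ → List W → Prop := fun i l => l.Nodup ∧
    ((i ∈ DD ∧ ∃ v ∈ Z i, ∃ v' ∈ Z i, H.Adj v v' ∧ l = [v, v']) ∨
    (i ∈ PG ∧ ∃ u : Ex, pos u = i ∧ ∃ a ∈ Z i ∩ Nu u, ∃ b ∈ Z i ∩ Nu u, ∃ c ∈ Z i ∩ Nu u,
      ∃ d ∈ Z i ∩ Nu u, H.Adj a b ∧ H.Adj b c ∧ H.Adj c d ∧ l = [a, b, c, d])) with hP
  have hsumwt : ∑ i ∈ PG ∪ DD, (if i ∈ DD then 2 else 4) = 4 * #Ex + 2 * D := by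
    rw [sum_union hdisj, sum_congr rfl (g := fun _ => 4) fun i hi => ?_,
      sum_congr (s₁ := DD) rfl (g := fun _ => 2) fun i hi => if_pos hi]
    · simp only [sum_const, smul_eq_mul, hPGcard, hDDcard]; ring
    · exact if_neg (disjoint_left.1 hdisj hi)
  have hIr : PG ∪ DD ⊆ range r := union_subset (hPGSt.trans hSt) (hDD2.trans sdiff_subset)
  obtain ⟨f, hf1, hf2⟩ := exists_disjoint_lists (PG ∪ DD) P (fun i => if i ∈ DD then 2 else 4)
    (4 * #Ex + 2 * D) (by
      rintro i l ⟨-, ⟨hi, v, -, v', -, -, rfl⟩ | ⟨hi, u, -, a, -, b, -, c, -, d, -, -, -, -, rfl⟩⟩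
      · simp [hi]
      · simp [disjoint_left.1 hdisj hi]) hsumwt.le (by
      intro i hi B hB
      have hir := mem_range.1 (hIr hi)
      rcases mem_union.1 hi with hi | hi
      · obtain ⟨u, -, rfl⟩ := mem_image.1 hi
        have h1 := (mem_filter.1 (hpos u)).2
        have h2 := le_card_sdiff B (Z (pos u) ∩ Nu u)
        obtain ⟨a, b, c, d, ha', hb', hc', hd', hnd, h3, h4, h5⟩ := hV.exists_path
          (Z := (Z (pos u) ∩ Nu u) \ B) (sdiff_subset.trans (inter_subset_left.trans (hZ _ hir)))
          (by omega)
        rw [mem_sdiff] at ha' hb' hc' hd'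
        refine ⟨[a, b, c, d], ⟨hnd, Or.inr ⟨hi, u, rfl, a, ha'.1, b, hb'.1, c, hc'.1, d, hd'.1,
          h3, h4, h5, rfl⟩⟩, ?_⟩
        simp [ha'.2, hb'.2, hc'.2, hd'.2]
      · have h1 := ha i hir
        have h2 := le_card_sdiff B (Z i)
        obtain ⟨v, hv, v', hv', hadj⟩ := hV.exists_adj (Z := Z i \ B)
          (sdiff_subset.trans (hZ _ hir)) (by omega)
        rw [mem_sdiff] at hv hv'
        exact ⟨[v, v'], ⟨by simpa using hadj.ne, Or.inl ⟨hi, v, hv.1, v', hv'.1, hadj, rfl⟩⟩,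
          by simp [hv.2, hv'.2]⟩)
  set Us := (PG ∪ DD).biUnion fun i => (f i).toFinset with hUs
  have hflen : ∀ i ∈ PG ∪ DD, (f i).length = if i ∈ DD then 2 else 4 := by
    intro i hi
    obtain ⟨-, ⟨hi, v, -, v', -, -, h⟩ | ⟨hi, u, -, a, -, b, -, c, -, d, -, -, -, -, h⟩⟩ := hf1 i hi
    · simp [hi, h]
    · simp [disjoint_left.1 hdisj hi, h]
  have hUscard : #Us = 4 * #Ex + 2 * D := by
    rw [hUs, card_biUnion fun i hi j hj hij => disjoint_left.2 fun w hw hw' =>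
      hf2 i hi j hj hij w (List.mem_toFinset.1 hw) (List.mem_toFinset.1 hw'), ← hsumwt]
    exact sum_congr rfl fun i hi => by
      rw [List.toFinset_card_of_nodup (hf1 i hi).1, hflen i hi]
  have hUsV : Us ⊆ V := by
    intro w hw
    obtain ⟨i, hi, hw⟩ := mem_biUnion.1 hw
    have hir := mem_range.1 (hIr hi)
    apply hZ i hir
    obtain ⟨-, ⟨-, v, hv, v', hv', -, h⟩ | ⟨-, u, -, a, ha, b, hb, c, hc, d, hd, -, -, -, h⟩⟩ :=
      hf1 i hi
    · rw [h] at hw; simp at hw; rcases hw with rfl | rfl <;> assumption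
    · rw [mem_inter] at ha hb hc hd
      rw [h] at hw; simp at hw; rcases hw with rfl | rfl | rfl | rfl <;> tauto
  have hIcard : #(PG ∪ DD) = #Ex + D := by rw [card_union_of_disjoint hdisj, hPGcard, hDDcard]
  set X := V \ Us with hXdef
  have hXcard : #X = r - (#Ex + D) := by rw [hXdef, card_sdiff_of_subset hUsV]; omega
  set Y := range r \ (PG ∪ DD) with hY
  have hYcard : #Y = #X := by rw [hY, card_sdiff_of_subset hIr, card_range, hXcard, hIcard]
  have hYSt : Y ⊆ St := by
    intro i hi
    by_contra hiS
    rw [hY, mem_sdiff] at hi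
    exact hi.2 (mem_union_right _ (hDD1 (mem_sdiff.2 ⟨hi.1, hiS⟩)))
  -- Suppose that a set `s` of gaps sees a set `NS` with `#NS < #s`. One gap shows `t ≤ #NS`. If `X
  -- \ NS` had `t` elements, at most `t` gaps would avoid it, so `#s ≤ t`, a contradiction.
  -- Otherwise fewer than `t` vertices are missed. One of them lies in at least `b` sets `Z i`, all
  -- with `i` outside `s`, and fewer than `t + #Ex + D` gaps of `St` lie there.
  obtain ⟨φ, hφinj, hφ⟩ := (all_card_le_biUnion_card_iff_exists_injective
    (fun i : Y => Z i ∩ X)).1 (by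
      intro s
      by_contra! hlt
      set NS := s.biUnion fun i : Y => Z i ∩ X with hNS
      obtain ⟨i, his⟩ : s.Nonempty := by
        rw [nonempty_iff_ne_empty]; rintro rfl; simp at hlt
      have hiY := mem_range.1 (mem_sdiff.1 i.2).1
      have h1 : t ≤ #NS := by
        have h2 : #(Z i ∩ X) ≤ #NS := card_le_card (subset_biUnion_of_mem
          (fun i : Y => Z i ∩ X) his)
        have h3 : Z i ∩ X = Z i \ Us := by
          ext w; simp only [mem_inter, hXdef, mem_sdiff]
          exact ⟨fun h => ⟨h.1, h.2.2⟩, fun h => ⟨h.1, hZ _ hiY h.1, h.2⟩⟩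
        have h4 := le_card_sdiff Us (Z i)
        have h5 := ha i hiY
        rw [h3] at h2
        omega
      have hNSX : NS ⊆ X := biUnion_subset.2 fun i _ => inter_subset_right
      have hsd := card_sdiff_of_subset hNSX
      have hsY : #s ≤ #Y := by simpa using card_le_univ s
      have himg : #(s.image Subtype.val) = #s := card_image_of_injective _ Subtype.val_injective
      have h6 : #(X \ NS) < t := by
        by_contra! hge
        have h7 := hX (X \ NS) (sdiff_subset.trans sdiff_subset) hge
        have h8 : s.image Subtype.val ⊆ {i ∈ St | Disjoint (Z i) (X \ NS)} := by
          intro j hj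
          obtain ⟨j, hjs, rfl⟩ := mem_image.1 hj
          refine mem_filter.2 ⟨hYSt j.2, disjoint_left.2 fun w hw hw' => ?_⟩
          rw [mem_sdiff] at hw'
          exact hw'.2 (mem_biUnion.2 ⟨j, hjs, mem_inter.2 ⟨hw, hw'.1⟩⟩)
        have h9 := card_le_card h8
        omega
      obtain ⟨v, hvX⟩ : (X \ NS).Nonempty := card_pos.1 (by omega)
      rw [mem_sdiff] at hvX
      have h7 := hv v (sdiff_subset hvX.1)
      have h8 : {i ∈ St | v ∈ Z i} ⊆ (Y \ s.image Subtype.val) ∪ (PG ∪ DD) := by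
        intro j hj
        rw [mem_filter] at hj
        by_cases hjI : j ∈ PG ∪ DD
        · exact mem_union_right _ hjI
        · refine mem_union_left _ (mem_sdiff.2 ⟨mem_sdiff.2 ⟨hSt hj.1, hjI⟩, fun hjs => ?_⟩)
          obtain ⟨j', hj's, rfl⟩ := mem_image.1 hjs
          exact hvX.2 (mem_biUnion.2 ⟨j', hj's, mem_inter.2 ⟨hj.2, hvX.1⟩⟩)
      have h9 := (card_le_card h8).trans (card_union_le _ _)
      rw [card_sdiff_of_subset (fun j hj => by
        obtain ⟨j, -, rfl⟩ := mem_image.1 hj; exact j.2), himg] at h9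
      omega)
  have hφsurj : univ.image φ = X := eq_of_subset_of_card_le (fun w hw => by
      obtain ⟨i, -, rfl⟩ := mem_image.1 hw; exact (mem_inter.1 (hφ i)).2)
    (by rw [card_image_of_injective _ hφinj, ← hYcard]; simp)
  have hsep : ∀ i, ∃ s : List W, i < r → IsSeparator H (Z i) Nu Ex (i ∈ St) s ∧
      (∀ hi : i ∈ Y, s = [φ ⟨i, hi⟩]) ∧ (i ∈ PG ∪ DD → ∀ w ∈ f i, w ∈ s) ∧
      (∀ u : Ex, pos u = i → (u : W) ∈ s) ∧
      s.length = if i ∈ Y then 1 else if i ∈ DD then 2 else 5 := by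
    intro i
    by_cases hir : i < r
    swap
    · exact ⟨[], fun h => absurd h hir⟩
    by_cases hiY : i ∈ Y
    · have hiI := (mem_sdiff.1 hiY).2
      exact ⟨[φ ⟨i, hiY⟩], fun _ => ⟨Or.inl ⟨hYSt hiY, _, (mem_inter.1 (hφ ⟨i, hiY⟩)).1, rfl⟩,
        fun _ => rfl, fun h => absurd h hiI,
        fun u hu => absurd (mem_union_left _ (mem_image.2 ⟨u, mem_univ _, hu⟩)) hiI,
        by simp [hiY]⟩⟩
    · have hiI : i ∈ PG ∪ DD := by
        by_contra hI; exact hiY (mem_sdiff.2 ⟨mem_range.2 hir, hI⟩)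
      obtain ⟨-, ⟨hi, v, hv, v', hv', hadj, h⟩ |
        ⟨hi, u, hui, a, ha, b, hb, c, hc, d, hd, h1, h2, h3, h⟩⟩ := hf1 i hiI
      · refine ⟨[v, v'], fun _ => ⟨Or.inr (Or.inl ⟨v, hv, v', hv', hadj, rfl⟩),
          fun h => absurd h hiY, fun _ w hw => h ▸ hw, fun u hu => ?_, by simp [hiY, hi]⟩⟩
        exact absurd hi (disjoint_left.1 hdisj (mem_image.2 ⟨u, mem_univ _, hu⟩))
      · refine ⟨[a, b, u, c, d], fun _ => ⟨Or.inr (Or.inr ⟨u, u.2, a, ha, b, hb, c, hc, d, hd, h1,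
          h2, h3, rfl⟩), fun h => absurd h hiY, fun _ w hw => ?_, fun u' hu' => ?_, ?_⟩⟩
        · rw [h] at hw; simp at hw ⊢; tauto
        · have := hpinj (hui.trans hu'.symm); simp [this]
        · simp [hiY, disjoint_left.1 hdisj hi]
  choose sep hsep using hsep
  refine ⟨sep, fun i hi => (hsep i hi).1, ?_, ?_⟩
  · intro v hvm
    rcases mem_union.1 hvm with hvV | hvE
    · by_cases hvU : v ∈ Us
      · obtain ⟨i, hi, hw⟩ := mem_biUnion.1 hvU
        have hir := mem_range.1 (hIr hi)
        exact ⟨i, hir, (hsep i hir).2.2.1 hi v (List.mem_toFinset.1 hw)⟩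
      · have : v ∈ X := mem_sdiff.2 ⟨hvV, hvU⟩
        rw [← hφsurj] at this
        obtain ⟨i, -, hi⟩ := mem_image.1 this
        have hir := mem_range.1 (mem_sdiff.1 i.2).1
        exact ⟨i, hir, by rw [(hsep i hir).2.1 i.2]; simp [hi]⟩
    · have hi : pos ⟨v, hvE⟩ ∈ PG := mem_image.2 ⟨_, mem_univ _, rfl⟩
      have hir := mem_range.1 (hSt (hPGSt hi))
      exact ⟨_, hir, (hsep _ hir).2.2.2.1 ⟨v, hvE⟩ rfl⟩
  · have h1 : ∑ i ∈ range r, (sep i).length =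
        ∑ i ∈ range r, if i ∈ Y then 1 else if i ∈ DD then 2 else 5 :=
      sum_congr rfl fun i hi => (hsep i (mem_range.1 hi)).2.2.2.2
    have h2 : range r = Y ∪ (PG ∪ DD) := by rw [hY, sdiff_union_of_subset hIr]
    have hYI : Disjoint Y (PG ∪ DD) := sdiff_disjoint
    rw [h1, h2, sum_union hYI, sum_union hdisj, sum_congr rfl (g := fun _ => 1) fun i hi => if_pos hi,
      sum_congr (s₁ := PG) rfl (g := fun _ => 5) fun i hi => ?_,
      sum_congr (s₁ := DD) rfl (g := fun _ => 2) fun i hi => ?_]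
    · simp only [sum_const, smul_eq_mul, hPGcard, hDDcard, hYcard, hXcard]; omega
    · rw [if_neg (disjoint_right.1 hYI (mem_union_right _ hi)), if_pos hi]
    · rw [if_neg (disjoint_right.1 hYI (mem_union_left _ hi)),
        if_neg (disjoint_left.1 hdisj hi)]

end Separators

/-! ### Squares of paths as lists, and weaving blocks with separators -/

section SquareLists

variable {W : Type*}

/-- Any two entries of the list at distance at most two are in the relation `A`. -/
def SqChain (A : W → W → Prop) : List W → Prop
  | [] => True
  | a :: l => (∀ c ∈ l.take 2, A a c) ∧ SqChain A l

theorem SqChain.getElem {A : W → W → Prop} {l : List W} (h : SqChain A l) {i j : ℕ}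
    (hi : i < l.length) (hj : j < l.length) (hij : i < j) (hji : j ≤ i + 2) : A l[i] l[j] := by
  induction l generalizing i j with
  | nil => simp at hi
  | cons a l ih =>
    obtain ⟨j, rfl⟩ : ∃ j', j = j' + 1 := ⟨j - 1, by omega⟩
    cases i with
    | zero =>
      have hj' : j < l.length := by simpa using hj
      refine h.1 _ ?_
      simp only [List.getElem_cons_succ]
      have : l[j] = (l.take 2)[j]'(by simp; omega) := by simp
      rw [this]
      exact List.getElem_mem _
    | succ i =>
      simp only [List.getElem_cons_succ]
      exact ih h.2 _ _ (by omega) (by omega)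

/-- The condition has range two, so an overlap of two entries leaves no pair to be checked across
the seam. -/
theorem SqChain.glue {A : W → W → Prop} {l m : List W} {a b : W} (h : SqChain A (l ++ [a, b]))
    (h' : SqChain A (a :: b :: m)) : SqChain A (l ++ a :: b :: m) := by
  induction l with
  | nil => exact h'
  | cons c l ih =>
    refine ⟨?_, ih h.2⟩
    have h1 := h.1
    match l with
    | [] => simpa using h1
    | [d] => simpa using h1
    | d :: e :: l => simpa using h1

theorem sqChain_of_getElem {A : W → W → Prop} {l : List W}
    (h : ∀ (i j : ℕ) (hi : i < l.length) (hj : j < l.length), i < j → j ≤ i + 2 → A l[i] l[j]) :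
    SqChain A l := by
  induction l with
  | nil => trivial
  | cons a l ih =>
    refine ⟨fun c hc => ?_, ih fun i j hi hj hij hji => ?_⟩
    · obtain ⟨i, hi, rfl⟩ := List.getElem_of_mem hc
      simp only [List.length_take] at hi
      have := h 0 (i + 1) (by simp) (by simp; omega) (by omega) (by omega)
      simpa using this
    · exact h (i + 1) (j + 1) (Nat.succ_lt_succ hi) (Nat.succ_lt_succ hj) (by omega) (by omega)

/-- The blocks `blk 0, …, blk i` with the lists `sep 0, …, sep (i - 1)` between them. -/
def weave (blk sep : ℕ → List W) : ℕ → List W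
  | 0 => blk 0
  | i + 1 => weave blk sep i ++ (sep i ++ blk (i + 1))

theorem mem_weave {blk sep : ℕ → List W} {i : ℕ} {w : W} :
    w ∈ weave blk sep i ↔ (∃ j ≤ i, w ∈ blk j) ∨ ∃ j < i, w ∈ sep j := by
  induction i with
  | zero => simp [weave]
  | succ i ih =>
    simp only [weave, List.mem_append, ih]
    constructor
    · rintro ((⟨j, hj, h⟩ | ⟨j, hj, h⟩) | h | h)
      · exact Or.inl ⟨j, by omega, h⟩
      · exact Or.inr ⟨j, by omega, h⟩
      · exact Or.inr ⟨i, by omega, h⟩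
      · exact Or.inl ⟨i + 1, le_rfl, h⟩
    · rintro (⟨j, hj, h⟩ | ⟨j, hj, h⟩)
      · rcases Nat.lt_or_ge i j with hij | hij
        · obtain rfl : j = i + 1 := by omega
          exact Or.inr (Or.inr h)
        · exact Or.inl (Or.inl ⟨j, hij, h⟩)
      · rcases Nat.lt_or_ge j i with hij | hij
        · exact Or.inl (Or.inr ⟨j, hij, h⟩)
        · obtain rfl : j = i := by omega
          exact Or.inr (Or.inl h)

theorem length_weave {blk sep : ℕ → List W} {k : ℕ} (hb : ∀ i, (blk i).length = k) (i : ℕ) :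
    (weave blk sep i).length = k * (i + 1) + ∑ j ∈ range i, (sep j).length := by
  induction i with
  | zero => simp [weave, hb]
  | succ i ih => simp only [weave, List.length_append, ih, hb, sum_range_succ]; ring

theorem sqChain_weave {A : W → W → Prop} {blk sep : ℕ → List W} {f f' p q : ℕ → W} {x x' y y' : W}
    {r : ℕ} (hf : ∀ i, ∃ s, blk i = f i :: f' i :: s) (hp : ∀ i, ∃ s, blk i = s ++ [p i, q i])
    (hb : ∀ i ≤ r, SqChain A (blk i)) (hx : SqChain A [x', x, f 0, f' 0])
    (hy : SqChain A [p r, q r, y, y'])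
    (hs : ∀ i < r, SqChain A (p i :: q i :: (sep i ++ [f (i + 1), f' (i + 1)]))) :
    SqChain A (x' :: x :: weave blk sep r ++ [y, y']) := by
  have key : ∀ i ≤ r, SqChain A (x' :: x :: weave blk sep i) ∧
      ∃ s, x' :: x :: weave blk sep i = s ++ [p i, q i] := by
    intro i
    induction i with
    | zero =>
      intro _
      obtain ⟨s, hs⟩ := hf 0
      obtain ⟨s', hs'⟩ := hp 0
      refine ⟨?_, x' :: x :: s', by simp [weave, hs']⟩
      simp only [weave, hs]
      exact SqChain.glue (l := [x', x]) hx (hs ▸ hb 0 (Nat.zero_le _))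
    | succ i ih =>
      intro hi
      obtain ⟨h1, s, h2⟩ := ih (by omega)
      obtain ⟨t, ht⟩ := hf (i + 1)
      obtain ⟨t', ht'⟩ := hp (i + 1)
      have e : x' :: x :: weave blk sep (i + 1) = (x' :: x :: weave blk sep i) ++
        (sep i ++ blk (i + 1)) := rfl
      rw [e]
      refine ⟨?_, (x' :: x :: weave blk sep i) ++ (sep i ++ t'), by simp [ht']⟩
      rw [h2] at h1 ⊢
      rw [List.append_assoc]
      refine SqChain.glue h1 ?_
      rw [ht]
      exact SqChain.glue (l := p i :: q i :: sep i) (by simpa using hs i (by omega))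
        (ht ▸ hb (i + 1) hi)
  obtain ⟨h1, s, h2⟩ := key r le_rfl
  rw [h2] at h1 ⊢
  rw [List.append_assoc]
  exact SqChain.glue h1 hy

open Classical in
-- Blocks and separators need not be shown disjoint: a list of length `#S` that contains all of `S`
-- has no repetition and no other entry.
theorem hasSquareHamPath_of_weave {H : SimpleGraph W} {S : Finset W} {blk sep : ℕ → List W}
    {f f' p q : ℕ → W} {x x' y y' : W} {r k : ℕ} (hk : ∀ i, (blk i).length = k)
    (hf : ∀ i, ∃ s, blk i = f i :: f' i :: s) (hp : ∀ i, ∃ s, blk i = s ++ [p i, q i])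
    (hb : ∀ i ≤ r, SqChain H.Adj (blk i))
    (hx : H.Adj x' (f 0) ∧ H.Adj x (f 0) ∧ H.Adj x (f' 0))
    (hy : H.Adj (p r) y ∧ H.Adj (q r) y ∧ H.Adj (q r) y')
    (hs : ∀ i < r, SqChain H.Adj (p i :: q i :: (sep i ++ [f (i + 1), f' (i + 1)])))
    (hmem : ∀ w ∈ S, w ∈ x' :: x :: weave blk sep r ++ [y, y'])
    (hcard : k * (r + 1) + ∑ j ∈ range r, (sep j).length + 4 = #S) :
    HasSquareHamPath H S x x' y y' := by
  set l := x' :: x :: weave blk sep r ++ [y, y'] with hl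
  have hlen : l.length = #S := by
    rw [← hcard, hl]; simp [length_weave hk]
  have hSl : S ⊆ l.toFinset := fun w hw => List.mem_toFinset.2 (hmem w hw)
  have hle : #l.toFinset ≤ #S := hlen ▸ List.toFinset_card_le l
  have hSeq : S = l.toFinset := eq_of_subset_of_card_le hSl hle
  have hnd : l.Nodup := by
    rw [← Multiset.coe_nodup, ← Multiset.toFinset_card_eq_card_iff_nodup]
    simp only [Multiset.coe_card, hlen]
    conv_rhs => rw [hSeq]
    rfl
  -- This relation grants the two end pairs, which are exempt, so that the gluing can ignore the
  -- exception.
  set A : W → W → Prop := fun a b => s(a, b) = s(x, x') ∨ s(a, b) = s(y, y') ∨ H.Adj a b with hA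
  have mono : ∀ m : List W, SqChain H.Adj m → SqChain A m := by
    intro m
    induction m with
    | nil => exact fun h => h
    | cons a m ih => exact fun h => ⟨fun c hc => Or.inr (Or.inr (h.1 c hc)), ih h.2⟩
  have hff : H.Adj (f 0) (f' 0) := by
    obtain ⟨s, hs⟩ := hf 0
    have := hb 0 (Nat.zero_le _)
    rw [hs] at this
    exact this.1 _ (by simp)
  have hpq : H.Adj (p r) (q r) := by
    obtain ⟨s, hs⟩ := hp r
    have := hb r le_rfl
    rw [hs] at this
    have h2 := this.getElem (i := s.length) (j := s.length + 1) (by simp) (by simp) (by omega)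
      (by omega)
    simpa using h2
  have hsq : SqChain A l := by
    refine sqChain_weave hf hp (fun i hi => mono _ (hb i hi)) ?_ ?_ (fun i hi => mono _ (hs i hi))
    · simp only [SqChain, hA]
      simp [Sym2.eq_swap, hx, hff]
    · simp only [SqChain, hA]
      simp [hy, hpq]
  refine ⟨l, hnd, fun w => ?_, ⟨weave blk sep r ++ [y, y'], by simp [hl]⟩,
    ⟨x' :: x :: weave blk sep r, by simp [hl]⟩, fun i j hi hj hij hji h1 h2 => ?_⟩
  · rw [hSeq, List.mem_toFinset]
  · rcases hsq.getElem hi hj hij hji with h | h | h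
    · exact absurd h h1
    · exact absurd h h2
    · exact h

end SquareLists

/-! ### Expectations over random subsets of a finite set, and Janson's inequality -/

section Bernoulli

set_option linter.unusedSectionVars false

variable {α ι : Type*} [DecidableEq α]

/-- The expectation of `f S`, where `S` is a random subset of `E` that contains every element of
`E` independently with probability `p`. -/
noncomputable def bexp (p : ℝ) (E : Finset α) (f : Finset α → ℝ) : ℝ :=
  ∑ S ∈ E.powerset, p ^ #S * (1 - p) ^ (#E - #S) * f S

theorem bexp_insert (p : ℝ) {E : Finset α} {e : α} (he : e ∉ E) (f : Finset α → ℝ) :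
    bexp p (insert e E) f = p * bexp p E (fun S => f (insert e S)) + (1 - p) * bexp p E f := by
  unfold bexp
  rw [sum_powerset_insert he, add_comm, mul_sum, mul_sum]
  congr 1
  · refine sum_congr rfl fun S hS => ?_
    have hS' := mem_powerset.1 hS
    rw [card_insert_of_notMem fun h => he (hS' h), card_insert_of_notMem he,
      Nat.add_sub_add_right, pow_succ]
    ring
  · refine sum_congr rfl fun S hS => ?_
    have := card_le_card (mem_powerset.1 hS)
    rw [card_insert_of_notMem he, Nat.sub_add_comm this, pow_succ]
    ring

theorem bexp_add (p : ℝ) (E : Finset α) (f g : Finset α → ℝ) :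
    bexp p E (fun S => f S + g S) = bexp p E f + bexp p E g := by
  simp only [bexp, mul_add, sum_add_distrib]

theorem bexp_mul_left (p : ℝ) (E : Finset α) (c : ℝ) (f : Finset α → ℝ) :
    bexp p E (fun S => c * f S) = c * bexp p E f := by
  simp only [bexp, mul_sum]
  exact sum_congr rfl fun S _ => by ring

theorem bexp_sum (p : ℝ) (E : Finset α) (I : Finset ι) (f : ι → Finset α → ℝ) :
    bexp p E (fun S => ∑ i ∈ I, f i S) = ∑ i ∈ I, bexp p E (f i) := by
  simp only [bexp, mul_sum]
  exact sum_comm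

theorem bexp_mono {p : ℝ} (hp0 : 0 ≤ p) (hp1 : p ≤ 1) {E : Finset α} {f g : Finset α → ℝ}
    (h : ∀ S ⊆ E, f S ≤ g S) : bexp p E f ≤ bexp p E g := by
  refine sum_le_sum fun S hS => mul_le_mul_of_nonneg_left (h S (mem_powerset.1 hS)) ?_
  have : 0 ≤ 1 - p := by linarith
  positivity

theorem bexp_const (p : ℝ) (E : Finset α) (c : ℝ) : bexp p E (fun _ => c) = c := by
  induction E using Finset.induction_on with
  | empty => simp [bexp]
  | insert e E he ih => rw [bexp_insert p he, ih]; ring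

theorem bexp_nonneg {p : ℝ} (hp0 : 0 ≤ p) (hp1 : p ≤ 1) {E : Finset α} {f : Finset α → ℝ}
    (h : ∀ S ⊆ E, 0 ≤ f S) : 0 ≤ bexp p E f := by
  rw [← bexp_const p E 0]
  exact bexp_mono hp0 hp1 h

/-- For one element at a time, a larger probability moves weight to the smaller of the two values.
This allows large `p` to be lowered to the threshold. -/
theorem bexp_anti {p q : ℝ} (hq0 : 0 ≤ q) (hqp : q ≤ p) (hp1 : p ≤ 1) {E : Finset α}
    {f : Finset α → ℝ} (hf : Antitone f) : bexp p E f ≤ bexp q E f := by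
  induction E using Finset.induction_on generalizing f with
  | empty => simp [bexp]
  | insert e E he ih =>
    rw [bexp_insert p he, bexp_insert q he]
    have hf' : Antitone fun S => f (insert e S) := fun S T h => hf (insert_subset_insert e h)
    have h1 := ih hf
    have h2 := ih hf'
    have h3 : bexp q E (fun S => f (insert e S)) ≤ bexp q E f :=
      bexp_mono hq0 (hqp.trans hp1) fun S _ => hf (subset_insert e S)
    nlinarith [mul_le_mul_of_nonneg_left h2 (hq0.trans hqp),
      mul_le_mul_of_nonneg_left h1 (sub_nonneg.2 hp1), mul_nonneg (sub_nonneg.2 hqp)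
      (sub_nonneg.2 h3)]

theorem bexp_mem (p : ℝ) {E : Finset α} {e : α} (he : e ∈ E) (f : Finset α → ℝ) :
    bexp p E (fun S => if e ∈ S then f S else 0) = p * bexp p E (fun S => f (insert e S)) := by
  obtain ⟨E', he', rfl⟩ : ∃ E', e ∉ E' ∧ E = insert e E' :=
    ⟨E.erase e, notMem_erase e E, (insert_erase he).symm⟩
  rw [bexp_insert p he', bexp_insert p he']
  have h0 : bexp p E' (fun S => if e ∈ S then f S else 0) = 0 := by
    unfold bexp
    refine sum_eq_zero fun S hS => ?_
    have : e ∉ S := fun h => he' (mem_powerset.1 hS h)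
    simp [this]
  rw [h0]
  simp only [mem_insert_self, if_true, insert_idem]
  ring

/-- Conditioning on `K ⊆ S` amounts to adding `K` to a fresh random set. In this form conditional
probabilities can be avoided. -/
theorem bexp_subset (p : ℝ) {E K : Finset α} (hK : K ⊆ E) (f : Finset α → ℝ) :
    bexp p E (fun S => if K ⊆ S then f S else 0) = p ^ #K * bexp p E (fun S => f (K ∪ S)) := by
  induction K using Finset.induction_on generalizing f with
  | empty => simp
  | insert e K he ih =>
    rw [insert_subset_iff] at hK
    have h1 : (fun S => if insert e K ⊆ S then f S else 0) =
        fun S => if e ∈ S then (if K ⊆ S then f S else 0) else 0 := by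
      funext S; simp only [insert_subset_iff]; split_ifs <;> tauto
    have h2 : (fun S => if K ⊆ insert e S then f (insert e S) else 0) =
        fun S => if K ⊆ S then f (insert e S) else 0 := by
      funext S; simp only [subset_insert_iff_of_notMem he]
    rw [h1, bexp_mem p hK.1, h2, ih hK.2 (fun S => f (insert e S)), card_insert_of_notMem he]
    simp only [insert_union]
    ring

open Classical in
/-- Janson's inequality. -/
theorem janson [DecidableEq ι] {p : ℝ} (hp0 : 0 ≤ p) (hp1 : p ≤ 1) {E : Finset α} (I : Finset ι)
    (K : ι → Finset α) (hK : ∀ i ∈ I, K i ⊆ E) :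
    bexp p E (fun S => if ∀ i ∈ I, ¬ K i ⊆ S then 1 else 0) ≤
      Real.exp (-(∑ i ∈ I, p ^ #(K i)) +
        ∑ i ∈ I, ∑ j ∈ I with j ≠ i ∧ ¬ Disjoint (K i) (K j), p ^ #(K i ∪ K j)) := by
  induction I using Finset.induction_on with
  | empty => simp [bexp_const]
  | insert i I hi ih =>
    have hKi := hK i (mem_insert_self _ _)
    have hKI : ∀ j ∈ I, K j ⊆ E := fun j hj => hK j (mem_insert_of_mem hj)
    -- Each index added to `I` multiplies the probability by at most `exp (-ρ)`. `D₀` keeps only the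
    -- events disjoint from `K i`, hence independent of `K i ⊆ S`. The events left out are handled
    -- by a union bound, with cost `p ^ #(K i ∪ K j)` for each by monotonicity.
    set D : Finset α → ℝ := fun S => if ∀ j ∈ I, ¬ K j ⊆ S then 1 else 0 with hD
    set D₀ : Finset α → ℝ := fun S => if ∀ j ∈ I, Disjoint (K i) (K j) → ¬ K j ⊆ S then 1 else 0
      with hD₀
    set J := {j ∈ I | j ≠ i ∧ ¬ Disjoint (K i) (K j)} with hJ
    set ρ : ℝ := p ^ #(K i) - ∑ j ∈ J, p ^ #(K i ∪ K j) with hρ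
    have hDn : ∀ S, 0 ≤ D S := fun S => by simp only [hD]; split_ifs <;> norm_num
    have hD₀n : ∀ S, 0 ≤ D₀ S := fun S => by simp only [hD₀]; split_ifs <;> norm_num
    have hD₀anti : Antitone D₀ := by
      intro S T hST
      simp only [hD₀]
      split_ifs with h1 h2 <;> norm_num
      exact h2 fun j hj hd hjS => h1 j hj hd (hjS.trans hST)
    have hDD₀ : ∀ S, D S ≤ D₀ S := by
      intro S
      simp only [hD, hD₀]
      split_ifs with h1 h2 <;> norm_num
      exact h2 fun j hj _ => h1 j hj
    have e1 : bexp p E (fun S => if ∀ j ∈ insert i I, ¬ K j ⊆ S then 1 else 0) =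
        bexp p E D - bexp p E (fun S => if K i ⊆ S then D S else 0) := by
      rw [eq_sub_iff_add_eq, ← bexp_add]
      congr 1; funext S
      simp only [hD, mem_insert, forall_eq_or_imp]
      split_ifs <;> first | tauto | norm_num
    have e2 : bexp p E (fun S => if K i ⊆ S then D₀ S else 0) = p ^ #(K i) * bexp p E D₀ := by
      rw [bexp_subset p hKi]
      congr 2; funext S
      simp only [hD₀]
      congr 1
      refine propext (forall₃_congr fun j _ hd => not_congr ⟨fun h => ?_, fun h =>
        h.trans subset_union_right⟩)
      exact fun a ha => (mem_union.1 (h ha)).resolve_left fun ha' => disjoint_left.1 hd ha' ha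
    have e3 : ∀ j ∈ J, bexp p E (fun S => if K i ∪ K j ⊆ S then D₀ S else 0) ≤
        p ^ #(K i ∪ K j) * bexp p E D₀ := by
      intro j hj
      rw [bexp_subset p (union_subset hKi (hKI j (mem_filter.1 hj).1))]
      exact mul_le_mul_of_nonneg_left (bexp_mono hp0 hp1 fun S _ => hD₀anti subset_union_right)
        (by positivity)
    have e4 : bexp p E (fun S => if K i ⊆ S then D₀ S else 0) ≤
        bexp p E (fun S => if K i ⊆ S then D S else 0) +
        ∑ j ∈ J, bexp p E (fun S => if K i ∪ K j ⊆ S then D₀ S else 0) := by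
      rw [← bexp_sum, ← bexp_add]
      refine bexp_mono hp0 hp1 fun S _ => ?_
      have hs : ∀ j ∈ J, 0 ≤ (if K i ∪ K j ⊆ S then D₀ S else 0) := fun j _ => by
        split_ifs; exacts [hD₀n S, le_rfl]
      by_cases hiS : K i ⊆ S
      · simp only [hiS, if_true]
        by_cases hDS : D S = 1
        · have h1 : D₀ S ≤ 1 := by simp only [hD₀]; split_ifs <;> norm_num
          have h2 := sum_nonneg hs
          linarith
        · have hne : ∃ j ∈ I, K j ⊆ S := by
            by_contra! h; exact hDS (if_pos h)
          obtain ⟨j, hj, hjS⟩ := hne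
          by_cases hd : Disjoint (K i) (K j)
          · have : D₀ S = 0 := if_neg fun h => h j hj hd hjS
            have h2 := sum_nonneg hs
            have := hDn S
            linarith
          · have hjJ : j ∈ J := mem_filter.2 ⟨hj, fun h => hi (h ▸ hj), hd⟩
            have h2 := single_le_sum hs hjJ
            rw [if_pos (union_subset hiS hjS)] at h2
            have := hDn S
            linarith
      · simp only [hiS, if_false]
        have := sum_nonneg hs
        linarith
    have e5 := sum_le_sum e3
    rw [← sum_mul] at e5
    have hBD : 0 ≤ bexp p E D := bexp_nonneg hp0 hp1 fun S _ => hDn S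
    have hBDD : bexp p E D ≤ bexp p E D₀ := bexp_mono hp0 hp1 fun S _ => hDD₀ S
    have hlow : bexp p E D * ρ ≤ bexp p E (fun S => if K i ⊆ S then D S else 0) := by
      rcases le_total 0 ρ with h | h
      · have := mul_le_mul_of_nonneg_right hBDD h
        have h2 : bexp p E D₀ * ρ = p ^ #(K i) * bexp p E D₀ -
          (∑ j ∈ J, p ^ #(K i ∪ K j)) * bexp p E D₀ := by rw [hρ]; ring
        linarith
      · refine (mul_nonpos_of_nonneg_of_nonpos hBD h).trans (bexp_nonneg hp0 hp1 fun S _ => ?_)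
        split_ifs; exacts [hDn S, le_rfl]
    have hstep : bexp p E (fun S => if ∀ j ∈ insert i I, ¬ K j ⊆ S then 1 else 0) ≤
        bexp p E D * Real.exp (-ρ) := by
      rw [e1]
      have := mul_le_mul_of_nonneg_left (Real.add_one_le_exp (-ρ)) hBD
      linarith
    refine hstep.trans ((mul_le_mul_of_nonneg_right (ih hKI) (Real.exp_pos _).le).trans ?_)
    rw [← Real.exp_add, Real.exp_le_exp, sum_insert hi, sum_insert hi, hρ]
    have h1 : ∑ j ∈ J, p ^ #(K i ∪ K j) ≤
        ∑ j ∈ insert i I with j ≠ i ∧ ¬ Disjoint (K i) (K j), p ^ #(K i ∪ K j) :=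
      sum_le_sum_of_subset_of_nonneg (filter_subset_filter _ (subset_insert _ _))
        fun _ _ _ => by positivity
    have h2 : ∑ i' ∈ I, ∑ j ∈ I with j ≠ i' ∧ ¬ Disjoint (K i') (K j), p ^ #(K i' ∪ K j) ≤
        ∑ i' ∈ I, ∑ j ∈ insert i I with j ≠ i' ∧ ¬ Disjoint (K i') (K j), p ^ #(K i' ∪ K j) :=
      sum_le_sum fun i' _ => sum_le_sum_of_subset_of_nonneg
        (filter_subset_filter _ (subset_insert _ _)) fun _ _ _ => by positivity
    linarith

theorem bexp_map (p : ℝ) {E : Finset α} (σ : Equiv.Perm α) (hσ : E.map σ.toEmbedding = E)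
    (f : Finset α → ℝ) : bexp p E (fun S => f (S.map σ.toEmbedding)) = bexp p E f := by
  unfold bexp
  refine sum_nbij' (fun S => S.map σ.toEmbedding) (fun S => S.map σ.symm.toEmbedding) ?_ ?_ ?_ ?_ ?_
  · intro S hS
    rw [mem_powerset] at hS ⊢
    rw [← hσ]; exact map_subset_map.2 hS
  · intro S hS
    rw [mem_powerset] at hS ⊢
    intro a ha
    obtain ⟨b, hb, rfl⟩ := mem_map.1 ha
    have := hS hb
    rw [← hσ] at this
    obtain ⟨c, hc, rfl⟩ := mem_map.1 this
    simpa using hc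
  · intro S _; ext a; simp
  · intro S _; ext a; simp
  · intro S _; simp

open Classical in
/-- If after a random permutation from an invariant family every set in `Str` is bad with
probability at most `κ`, then the random set is bad with probability at most `P(¬ Str) + κ`. -/
theorem bexp_le_of_average {p : ℝ} (hp0 : 0 ≤ p) (hp1 : p ≤ 1) {E : Finset α}
    {β : Type*} [Fintype β] [Nonempty β] (act : β → Equiv.Perm α)
    (hact : ∀ b, E.map (act b).toEmbedding = E) (Str Bad : Finset α → Prop) {κ : ℝ} (hκ : 0 ≤ κ)
    (h : ∀ S ⊆ E, Str S → (#{b | Bad (S.map (act b).toEmbedding)} : ℝ) ≤ κ * Fintype.card β) :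
    bexp p E (fun S => if Bad S then 1 else 0) ≤
      bexp p E (fun S => if ¬ Str S then 1 else 0) + κ := by
  have hβ : (0 : ℝ) < Fintype.card β := by exact_mod_cast Fintype.card_pos
  have h1 : (Fintype.card β : ℝ) * bexp p E (fun S => if Bad S then 1 else 0) =
      bexp p E (fun S => (#{b | Bad (S.map (act b).toEmbedding)} : ℝ)) := by
    have : ∀ b ∈ (univ : Finset β), bexp p E (fun S => if Bad S then (1 : ℝ) else 0) =
        bexp p E (fun S => if Bad (S.map (act b).toEmbedding) then (1 : ℝ) else 0) :=
      fun b _ => (bexp_map p (act b) (hact b) (fun S => if Bad S then (1 : ℝ) else 0)).symm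
    have h2 := sum_congr (rfl : (univ : Finset β) = univ) this
    rw [sum_const, card_univ, nsmul_eq_mul, ← bexp_sum] at h2
    rw [h2]
    congr 1; funext S
    simp
  have h2 : bexp p E (fun S => (#{b | Bad (S.map (act b).toEmbedding)} : ℝ)) ≤
      bexp p E (fun S => (Fintype.card β : ℝ) * ((if ¬ Str S then 1 else 0) + κ)) := by
    refine bexp_mono hp0 hp1 fun S hS => ?_
    by_cases hs : Str S
    · rw [if_neg (not_not.2 hs), zero_add, mul_comm]; exact h S hS hs
    · rw [if_pos hs]
      have h3 : (#{b | Bad (S.map (act b).toEmbedding)} : ℝ) ≤ Fintype.card β := by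
        exact_mod_cast card_le_univ _
      nlinarith
  rw [bexp_mul_left, bexp_add, bexp_const] at h2
  rw [← h1] at h2
  exact le_of_mul_le_mul_left h2 hβ

open Classical in
theorem bexp_union_bound {p : ℝ} (hp0 : 0 ≤ p) (hp1 : p ≤ 1) {E : Finset α} (I : Finset ι)
    (A : ι → Finset α → Prop) {c : ℝ}
    (h : ∀ i ∈ I, bexp p E (fun S => if A i S then 1 else 0) ≤ c) :
    bexp p E (fun S => if ∃ i ∈ I, A i S then 1 else 0) ≤ #I * c := by
  calc _ ≤ bexp p E (fun S => ∑ i ∈ I, if A i S then (1 : ℝ) else 0) := by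
        refine bexp_mono hp0 hp1 fun S _ => ?_
        have hs : ∀ i ∈ I, 0 ≤ (if A i S then (1 : ℝ) else 0) := fun i _ => by
          split_ifs <;> norm_num
        split_ifs with h
        · obtain ⟨i, hi, hA⟩ := h
          have := single_le_sum hs hi
          rwa [if_pos hA] at this
        · exact sum_nonneg hs
    _ = ∑ i ∈ I, bexp p E (fun S => if A i S then (1 : ℝ) else 0) := bexp_sum p E I _
    _ ≤ ∑ i ∈ I, c := sum_le_sum h
    _ = #I * c := by simp

end Bernoulli

/-! ### The law of a random subgraph as a finite sum -/

open Classical in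
-- The law is concentrated on the finitely many subsets of the edge set of `H`, whose masses are
-- explicit. An upper bound is enough, as it is only applied to failure events.
theorem randomSubgraph_real_le {W : Type*} [Fintype W] (H : SimpleGraph W) (p : unitInterval)
    (A : SimpleGraph W → Prop) :
    (randomSubgraph H p).real {Γ | A Γ} ≤ bexp (p : ℝ) H.edgeFinset
      (fun S => if A (SimpleGraph.fromEdgeSet (S : Set (Sym2 W))) then 1 else 0) := by
  set E := H.edgeFinset with hE
  have hEH : (E : Set (Sym2 W)) = H.edgeSet := by simp [hE]
  have h0 : (randomSubgraph H p).real {Γ | A Γ} =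
      (ProbabilityTheory.setBernoulli H.edgeSet p).real
        {s | s ∈ SimpleGraph.edgeSet '' {Γ | A Γ} ∧ s ⊆ H.edgeSet} := by
    rw [MeasureTheory.measureReal_def, randomSubgraph,
      SimpleGraph.measurableEmbedding_edgeSet.comap_apply,
      ProbabilityTheory.setBernoulli_apply_eq_apply_subsets, MeasureTheory.measureReal_def]
  set F : Finset (Finset (Sym2 W)) := {S ∈ E.powerset |
    A (SimpleGraph.fromEdgeSet (S : Set (Sym2 W)))} with hF
  have h1 : {s | s ∈ SimpleGraph.edgeSet '' {Γ | A Γ} ∧ s ⊆ H.edgeSet} ⊆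
      ((F.image (fun S : Finset (Sym2 W) => (S : Set (Sym2 W))) : Finset (Set (Sym2 W))) : Set (Set (Sym2 W))) := by
    rintro s ⟨⟨Γ, hΓ, rfl⟩, hs⟩
    simp only [coe_image, Set.mem_image, mem_coe]
    refine ⟨Γ.edgeFinset, mem_filter.2 ⟨mem_powerset.2 ?_, ?_⟩, by simp⟩
    · rw [← coe_subset, hEH]; simpa using hs
    · simpa using hΓ
  rw [h0]
  refine (MeasureTheory.measureReal_mono h1).trans ?_
  rw [← MeasureTheory.sum_measureReal_singleton, sum_image fun S _ T _ h => coe_injective h,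
    bexp, hF, sum_filter]
  refine (sum_congr rfl fun S hS => ?_).le
  have hSE := mem_powerset.1 hS
  have hSH : (S : Set (Sym2 W)) ⊆ H.edgeSet := by rw [← hEH]; exact_mod_cast hSE
  split_ifs
  · rw [ProbabilityTheory.setBernoulli_real_singleton p hSH (Set.toFinite _), ← hEH,
      Set.ncard_coe_finset, ← coe_sdiff, Set.ncard_coe_finset, card_sdiff_of_subset hSE, mul_one]
  · simp

/-! ### Edges of blocks and the correlation of two blocks -/

section BlockEdges

/-- The number of pairs in `T` at distance at most two. -/
theorem card_close_pairs_le {k : ℕ} (T : Finset (Fin k)) :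
    (2 ≤ #T → #{e ∈ T ×ˢ T | e.1 < e.2 ∧ (e.2 : ℕ) ≤ e.1 + 2} + 3 ≤ 2 * #T) ∧
    (#T ≤ 1 → #{e ∈ T ×ˢ T | e.1 < e.2 ∧ (e.2 : ℕ) ≤ e.1 + 2} = 0) := by
  induction T using Finset.induction_on_max with
  | empty => simp
  | insert x T hx ih =>
    have hxT : x ∉ T := fun h => lt_irrefl _ (hx x h)
    -- A new maximum is close to at most two of the old elements, and to at most one if there is
    -- only one.
    have h1 : ({e ∈ insert x T ×ˢ insert x T | e.1 < e.2 ∧ (e.2 : ℕ) ≤ e.1 + 2} :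
        Finset (Fin k × Fin k)) ⊆ {e ∈ T ×ˢ T | e.1 < e.2 ∧ (e.2 : ℕ) ≤ e.1 + 2} ∪
        ({i ∈ T | (x : ℕ) ≤ ((i : Fin k) : ℕ) + 2}).image (fun i => (i, x)) := by
      rintro ⟨i, j⟩ he
      simp only [mem_filter, mem_product, mem_insert, mem_union, mem_image, Prod.mk.injEq] at he ⊢
      obtain ⟨⟨rfl | hi, rfl | hj⟩, hlt, hle⟩ := he
      · exact absurd hlt (lt_irrefl _)
      · exact absurd hlt (hx j hj).not_gt
      · exact Or.inr ⟨i, ⟨hi, hle⟩, rfl, rfl⟩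
      · exact Or.inl ⟨⟨hi, hj⟩, hlt, hle⟩
    have h2 := (card_le_card h1).trans ((card_union_le _ _).trans
      (Nat.add_le_add_left card_image_le _))
    have h3 : #{i ∈ T | (x : ℕ) ≤ ((i : Fin k) : ℕ) + 2} ≤ #T := card_filter_le _ _
    have h4 : #{i ∈ T | (x : ℕ) ≤ ((i : Fin k) : ℕ) + 2} ≤ 2 := by
      have h5 : ({i ∈ T | (x : ℕ) ≤ ((i : Fin k) : ℕ) + 2}).image (fun i : Fin k => (i : ℕ)) ⊆ Ico ((x : ℕ) - 2) x := by
        intro n hn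
        simp only [mem_image, mem_filter] at hn
        obtain ⟨i, ⟨hi, hle⟩, rfl⟩ := hn
        have : (i : ℕ) < x := hx i hi
        simp only [mem_Ico]; omega
      have h6 := card_le_card h5
      rw [card_image_of_injective _ Fin.val_injective, Nat.card_Ico] at h6
      omega
    rw [card_insert_of_notMem hxT]
    refine ⟨fun h => ?_, fun h => ?_⟩
    · by_cases hT : 2 ≤ #T
      · have := ih.1 hT; omega
      · have := ih.2 (by omega); omega
    · have := ih.2 (by omega); omega

/-- The pairs of indices at distance at most two. -/
def closePairs (k : ℕ) : Finset (Fin k × Fin k) :=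
  {e ∈ univ | e.1 < e.2 ∧ (e.2 : ℕ) ≤ e.1 + 2}

theorem card_closePairs {k : ℕ} (hk : 2 ≤ k) : #(closePairs k) = 2 * k - 3 := by
  apply le_antisymm
  · have := (card_close_pairs_le (univ : Finset (Fin k))).1 (by simpa using hk)
    rw [univ_product_univ, card_univ, Fintype.card_fin] at this
    unfold closePairs; omega
  · obtain ⟨k, rfl⟩ : ∃ k', k = k' + 2 := ⟨k - 2, by omega⟩
    have h1 : (univ : Finset (Fin (k + 1))).image (fun i => (i.castSucc, i.succ)) ∪
        (univ : Finset (Fin k)).image (fun i => (i.castSucc.castSucc, i.succ.succ)) ⊆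
        closePairs (k + 2) := by
      intro e he
      simp only [mem_union, mem_image, mem_univ, true_and] at he
      simp only [closePairs, mem_filter, mem_univ, true_and]
      rcases he with ⟨i, rfl⟩ | ⟨i, rfl⟩ <;> simp [Fin.lt_def]
    have h2 := card_le_card h1
    rw [card_union_of_disjoint, card_image_of_injective, card_image_of_injective] at h2
    · simp at h2; omega
    · intro i j h; simpa using h
    · intro i j h; simpa using h
    · rw [disjoint_left]
      rintro e he he'
      simp only [mem_image, mem_univ, true_and] at he he'
      obtain ⟨i, rfl⟩ := he
      obtain ⟨j, hj⟩ := he'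
      simp only [Prod.mk.injEq, Fin.ext_iff, Fin.val_castSucc, Fin.val_succ] at hj
      omega

set_option linter.unusedSectionVars false

variable {W : Type*} [DecidableEq W] {k : ℕ}

/-- The edges of the square of the path `a 0, …, a (k - 1)`. -/
def blockEdges (a : Fin k → W) : Finset (Sym2 W) :=
  (closePairs k).image fun e => s(a e.1, a e.2)

variable {U : Fin k → Finset W}

theorem index_unique (hU : ∀ i j, i ≠ j → Disjoint (U i) (U j)) {i j : Fin k} {w : W}
    (hi : w ∈ U i) (hj : w ∈ U j) : i = j := by
  by_contra h
  exact disjoint_left.1 (hU i j h) hi hj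

/-- As the parts are disjoint, an edge determines the indices of its ends; the order of the indices
rules out the reversed match. -/
theorem closePair_eq (hU : ∀ i j, i ≠ j → Disjoint (U i) (U j)) {a b : Fin k → W}
    (ha : ∀ i, a i ∈ U i) (hb : ∀ i, b i ∈ U i) {e e' : Fin k × Fin k} (he : e ∈ closePairs k)
    (he' : e' ∈ closePairs k) (h : s(a e.1, a e.2) = s(b e'.1, b e'.2)) :
    e = e' ∧ a e.1 = b e.1 ∧ a e.2 = b e.2 := by
  simp only [closePairs, mem_filter, mem_univ, true_and] at he he'
  rw [Sym2.eq_iff] at h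
  rcases h with ⟨h1, h2⟩ | ⟨h1, h2⟩
  · have e1 : e.1 = e'.1 := index_unique hU (ha _) (h1 ▸ hb _)
    have e2 : e.2 = e'.2 := index_unique hU (ha _) (h2 ▸ hb _)
    exact ⟨Prod.ext e1 e2, e1 ▸ h1, e2 ▸ h2⟩
  · have e1 : e.1 = e'.2 := index_unique hU (ha _) (h1 ▸ hb _)
    have e2 : e.2 = e'.1 := index_unique hU (ha _) (h2 ▸ hb _)
    have := he.1
    rw [e1, e2] at this
    exact absurd this he'.1.not_gt

theorem card_blockEdges (hk : 2 ≤ k) (hU : ∀ i j, i ≠ j → Disjoint (U i) (U j)) {a : Fin k → W}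
    (ha : ∀ i, a i ∈ U i) : #(blockEdges a) = 2 * k - 3 := by
  rw [blockEdges, card_image_of_injOn, card_closePairs hk]
  intro e he e' he' h
  exact (closePair_eq hU ha ha he he' h).1

/-- Blocks with a common edge agree in `s ≥ 2` places and share at most `2s - 3` edges
(`card_close_pairs_le`). So every place where they differ costs two further edges. -/
theorem le_card_blockEdges_union (hk : 2 ≤ k) (hU : ∀ i j, i ≠ j → Disjoint (U i) (U j))
    {a b : Fin k → W} (ha : ∀ i, a i ∈ U i) (hb : ∀ i, b i ∈ U i)
    (hab : ¬ Disjoint (blockEdges a) (blockEdges b)) :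
    (2 * k - 3) + 2 * #{i | a i ≠ b i} ≤ #(blockEdges a ∪ blockEdges b) := by
  set T : Finset (Fin k) := {i | a i = b i} with hT
  have hTc : #T + #{i | a i ≠ b i} = k := by
    have := card_filter_add_card_filter_not (s := (univ : Finset (Fin k))) (fun i => a i = b i)
    simpa [hT] using this
  have h1 : blockEdges a ∩ blockEdges b ⊆
      ({e ∈ T ×ˢ T | e.1 < e.2 ∧ (e.2 : ℕ) ≤ e.1 + 2}).image fun e => s(a e.1, a e.2) := by
    intro s hs
    rw [mem_inter] at hs
    obtain ⟨e, he, rfl⟩ := mem_image.1 hs.1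
    obtain ⟨e', he', h⟩ := mem_image.1 hs.2
    obtain ⟨-, h2, h3⟩ := closePair_eq hU ha hb he he' h.symm
    refine mem_image.2 ⟨e, mem_filter.2 ⟨mem_product.2 ⟨?_, ?_⟩, (mem_filter.1 he).2⟩, rfl⟩
    · simpa [hT] using h2
    · simpa [hT] using h3
  have h2 := (card_le_card h1).trans card_image_le
  have h3 : 2 ≤ #T := by
    by_contra hlt
    have h4 := (card_close_pairs_le T).2 (by omega)
    rw [h4] at h2
    exact hab (disjoint_iff_inter_eq_empty.2 (card_eq_zero.1 (Nat.le_zero.1 h2)))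
  have h4 := (card_close_pairs_le T).1 h3
  have h5 := card_union_add_card_inter (blockEdges a) (blockEdges b)
  rw [card_blockEdges hk hU ha, card_blockEdges hk hU hb] at h5
  omega

open Classical in
-- Janson's inequality with a correlation term of at most half the mean. By
-- `le_card_blockEdges_union`, the blocks correlated with a given one contribute at most `p ^ (2k -
-- 3) * ((1 + m * p ^ 2) ^ k - 1)`, where the factor `1 + m * p ^ 2` belongs to one coordinate.
theorem bexp_no_block_le {p : ℝ} (hp0 : 0 ≤ p) (hp1 : p ≤ 1) {E : Finset (Sym2 W)} {m : ℕ}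
    (hk : 2 ≤ k) (hU : ∀ i j, i ≠ j → Disjoint (U i) (U j)) {A : Fin k → Finset W}
    (hA : ∀ i, A i ⊆ U i) (hm : ∀ i, #(A i) ≤ m)
    (hE : ∀ a : Fin k → W, (∀ i, a i ∈ U i) → blockEdges a ⊆ E)
    (hmp : (1 + m * p ^ 2) ^ k ≤ 3 / 2) :
    bexp p E (fun S => if ∀ a : Fin k → W, (∀ i, a i ∈ A i) → ¬ blockEdges a ⊆ S then 1 else 0) ≤
      Real.exp (-((∏ i, (#(A i) : ℝ)) * p ^ (2 * k - 3) / 2)) := by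
  have hmem : ∀ {a}, a ∈ Fintype.piFinset A → ∀ i, a i ∈ U i := fun h i =>
    hA i (Fintype.mem_piFinset.1 h i)
  have h1 := janson hp0 hp1 (Fintype.piFinset A) blockEdges (E := E) fun a ha => hE a (hmem ha)
  have e0 : (fun S => if ∀ a : Fin k → W, (∀ i, a i ∈ A i) → ¬ blockEdges a ⊆ S then (1 : ℝ)
      else 0) = fun S => if ∀ a ∈ Fintype.piFinset A, ¬ blockEdges a ⊆ S then 1 else 0 := by
    funext S; simp only [Fintype.mem_piFinset]
  rw [e0]
  refine h1.trans (Real.exp_le_exp.2 ?_)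
  set q : ℝ := p ^ (2 * k - 3) with hq
  have hq0 : 0 ≤ q := by positivity
  have e1 : ∑ a ∈ Fintype.piFinset A, p ^ #(blockEdges a) = (∏ i, (#(A i) : ℝ)) * q := by
    rw [sum_congr rfl fun a ha => by rw [card_blockEdges hk hU (hmem ha)], sum_const,
      Fintype.card_piFinset, nsmul_eq_mul]
    push_cast; rfl
  have e2 : ∀ a ∈ Fintype.piFinset A, ∑ b ∈ Fintype.piFinset A with
      b ≠ a ∧ ¬ Disjoint (blockEdges a) (blockEdges b), p ^ #(blockEdges a ∪ blockEdges b) ≤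
      q / 2 := by
    intro a ha
    have h2 : ∑ b ∈ Fintype.piFinset A with
        b ≠ a ∧ ¬ Disjoint (blockEdges a) (blockEdges b), p ^ #(blockEdges a ∪ blockEdges b) ≤
        ∑ b ∈ (Fintype.piFinset A).erase a, q * ∏ i, (if a i = b i then 1 else p ^ 2) := by
      calc _ ≤ ∑ b ∈ Fintype.piFinset A with
            b ≠ a ∧ ¬ Disjoint (blockEdges a) (blockEdges b),
              q * ∏ i, (if a i = b i then 1 else p ^ 2) := by
            refine sum_le_sum fun b hb => ?_
            rw [mem_filter] at hb
            have h3 := le_card_blockEdges_union hk hU (hmem ha) (hmem hb.1) hb.2.2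
            refine (pow_le_pow_of_le_one hp0 hp1 h3).trans_eq ?_
            rw [pow_add, pow_mul, prod_ite]
            simp [hq]
        _ ≤ _ := by
            refine sum_le_sum_of_subset_of_nonneg (fun b hb => ?_) fun b _ _ => ?_
            · rw [mem_filter] at hb
              exact mem_erase.2 ⟨hb.2.1, hb.1⟩
            · refine mul_nonneg hq0 (prod_nonneg fun i _ => ?_)
              split_ifs <;> positivity
    have h3 : ∑ b ∈ Fintype.piFinset A, ∏ i, (if a i = b i then (1 : ℝ) else p ^ 2) ≤ 3 / 2 := by
      rw [← prod_univ_sum A (fun i x => if a i = x then (1 : ℝ) else p ^ 2)]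
      refine le_trans ?_ hmp
      calc _ ≤ ∏ i : Fin k, (1 + m * p ^ 2) := by
            refine prod_le_prod (fun i _ => sum_nonneg fun x _ => by split_ifs <;> positivity)
              fun i _ => ?_
            have hai := Fintype.mem_piFinset.1 ha i
            rw [← add_sum_erase _ _ hai, if_pos rfl]
            refine add_le_add_right ?_ 1
            rw [sum_congr rfl fun x hx => if_neg (ne_of_mem_erase hx).symm, sum_const, nsmul_eq_mul]
            refine mul_le_mul_of_nonneg_right ?_ (by positivity)
            exact_mod_cast (card_le_card (erase_subset _ _)).trans (hm i)
        _ = _ := by simp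
    have h4 := add_sum_erase (Fintype.piFinset A)
      (fun b => ∏ i, (if a i = b i then (1 : ℝ) else p ^ 2)) ha
    simp only [if_true, prod_const_one] at h4
    refine h2.trans ?_
    rw [← mul_sum]
    nlinarith
  have e3 := sum_le_sum e2
  rw [sum_const, Fintype.card_piFinset, nsmul_eq_mul] at e3
  push_cast at e3
  rw [e1]
  linarith

open Classical in
theorem bexp_no_edge_le {p : ℝ} (hp0 : 0 ≤ p) (hp1 : p ≤ 1) {E : Finset (Sym2 W)}
    {A B : Finset W} (hAB : Disjoint A B) (hE : ∀ a ∈ A, ∀ b ∈ B, s(a, b) ∈ E) :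
    bexp p E (fun S => if ∀ a ∈ A, ∀ b ∈ B, s(a, b) ∉ S then 1 else 0) ≤
      Real.exp (-((#A : ℝ) * #B * p)) := by
  have h1 := janson hp0 hp1 (A ×ˢ B) (fun e => ({s(e.1, e.2)} : Finset (Sym2 W))) (E := E)
    fun e he => by
      rw [mem_product] at he
      simpa using hE _ he.1 _ he.2
  have e0 : (fun S : Finset (Sym2 W) => if ∀ a ∈ A, ∀ b ∈ B, s(a, b) ∉ S then (1 : ℝ) else 0) =
      fun S => if ∀ e ∈ A ×ˢ B, ¬ ({s(e.1, e.2)} : Finset (Sym2 W)) ⊆ S then 1 else 0 := by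
    funext S
    simp only [mem_product, singleton_subset_iff, Prod.forall, and_imp]
    congr 1
    exact propext ⟨fun h a b ha hb => h a ha b hb, fun h a ha b hb => h a b ha hb⟩
  rw [e0]
  refine h1.trans (Real.exp_le_exp.2 ?_)
  have e1 : ∀ e ∈ A ×ˢ B, ∑ f ∈ A ×ˢ B with f ≠ e ∧ ¬ Disjoint ({s(e.1, e.2)} : Finset (Sym2 W))
      {s(f.1, f.2)}, p ^ #({s(e.1, e.2)} ∪ {s(f.1, f.2)} : Finset (Sym2 W)) = 0 := by
    intro e he
    rw [filter_false_of_mem, sum_empty]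
    rintro f hf ⟨hne, hd⟩
    rw [disjoint_singleton, not_not, Sym2.eq_iff] at hd
    rw [mem_product] at he hf
    rcases hd with ⟨h2, h3⟩ | ⟨h2, h3⟩
    · exact hne (Prod.ext h2.symm h3.symm)
    · exact disjoint_left.1 hAB he.1 (h2 ▸ hf.2)
  rw [sum_eq_zero e1]
  simp

end BlockEdges

/-! ### Tail bounds for pairs of rows under random permutations -/

section RandomPermutations

open Nat in
-- The inverse of one solution carries all solutions to permutations that fix the range of `ψ`
-- pointwise.
theorem card_perm_extending_le {m : ℕ} {ι : Type*} [Fintype ι] (ψ : ι ↪ Fin m) (f : ι → Fin m) :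
    #{τ : Equiv.Perm (Fin m) | ∀ a, τ (ψ a) = f a} ≤ (m - Fintype.card ι)! := by
  classical
  rcases ({τ : Equiv.Perm (Fin m) | ∀ a, τ (ψ a) = f a} : Finset _).eq_empty_or_nonempty with
    h | ⟨τ₀, hτ₀⟩
  · rw [h]; simp
  simp only [mem_filter, mem_univ, true_and] at hτ₀
  have h1 : Fintype.card {τ : Equiv.Perm (Fin m) // ∀ b, ¬ (b ∉ Set.range ψ) → τ b = b} =
      (m - Fintype.card ι)! := by
    rw [← Fintype.card_congr (Equiv.Perm.subtypeEquivSubtypePerm fun b => b ∉ Set.range ψ),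
      Fintype.card_perm]
    congr 1
    rw [Fintype.card_subtype_compl, Fintype.card_fin]
    congr 1
    exact (Fintype.card_congr (Equiv.ofInjective ψ ψ.injective)).symm
  rw [← h1, Fintype.card_subtype]
  refine card_le_card_of_injOn (fun τ => τ₀⁻¹ * τ) (fun τ hτ => ?_) fun τ _ τ' _ h => ?_
  · simp only [coe_filter, mem_univ, true_and, Set.mem_ofPred_eq] at hτ ⊢
    intro b hb
    rw [not_not] at hb
    obtain ⟨a, rfl⟩ := hb
    rw [Equiv.Perm.mul_apply, hτ a, ← hτ₀ a]; simp
  · exact mul_left_cancel h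

variable {k m : ℕ}

open Nat in
theorem card_perms_le {ι : Type*} [Fintype ι] [DecidableEq ι] (ψ : ι ↪ Fin m)
    (A : Finset (ι → Fin k → Fin m)) :
    #{σ : Fin k → Equiv.Perm (Fin m) | (fun a i => σ i (ψ a)) ∈ A} ≤
      #A * ((m - Fintype.card ι)!) ^ k := by
  classical
  have h := card_eq_sum_card_fiberwise (s := {σ : Fin k → Equiv.Perm (Fin m) |
    (fun a i => σ i (ψ a)) ∈ A}) (t := A) (f := fun σ a i => σ i (ψ a))
    fun σ hσ => by simpa using hσ
  rw [h, ← smul_eq_mul, ← sum_const]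
  refine sum_le_sum fun F _ => ?_
  have h2 : {σ ∈ ({σ : Fin k → Equiv.Perm (Fin m) | (fun a i => σ i (ψ a)) ∈ A} : Finset _) |
      (fun a i => σ i (ψ a)) = F} ⊆
      Fintype.piFinset fun i => {τ : Equiv.Perm (Fin m) | ∀ a, τ (ψ a) = F a i} := by
    intro σ hσ
    simp only [mem_filter, mem_univ, true_and] at hσ
    simp only [Fintype.mem_piFinset, mem_filter, mem_univ, true_and]
    exact fun i a => congrFun (congrFun hσ.2 a) i
  refine (card_le_card h2).trans ?_
  rw [Fintype.card_piFinset]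
  refine (prod_le_prod' fun i _ => card_perm_extending_le ψ fun a => F a i).trans ?_
  simp

/-- A sum over sequences of pairs of a product is a power. -/
theorem sum_prod_pairs {R : Type*} [Fintype R] [DecidableEq R] (t : ℕ) (h : R → R → ℝ) :
    ∑ F : Fin t × Bool → R, ∏ g, h (F (g, false)) (F (g, true)) = (∑ r, ∑ r', h r r') ^ t := by
  have e : (∑ r, ∑ r', h r r') = ∑ x : R × R, h x.1 x.2 :=
    (Fintype.sum_prod_type (fun x : R × R => h x.1 x.2)).symm
  rw [e, Finset.sum_pow', ← Fintype.piFinset_univ]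
  refine sum_nbij' (fun F g => (F (g, false), F (g, true)))
    (fun F a => if a.2 then (F a.1).2 else (F a.1).1) ?_ ?_ ?_ ?_ ?_
  all_goals simp
  intro F
  funext ⟨a, b⟩
  cases b <;> simp

open Classical in
/-- The pairs of rows `σ (ψ (g, false))`, `σ (ψ (g, true))` that satisfy `P`. -/
noncomputable def pairCount {t : ℕ} (ψ : Fin t × Bool ↪ Fin m)
    (P : (Fin k → Fin m) → (Fin k → Fin m) → Prop) (σ : Fin k → Equiv.Perm (Fin m)) : ℕ :=
  #{g : Fin t | P (fun i => σ i (ψ (g, false))) (fun i => σ i (ψ (g, true)))}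

open Classical Nat in
-- Markov's inequality for the weight `θ ^ pairCount`, with `θ > 1` for upper tails and `θ < 1` for
-- lower ones. The rows at the positions `ψ` are first relaxed to arbitrary rows, over which the
-- weight factorises by `sum_prod_pairs`. Each choice of them extends to at most `(m - 2t)! ^ k`
-- tuples of permutations.
theorem card_perms_le_of_weight {t : ℕ} (ψ : Fin t × Bool ↪ Fin m)
    (P : (Fin k → Fin m) → (Fin k → Fin m) → Prop) (C : ℕ → Prop) {θ c : ℝ} (hθ : 0 ≤ θ)
    (hc : 0 < c) (hC : ∀ n, C n → c ≤ θ ^ n) :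
    (#{σ : Fin k → Equiv.Perm (Fin m) | C (pairCount ψ P σ)} : ℝ) ≤
      (∑ r, ∑ r', if P r r' then θ else 1) ^ t / c * (((m - 2 * t)! : ℕ) : ℝ) ^ k := by
  set A : Finset (Fin t × Bool → Fin k → Fin m) :=
    {F | C #{g : Fin t | P (F (g, false)) (F (g, true))}} with hA
  have h1 := card_perms_le (k := k) ψ A
  have h2 : #{σ : Fin k → Equiv.Perm (Fin m) | (fun a i => σ i (ψ a)) ∈ A} =
      #{σ : Fin k → Equiv.Perm (Fin m) | C (pairCount ψ P σ)} := by
    refine congrArg card (filter_congr fun σ _ => ?_); simp [hA, pairCount]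
  have h3 : Fintype.card (Fin t × Bool) = 2 * t := by simp [mul_comm]
  rw [h2, h3] at h1
  have h4 : (#A : ℝ) ≤ (∑ r, ∑ r', if P r r' then θ else 1) ^ t / c := by
    rw [← sum_prod_pairs, le_div_iff₀ hc]
    calc (#A : ℝ) * c = ∑ F ∈ A, c := by simp
      _ ≤ ∑ F ∈ A, ∏ g, (if P (F (g, false)) (F (g, true)) then θ else 1) := by
          refine sum_le_sum fun F hF => ?_
          rw [prod_ite, prod_const, prod_const_one, mul_one]
          exact hC _ (mem_filter.1 hF).2
      _ ≤ _ := by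
          refine sum_le_univ_sum_of_nonneg fun F => prod_nonneg fun g _ => ?_
          split_ifs <;> [exact hθ; norm_num]
  calc (#{σ : Fin k → Equiv.Perm (Fin m) | C (pairCount ψ P σ)} : ℝ)
      ≤ (#A : ℝ) * (((m - 2 * t)! : ℕ) : ℝ) ^ k := by exact_mod_cast h1
    _ ≤ _ := mul_le_mul_of_nonneg_right h4 (by positivity)

open Classical in
theorem sum_ite_pairs {R : Type*} [Fintype R] (P : R → R → Prop) (θ : ℝ) :
    (∑ r, ∑ r', if P r r' then θ else 1) =
      (Fintype.card R : ℝ) ^ 2 + (θ - 1) * #{x : R × R | P x.1 x.2} := by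
  have h1 : ∀ x : R × R, (if P x.1 x.2 then θ else 1) =
      1 + (θ - 1) * (if P x.1 x.2 then 1 else 0) := fun x => by split_ifs <;> ring
  rw [← Fintype.sum_prod_type (fun x : R × R => if P x.1 x.2 then θ else 1),
    sum_congr rfl fun x _ => h1 x, sum_add_distrib, ← mul_sum]
  simp [sq]

open Classical Nat in
/-- A rare property of pairs of rows does not hold for many pairs of rows. -/
theorem card_many_pairs_le {t a : ℕ} (ψ : Fin t × Bool ↪ Fin m)
    (P : (Fin k → Fin m) → (Fin k → Fin m) → Prop) {β : ℝ} (hβ : 0 < β)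
    (hP : (#{x : (Fin k → Fin m) × (Fin k → Fin m) | P x.1 x.2} : ℝ) ≤ β * ((m : ℝ) ^ k) ^ 2)
    (hβ1 : β ≤ 1) (ht : 2 * t ≤ m) :
    (#{σ : Fin k → Equiv.Perm (Fin m) | a ≤ pairCount ψ P σ} : ℝ) ≤
      ((m ! : ℕ) : ℝ) ^ k * (Real.exp (k * m) * 2 ^ t * β ^ a) := by
  -- With `θ = β⁻¹` a random pair has mean weight at most `2`.
  have h := card_perms_le_of_weight ψ P (fun n => a ≤ n) (θ := β⁻¹) (c := β⁻¹ ^ a) (by positivity)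
    (by positivity) fun n hn => pow_le_pow_right₀ ((one_le_inv₀ hβ).2 hβ1) hn
  refine (le_of_eq (by congr!)).trans (h.trans ?_)
  rw [sum_ite_pairs]
  have hR : (Fintype.card (Fin k → Fin m) : ℝ) = (m : ℝ) ^ k := by simp
  rw [hR]
  have h1 : ((m : ℝ) ^ k) ^ 2 + (β⁻¹ - 1) *
      #{x : (Fin k → Fin m) × (Fin k → Fin m) | P x.1 x.2} ≤ ((m : ℝ) ^ k) ^ 2 * 2 := by
    have h2 : 0 ≤ β⁻¹ - 1 := sub_nonneg.2 ((one_le_inv₀ hβ).2 hβ1)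
    have h3 := mul_le_mul_of_nonneg_left hP h2
    have h4 : (β⁻¹ - 1) * (β * ((m : ℝ) ^ k) ^ 2) = (1 - β) * ((m : ℝ) ^ k) ^ 2 := by
      field_simp
    nlinarith [sq_nonneg ((m : ℝ) ^ k)]
  have h0 : 0 ≤ ((m : ℝ) ^ k) ^ 2 + (β⁻¹ - 1) *
      #{x : (Fin k → Fin m) × (Fin k → Fin m) | P x.1 x.2} := by
    have h2 : 0 ≤ β⁻¹ - 1 := sub_nonneg.2 ((one_le_inv₀ hβ).2 hβ1)
    positivity
  -- The price for treating the rows as independent. A factor `exp m` for each part is affordable,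
  -- since `β` will be exponentially small in the ratio `m / a`.
  have h5 : (m : ℝ) ^ (2 * t) * ((m - 2 * t)! : ℕ) ≤ (m ! : ℕ) * Real.exp m := by
    have h6 : (((m - 2 * t)! : ℕ) : ℝ) ≤ (m : ℝ) ^ (m - 2 * t) := by
      have : (m - 2 * t)! ≤ m ^ (m - 2 * t) :=
        (Nat.factorial_le_pow _).trans (Nat.pow_le_pow_left (Nat.sub_le _ _) _)
      exact_mod_cast this
    have h7 := Real.pow_div_factorial_le_exp (x := m) (by positivity) m
    rw [div_le_iff₀ (by positivity)] at h7
    calc _ ≤ (m : ℝ) ^ (2 * t) * (m : ℝ) ^ (m - 2 * t) := mul_le_mul_of_nonneg_left h6 (by positivity)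
      _ = (m : ℝ) ^ m := by rw [← pow_add]; congr 1; omega
      _ ≤ _ := by linarith
  calc _ ≤ (((m : ℝ) ^ k) ^ 2 * 2) ^ t / β⁻¹ ^ a * (((m - 2 * t)! : ℕ) : ℝ) ^ k := by gcongr
    _ = ((m : ℝ) ^ (2 * t) * ((m - 2 * t)! : ℕ)) ^ k * (2 ^ t * β ^ a) := by
        rw [inv_pow, div_inv_eq_mul, mul_pow, mul_pow, ← pow_mul, ← pow_mul, ← pow_mul,
          mul_comm k (2 * t)]
        ring
    _ ≤ ((m ! : ℕ) * Real.exp m) ^ k * (2 ^ t * β ^ a) := by gcongr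
    _ = _ := by rw [mul_pow, ← Real.exp_nat_mul]; ring

open Classical Nat in
/-- A property that holds for a positive proportion of the pairs of rows holds for many pairs of
rows. -/
theorem card_few_pairs_le {t a : ℕ} (ψ : Fin t × Bool ↪ Fin m)
    (P : (Fin k → Fin m) → (Fin k → Fin m) → Prop) {q : ℝ}
    (hP : q * ((m : ℝ) ^ k) ^ 2 ≤ #{x : (Fin k → Fin m) × (Fin k → Fin m) | P x.1 x.2})
    (ht : 4 * t ≤ m) (hm : 0 < m) :
    (#{σ : Fin k → Equiv.Perm (Fin m) | pairCount ψ P σ ≤ a} : ℝ) ≤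
      ((m ! : ℕ) : ℝ) ^ k * Real.exp (8 * k * t ^ 2 / m - q * t / 2 + a) := by
  have h := card_perms_le_of_weight ψ P (fun n => n ≤ a) (θ := 1 / 2) (c := (1 / 2) ^ a)
    (by norm_num) (by positivity)
    fun n hn => pow_le_pow_of_le_one (by norm_num) (by norm_num) hn
  refine (le_of_eq (by congr!)).trans (h.trans ?_)
  rw [sum_ite_pairs]
  have hR : (Fintype.card (Fin k → Fin m) : ℝ) = (m : ℝ) ^ k := by simp
  rw [hR]
  have hm' : (0 : ℝ) < m := by exact_mod_cast hm
  have h1 : ((m : ℝ) ^ k) ^ 2 + (1 / 2 - 1) *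
      #{x : (Fin k → Fin m) × (Fin k → Fin m) | P x.1 x.2} ≤
      ((m : ℝ) ^ k) ^ 2 * Real.exp (-(q / 2)) := by
    have := Real.add_one_le_exp (-(q / 2))
    nlinarith [sq_nonneg ((m : ℝ) ^ k)]
  have h0 : 0 ≤ ((m : ℝ) ^ k) ^ 2 + (1 / 2 - 1) *
      #{x : (Fin k → Fin m) × (Fin k → Fin m) | P x.1 x.2} := by
    have h2 : #{x : (Fin k → Fin m) × (Fin k → Fin m) | P x.1 x.2} ≤
      Fintype.card ((Fin k → Fin m) × (Fin k → Fin m)) := card_le_univ _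
    have h3 : (#{x : (Fin k → Fin m) × (Fin k → Fin m) | P x.1 x.2} : ℝ) ≤
      Fintype.card ((Fin k → Fin m) × (Fin k → Fin m)) := by exact_mod_cast h2
    rw [Fintype.card_prod] at h3
    push_cast at h3
    rw [hR] at h3
    nlinarith [sq_nonneg ((m : ℝ) ^ k)]
  -- Here the price must be smaller than the gain `exp (q * t / 2)`. It is quadratic in `t`, so this
  -- holds once `t` is a small multiple of `m`.
  have h5 : (m : ℝ) ^ (2 * t) * ((m - 2 * t)! : ℕ) ≤ (m ! : ℕ) * Real.exp (8 * t ^ 2 / m) := by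
    have h6 := Nat.factorial_mul_descFactorial (n := m) (k := 2 * t) (by omega)
    have h7 := Nat.pow_sub_le_descFactorial m (2 * t)
    have h8 : (((m + 1 - 2 * t : ℕ) : ℝ)) ^ (2 * t) ≤ (m.descFactorial (2 * t) : ℕ) := by
      exact_mod_cast h7
    have h9 : (m : ℝ) ≤ ((m + 1 - 2 * t : ℕ) : ℝ) * Real.exp (4 * t / m) := by
      rw [Nat.cast_sub (by omega)]
      push_cast
      have h10 := Real.add_one_le_exp (4 * t / m : ℝ)
      have h11 : (4 * t : ℝ) ≤ m := by exact_mod_cast ht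
      have h12 : (m : ℝ) ≤ (m + 1 - 2 * t) * (4 * t / m + 1) := by
        have h13 : (m + 1 - 2 * t : ℝ) * (4 * t / m + 1) =
          m + 1 + (2 * t * (m - 4 * t) + 4 * t) / m := by field_simp; ring
        rw [h13]
        have : 0 ≤ (2 * t * (m - 4 * t) + 4 * t : ℝ) / m := by
          have : (0 : ℝ) ≤ m - 4 * t := by linarith
          positivity
        linarith
      exact h12.trans (mul_le_mul_of_nonneg_left h10 (by linarith [(Nat.cast_nonneg t : (0:ℝ) ≤ t)]))
    calc (m : ℝ) ^ (2 * t) * ((m - 2 * t)! : ℕ)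
        ≤ (((m + 1 - 2 * t : ℕ) : ℝ) * Real.exp (4 * t / m)) ^ (2 * t) * ((m - 2 * t)! : ℕ) := by
          gcongr
      _ = (((m + 1 - 2 * t : ℕ) : ℝ) ^ (2 * t)) * ((m - 2 * t)! : ℕ) * Real.exp (8 * t ^ 2 / m) := by
          rw [mul_pow, ← Real.exp_nat_mul]
          have : ((2 * t : ℕ) : ℝ) * (4 * t / m) = 8 * t ^ 2 / m := by push_cast; ring
          rw [this]; ring
      _ ≤ (m.descFactorial (2 * t) : ℕ) * ((m - 2 * t)! : ℕ) * Real.exp (8 * t ^ 2 / m) := by gcongr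
      _ = _ := by rw [← h6]; push_cast; ring
  have h2a : (2 : ℝ) ^ a ≤ Real.exp a := by
    have : (2 : ℝ) ≤ Real.exp 1 := by have := Real.add_one_le_exp (1 : ℝ); linarith
    calc (2 : ℝ) ^ a ≤ Real.exp 1 ^ a := by gcongr
      _ = _ := by rw [← Real.exp_nat_mul, mul_one]
  calc _ ≤ (((m : ℝ) ^ k) ^ 2 * Real.exp (-(q / 2))) ^ t / (1 / 2) ^ a *
        (((m - 2 * t)! : ℕ) : ℝ) ^ k := by gcongr
    _ = ((m : ℝ) ^ (2 * t) * ((m - 2 * t)! : ℕ)) ^ k * (Real.exp (-(q / 2)) ^ t * 2 ^ a) := by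
        rw [one_div, inv_pow, div_inv_eq_mul, mul_pow, mul_pow, ← pow_mul, ← pow_mul, ← pow_mul,
          mul_comm k (2 * t)]
        ring
    _ ≤ ((m ! : ℕ) * Real.exp (8 * t ^ 2 / m)) ^ k * (Real.exp (-(q / 2)) ^ t * Real.exp a) := by
        gcongr
    _ = _ := by
        rw [mul_pow, ← Real.exp_nat_mul, ← Real.exp_nat_mul, mul_assoc, ← Real.exp_add,
          ← Real.exp_add]
        congr 2
        ring

end RandomPermutations

/-! ### Ordering the blocks -/

section Ordering

theorem breaks_range (S : ℕ → ℕ → Prop) [DecidableRel S] (n : ℕ) :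
    breaks S (List.range n) = #{j ∈ range (n - 1) | ¬ S j (j + 1)} := by
  induction n with
  | zero => simp [breaks]
  | succ n ih =>
    cases n with
    | zero => simp [breaks]
    | succ n =>
      rw [List.range_succ, List.range_succ, breaks_append, ← List.range_succ, ih]
      simp only [breaks, Nat.add_sub_cancel, range_add_one, filter_insert]
      by_cases h : S n (n + 1) <;> simp [h]

theorem breaks_eq_card {α : Type*} [Inhabited α] (S : α → α → Prop) [DecidableRel S] (l : List α) :
    breaks S l = #{i ∈ range (l.length - 1) | ¬ S (l.getD i default) (l.getD (i + 1) default)} := by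
  have key : ∀ l : List α, breaks S l = ∑ i ∈ range (l.length - 1),
      if ¬ S (l.getD i default) (l.getD (i + 1) default) then 1 else 0 := by
    intro l
    induction l with
    | nil => simp [breaks]
    | cons a l ih =>
      cases l with
      | nil => simp [breaks]
      | cons b l =>
        simp only [breaks, ih, List.length_cons, Nat.add_sub_cancel]
        rw [sum_range_succ']
        simp only [List.getD_cons_succ, List.getD_cons_zero]
        rw [add_comm]
        congr 1
        by_cases h : S a b <;> simp [h]
  rw [key, card_filter]

/-- The extra `1` is for the index `0`, which has no predecessor. -/
theorem card_filter_pred_le {N t : ℕ} (P Q : ℕ → Prop) [DecidablePred P] [DecidablePred Q]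
    (h : ∀ j, P (j + 1) → Q j) (hQ : #{j ∈ range (N - 1) | Q j} ≤ t) :
    #{j ∈ range N | P j} ≤ t + 1 := by
  have : {j ∈ range N | P j} ⊆ insert 0 ({j ∈ range (N - 1) | Q j}.image (· + 1)) := by
    intro j hj
    simp only [mem_filter, mem_range] at hj
    cases j with
    | zero => simp
    | succ j =>
      refine mem_insert_of_mem (mem_image.2 ⟨j, mem_filter.2 ⟨mem_range.2 (by omega), h j hj.2⟩, rfl⟩)
  have h2 := (card_le_card this).trans (card_insert_le _ _)
  have h3 := card_image_le (s := {j ∈ range (N - 1) | Q j}) (f := (· + 1))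
  omega

theorem card_filter_succ_le {N t : ℕ} (P Q : ℕ → Prop) [DecidablePred P] [DecidablePred Q]
    (h : ∀ j, P j → Q j) (hQ : #{j ∈ range (N - 1) | Q j} ≤ t) :
    #{j ∈ range N | P j} ≤ t + 1 := by
  have : {j ∈ range N | P j} ⊆ insert (N - 1) {j ∈ range (N - 1) | Q j} := by
    intro j hj
    simp only [mem_filter, mem_range] at hj
    rw [mem_insert, mem_filter, mem_range]
    by_cases hjN : j = N - 1
    · exact Or.inl hjN
    · exact Or.inr ⟨by omega, h j hj.2⟩
  have h2 := (card_le_card this).trans (card_insert_le _ _)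
  omega

variable {W : Type*} [DecidableEq W]

theorem countP_le_card_filter {l : List ℕ} {N : ℕ} (hl : l.Nodup) (hN : ∀ j ∈ l, j < N)
    (P : ℕ → Prop) [DecidablePred P] : l.countP (fun j => P j) ≤ #{j ∈ range N | P j} := by
  rw [List.countP_eq_length_filter, ← List.toFinset_card_of_nodup (hl.filter _)]
  refine card_le_card fun j hj => ?_
  simp only [List.mem_toFinset, List.mem_filter, decide_eq_true_eq] at hj
  exact mem_filter.2 ⟨mem_range.2 (hN j hj.1), hj.2⟩

set_option maxHeartbeats 400000 in
open Classical in
/-- Blocks `0, …, N - 1` with front and back neighbourhoods can be arranged so that all consecutive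
pairs have a large common neighbourhood and most of them are linked pairs `(j, j + 1)`. -/
theorem exists_block_order {V : Finset W} {front back : ℕ → Finset W} {N t a a' jx jy : ℕ}
    (link : ℕ → Prop) (hf : ∀ j, front j ⊆ V) (hb : ∀ j, back j ⊆ V) (ht : 1 ≤ t) (haa : a ≤ a')
    (h0 : #{j ∈ range (N - 1) | #(back j ∩ front (j + 1)) < a'} ≤ t)
    (h1 : ∀ X ⊆ V, a' ≤ #X → #{j ∈ range (N - 1) | #(back j ∩ front (j + 1) ∩ X) < a} ≤ t)
    (hlink : #{j ∈ range (N - 1) | ¬ link j} ≤ 2 * t)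
    (hjx : jx < N ∧ a' ≤ #(front jx) ∧ a' ≤ #(back jx))
    (hjy : jy < N ∧ a' ≤ #(front jy) ∧ a' ≤ #(back jy)) (hne : jx ≠ jy) (hN : 24 * t ≤ N) :
    ∃ l : List ℕ, l.Nodup ∧ (∀ j ∈ l, j < N) ∧ l.head? = some jx ∧ l.getLast? = some jy ∧
      N ≤ l.length + 4 * t ∧ breaks (fun i j => a ≤ #(back i ∩ front j)) l = 0 ∧
      breaks (fun i j => j = i + 1 ∧ link i ∧ a ≤ #(back i ∩ front j)) l ≤ 44 * t := by
  generalize hR : (fun i j => a ≤ #(back i ∩ front j)) = R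
  generalize hS : (fun i j => j = i + 1 ∧ link i ∧ a ≤ #(back i ∩ front j)) = S
  set good : ℕ → Prop := fun j => a' ≤ #(front j) ∧ a' ≤ #(back j) with hgood
  have hfront : #{j ∈ range N | #(front j) < a'} ≤ t + 1 :=
    card_filter_pred_le _ _ (fun j hj => (card_le_card inter_subset_right).trans_lt hj) h0
  have hback : #{j ∈ range N | #(back j) < a'} ≤ t + 1 :=
    card_filter_succ_le _ _ (fun j hj => (card_le_card inter_subset_left).trans_lt hj) h0
  -- Take the large set `back i` for `X` in `h1`: for most `j` already a part of `front j` meets it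
  -- often enough. Hence `R` is nearly complete on good rows.
  have hout : ∀ i, good i → #{j ∈ range N | ¬ R i j} ≤ t + 1 := by
    intro i hi
    refine card_filter_pred_le _ _ (fun j hj => ?_) (h1 (back i) (hb i) hi.2)
    simp only [← hR, not_le] at hj
    refine (card_le_card fun w hw => ?_).trans_lt hj
    simp only [mem_inter] at hw ⊢
    tauto
  have hin : ∀ i, good i → #{j ∈ range N | ¬ R j i} ≤ t + 1 := by
    intro i hi
    refine card_filter_succ_le _ _ (fun j hj => ?_) (h1 (front i) (hf i) hi.1)
    simp only [← hR, not_le] at hj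
    refine (card_le_card fun w hw => ?_).trans_lt hj
    simp only [mem_inter] at hw ⊢
    tauto
  obtain ⟨keep, hkeep⟩ : ∃ keep : ℕ → Prop, ∀ j, keep j ↔ good j ∧ j ≠ jx ∧ j ≠ jy :=
    ⟨_, fun _ => Iff.rfl⟩
  set mid := (List.range N).filter fun j => keep j with hmid
  have hmidN : ∀ j ∈ mid, j < N := fun j hj => by simpa using (List.mem_filter.1 hj).1
  have hmidk : ∀ j ∈ mid, keep j := fun j hj => by simpa using (List.mem_filter.1 hj).2
  have hrem : (List.range N).countP (fun j => !decide (keep j)) ≤ 2 * t + 4 := by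
    have e1 : (List.range N).countP (fun j => !decide (keep j)) =
        (List.range N).countP (fun j => decide (¬ keep j)) := by
      congr 1; funext j; simp
    rw [e1]
    refine (countP_le_card_filter List.nodup_range (fun j hj => by simpa using hj) _).trans ?_
    have e2 : {j ∈ range N | ¬ keep j} ⊆ ({j ∈ range N | #(front j) < a'} ∪
        {j ∈ range N | #(back j) < a'}) ∪ {jx, jy} := by
      intro j hj
      rw [mem_filter] at hj
      by_contra hc
      simp only [mem_union, mem_filter, mem_insert, mem_singleton, not_or, not_and, not_lt] at hc
      exact hj.2 ((hkeep j).2 ⟨⟨hc.1.1 hj.1, hc.1.2 hj.1⟩, hc.2.1, hc.2.2⟩)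
    have e3 := (card_le_card e2).trans (card_union_le _ _)
    have e4 := card_union_le {j ∈ range N | #(front j) < a'} {j ∈ range N | #(back j) < a'}
    have e5 := card_le_two (a := jx) (b := jy)
    omega
  have hmidlen : N ≤ mid.length + (2 * t + 4) := by
    have := List.length_eq_countP_add_countP (l := List.range N) (fun j => decide (keep j))
    rw [List.length_range, List.countP_eq_length_filter, ← hmid] at this
    simp only [Bool.not_eq_true, ← Bool.not_eq_true'] at this
    have h2 : (List.range N).countP (fun j => decide ((!decide (keep j)) = true)) =
      (List.range N).countP (fun j => !decide (keep j)) := by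
        congr 1; funext j; simp
    omega
  have hSrange : breaks S (List.range N) ≤ 3 * t := by
    rw [breaks_range]
    have e1 : {j ∈ range (N - 1) | ¬ S j (j + 1)} ⊆ {j ∈ range (N - 1) | ¬ link j} ∪
        {j ∈ range (N - 1) | #(back j ∩ front (j + 1)) < a'} := by
      intro j hj
      simp only [mem_filter, ← hS, mem_union, true_and, not_and, not_le] at hj ⊢
      by_cases hl : link j
      · exact Or.inr ⟨hj.1, (hj.2 hl).trans_le haa⟩
      · exact Or.inl ⟨hj.1, hl⟩
    have e2 := (card_le_card e1).trans (card_union_le _ _)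
    omega
  have hSmid : breaks S mid ≤ 5 * t + 4 := by
    have := breaks_filter_le S (fun j => decide (keep j)) (List.range N)
    rw [← hmid] at this
    omega
  set l₁ := [jx] ++ (mid ++ [jy]) with hl₁
  have hl₁nd : l₁.Nodup := by
    have h2 : mid.Nodup := List.nodup_range.filter _
    have h3 : jx ∉ mid := fun h => ((hkeep _).1 (hmidk _ h)).2.1 rfl
    have h4 : jy ∉ mid := fun h => ((hkeep _).1 (hmidk _ h)).2.2 rfl
    rw [hl₁, List.singleton_append, List.nodup_cons, List.nodup_append]
    simp only [List.mem_append, List.mem_singleton, not_or]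
    exact ⟨⟨h3, hne⟩, h2, List.nodup_singleton _, fun c hc b hb => by
      rw [hb]; rintro rfl; exact h4 hc⟩
  have hl₁N : ∀ j ∈ l₁, j < N ∧ good j := by
    intro j hj
    simp only [hl₁, List.mem_append, List.mem_singleton] at hj
    rcases hj with rfl | hj | rfl
    · exact ⟨hjx.1, hjx.2⟩
    · exact ⟨hmidN j hj, ((hkeep j).1 (hmidk j hj)).1⟩
    · exact ⟨hjy.1, hjy.2⟩
  have hl₁len : l₁.length = mid.length + 2 := by simp [hl₁]
  -- In the natural order there are `2t` missing links and `t` small intersections; at most `2t + 4`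
  -- rows are deleted and two ends are attached. Repairing at most `5t + 6` breaks of `R` costs
  -- three each, in total `20t + 24 ≤ 44t`.
  have hSl₁ : breaks S l₁ ≤ 5 * t + 6 := by
    have e1 := breaks_append_le S [jx] (mid ++ [jy])
    have e2 := breaks_append_le S mid [jy]
    rw [← hl₁] at e1
    simp only [breaks] at e1 e2
    omega
  have hRl₁ : breaks R l₁ ≤ breaks S l₁ := breaks_mono (fun i j h => by
    rw [← hS] at h; rw [← hR]; exact h.2.2) l₁
  obtain ⟨l, g1, g2, g3, g4, g5⟩ := exists_perm_breaks_eq_zero (R := R) (S := S) (t := t + 1)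
    (l := l₁)
    (fun b hb => (countP_le_card_filter hl₁nd (fun j hj => (hl₁N j hj).1) _).trans
      (hout b (hl₁N b hb).2))
    (fun b hb => (countP_le_card_filter hl₁nd (fun j hj => (hl₁N j hj).1) _).trans
      (hin b (hl₁N b hb).2)) (by omega)
  refine ⟨l, g1.nodup_iff.2 hl₁nd, fun j hj => (hl₁N j (g1.subset hj)).1, by rw [g2]; simp [hl₁],
    by rw [g3, hl₁, ← List.append_assoc]; simp only [List.getLast?_append]; simp, ?_, g4, ?_⟩
  · rw [g1.length_eq, hl₁len]; omega
  · omega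

end Ordering

/-! ### The deterministic construction of the path -/

section Assembly

theorem mem_closePairs {k : ℕ} {i j : Fin k} (h : (i : ℕ) < j) (h' : (j : ℕ) ≤ i + 2) :
    (i, j) ∈ closePairs k :=
  mem_filter.2 ⟨mem_univ _, h, h'⟩

theorem ofFn_eq_cons_cons {W : Type*} {k : ℕ} (f : Fin k → W) {i₀ i₁ : Fin k} (h₀ : (i₀ : ℕ) = 0)
    (h₁ : (i₁ : ℕ) = 1) : ∃ s, List.ofFn f = f i₀ :: f i₁ :: s := by
  obtain ⟨k, rfl⟩ : ∃ k', k = k' + 2 := ⟨k - 2, by have := i₁.2; omega⟩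
  obtain rfl : i₀ = 0 := Fin.ext h₀
  obtain rfl : i₁ = 1 := Fin.ext h₁
  exact ⟨_, by rw [List.ofFn_succ, List.ofFn_succ]; rfl⟩

theorem ofFn_eq_append {W : Type*} {k : ℕ} (f : Fin k → W) {i j : Fin k} (hi : (i : ℕ) + 2 = k)
    (hj : (j : ℕ) + 1 = k) : ∃ s, List.ofFn f = s ++ [f i, f j] := by
  obtain ⟨k, rfl⟩ : ∃ k', k = k' + 2 := ⟨k - 2, by omega⟩
  obtain rfl : i = (Fin.last k).castSucc := Fin.ext (by simp; omega)
  obtain rfl : j = Fin.last (k + 1) := Fin.ext (by simp; omega)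
  exact ⟨List.ofFn fun i : Fin k => f i.castSucc.castSucc, by
    rw [List.ofFn_succ', List.ofFn_succ']; simp⟩

theorem sqChain_ofFn {W : Type*} {A : W → W → Prop} {k : ℕ} (f : Fin k → W)
    (h : ∀ e ∈ closePairs k, A (f e.1) (f e.2)) : SqChain A (List.ofFn f) := by
  refine sqChain_of_getElem fun i j hi hj hij hji => ?_
  simp only [List.length_ofFn] at hi hj
  simp only [List.getElem_ofFn]
  exact h (⟨i, hi⟩, ⟨j, hj⟩) (by simp [closePairs, hij, hji])

variable {W : Type*} [DecidableEq W]

/-- Only a single vertex leaves `q` and `f` at distance two; the longer separators make the link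
superfluous. In `a b u c d`, both pairs `ab` and `cd` and the pair `bc` across `u` are edges of the
path `abcd`. -/
theorem sqChain_of_isSeparator {H : SimpleGraph W} {Z Ex : Finset W} {Nu : W → Finset W}
    {strong : Prop} {p q f f' : W} {s : List W} (h : IsSeparator H Z Nu Ex strong s)
    (hpq : H.Adj p q) (hff : H.Adj f f') (hlink : strong → H.Adj q f)
    (hZ : ∀ v ∈ Z, H.Adj p v ∧ H.Adj q v ∧ H.Adj f v ∧ H.Adj f' v)
    (hN : ∀ u ∈ Ex, ∀ v ∈ Nu u, H.Adj u v) :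
    SqChain H.Adj (p :: q :: (s ++ [f, f'])) := by
  rcases h with ⟨hs, v, hv, rfl⟩ | ⟨v, hv, v', hv', hadj, rfl⟩ |
    ⟨u, hu, a, ha, b, hb, c, hc, d, hd, hab, hbc, hcd, rfl⟩
  · obtain ⟨h1, h2, h3, h4⟩ := hZ v hv
    simp [SqChain, hpq, h1, h2, h3.symm, h4.symm, hlink hs, hff]
  · obtain ⟨h1, h2, h3, h4⟩ := hZ v hv
    obtain ⟨g1, g2, g3, g4⟩ := hZ v' hv'
    simp [SqChain, hpq, h1, h2, g2, hadj, h3.symm, g3.symm, g4.symm, hff]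
  · rw [mem_inter] at ha hb hc hd
    obtain ⟨h1, h2, -, -⟩ := hZ a ha.1
    obtain ⟨-, g2, -, -⟩ := hZ b hb.1
    obtain ⟨-, -, e3, -⟩ := hZ c hc.1
    obtain ⟨-, -, k3, k4⟩ := hZ d hd.1
    have ua := hN u hu a ha.2
    have ub := hN u hu b hb.2
    have uc := hN u hu c hc.2
    have ud := hN u hu d hd.2
    simp [SqChain, hpq, h1, h2, g2, hab, hbc, hcd, e3.symm, k3.symm, k4.symm, ua.symm, ub.symm,
      uc, ud, hff]

set_option maxHeartbeats 1000000 in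
open Classical in
/-- A sufficient deterministic condition for the square of a Hamilton path, in terms of an
arrangement of the vertices of the `U i` in rows. -/
theorem hasSquareHamPath_of_rows {H : SimpleGraph W} {V S : Finset W} {k m n t a a' B : ℕ}
    {U : Fin k → Finset W} {x x' y y' : W} (w : ℕ → Fin k → W) (nb : W → Finset W)
    {i₀ i₁ i₂ i₃ : Fin k} (hi₀ : (i₀ : ℕ) = 0) (hi₁ : (i₁ : ℕ) = 1) (hi₂ : (i₂ : ℕ) + 2 = k)
    (hi₃ : (i₃ : ℕ) + 1 = k)
    (hwU : ∀ j < m, ∀ i, w j i ∈ U i)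
    (hwinj : ∀ i, ∀ j < m, ∀ j' < m, w j i = w j' i → j = j')
    (hUm : ∀ i, #(U i) = m) (hU : ∀ i j, i ≠ j → Disjoint (U i) (U j)) (hVn : #V = n)
    (hS : ∀ z, z ∈ S → z ∈ V ∨ z = x ∨ z = x' ∨ z = y ∨ z = y' ∨ ∃ i, z ∈ U i)
    (hScard : #S = n + 4 + k * m)
    (hnbV : ∀ u, nb u ⊆ V) (hnb : ∀ i, ∀ u ∈ U i, ∀ v ∈ nb u, H.Adj u v)
    (hV : JoinsLarge H V t)
    (hblock : ∀ j < m - t, ∀ e ∈ closePairs k, H.Adj (w j e.1) (w j e.2))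
    (hlink : #{j ∈ range (m - t - 1) | ¬ H.Adj (w j i₃) (w (j + 1) i₀)} ≤ 2 * t)
    (h0 : #{j ∈ range (m - t - 1) | #((nb (w j i₂) ∩ nb (w j i₃)) ∩
      (nb (w (j + 1) i₀) ∩ nb (w (j + 1) i₁))) < a'} ≤ t)
    (h1 : ∀ X ⊆ V, a' ≤ #X → #{j ∈ range (m - t - 1) | #((nb (w j i₂) ∩ nb (w j i₃)) ∩
      (nb (w (j + 1) i₀) ∩ nb (w (j + 1) i₁)) ∩ X) < a} ≤ t)
    (hX : ∀ X ⊆ V, t ≤ #X → #{j ∈ range (m - t - 1) | Disjoint ((nb (w j i₂) ∩ nb (w j i₃)) ∩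
      (nb (w (j + 1) i₀) ∩ nb (w (j + 1) i₁))) X} ≤ t)
    (hdeg : ∀ i, ∀ u ∈ U i, a' ≤ #(nb u))
    (hB : ∀ v ∈ V, B ≤ #{j ∈ range (m - t - 1) | v ∈ (nb (w j i₂) ∩ nb (w j i₃)) ∩
      (nb (w (j + 1) i₀) ∩ nb (w (j + 1) i₁))})
    (hx : B ≤ #{j ∈ range (m - t) | H.Adj x' (w j i₀) ∧ H.Adj x (w j i₀) ∧ H.Adj x (w j i₁)})
    (hy : B ≤ #{j ∈ range (m - t) | H.Adj (w j i₂) y ∧ H.Adj (w j i₃) y ∧ H.Adj (w j i₃) y'})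
    (ht : 1 ≤ t) (haa : a ≤ a') (hm : 25 * t ≤ m) (hnm : m + (15 * k + 44) * t ≤ n)
    (ha : 2 * (n - m) + (20 * k + 18) * t ≤ a) (hB' : (n - m) + (5 * k + 55) * t ≤ B) :
    HasSquareHamPath H S x x' y y' := by
  set N := m - t with hNdef
  set front : ℕ → Finset W := fun j => nb (w j i₀) ∩ nb (w j i₁) with hfront
  set back : ℕ → Finset W := fun j => nb (w j i₂) ∩ nb (w j i₃) with hback
  have hkt : t ≤ k * t := Nat.le_mul_of_pos_left t (by have := i₀.2; omega)
  have e1 : (15 * k + 44) * t = 15 * (k * t) + 44 * t := by ring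
  have e2 : (20 * k + 18) * t = 20 * (k * t) + 18 * t := by ring
  have e3 : (5 * k + 55) * t = 5 * (k * t) + 55 * t := by ring
  rw [e1] at hnm
  rw [e2] at ha
  rw [e3] at hB'
  have hfg : #{j ∈ range N | #(front j) < a'} ≤ t + 1 :=
    card_filter_pred_le _ _ (fun j hj => (card_le_card inter_subset_right).trans_lt hj) h0
  have hbg : #{j ∈ range N | #(back j) < a'} ≤ t + 1 :=
    card_filter_succ_le _ _ (fun j hj => (card_le_card inter_subset_left).trans_lt hj) h0
  -- At most `2t + 2` rows have a small front or back and one row is forbidden, while `B` is larger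
  -- than `2t + 3`.
  have pick : ∀ (P : ℕ → Prop) (j₀ : ℕ), B ≤ #{j ∈ range N | P j} →
      ∃ j, j ≠ j₀ ∧ P j ∧ j < N ∧ a' ≤ #(front j) ∧ a' ≤ #(back j) := by
    intro P j₀ hP
    by_contra! hc
    have hsub : {j ∈ range N | P j} ⊆ ({j ∈ range N | #(front j) < a'} ∪
        {j ∈ range N | #(back j) < a'}) ∪ {j₀} := by
      intro j hj
      rw [mem_filter, mem_range] at hj
      by_contra hn
      simp only [mem_union, mem_filter, mem_singleton, mem_range, not_or, not_and, not_lt] at hn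
      exact absurd (hn.1.2 hj.1) (not_le.2 (hc j hn.2 hj.2 hj.1 (hn.1.1 hj.1)))
    have g1 := (card_le_card hsub).trans (card_union_le _ _)
    have g2 := card_union_le {j ∈ range N | #(front j) < a'} {j ∈ range N | #(back j) < a'}
    rw [card_singleton] at g1
    omega
  -- The forbidden index `N` is out of range, so it excludes nothing.
  obtain ⟨jx, -, hjx, hjxg⟩ := pick
    (fun j => H.Adj x' (w j i₀) ∧ H.Adj x (w j i₀) ∧ H.Adj x (w j i₁)) N (by convert hx)
  obtain ⟨jy, hjne, hjy, hjyg⟩ := pick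
    (fun j => H.Adj (w j i₂) y ∧ H.Adj (w j i₃) y ∧ H.Adj (w j i₃) y') jx (by convert hy)
  obtain ⟨l, hlnd, hlN, hlx, hly, hlen, hlR, hlS⟩ := exists_block_order (V := V) (front := front)
    (back := back) (fun j => H.Adj (w j i₃) (w (j + 1) i₀))
    (fun j => inter_subset_left.trans (hnbV _)) (fun j => inter_subset_left.trans (hnbV _)) ht haa
    h0 h1 hlink hjxg hjyg hjne.symm (by omega)
  set L := l.length with hL
  set r := L - 1 with hr
  have hLN : L ≤ N := by
    have := (List.nodup_range (n := N)).length_le_of_subset (l₂ := List.range N) (by simp)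
    have h2 : l ⊆ List.range N := fun j hj => by simpa using hlN j hj
    simpa using hlnd.length_le_of_subset h2
  have hLpos : 1 ≤ L := by omega
  have hrL : r + 1 = L := by omega
  obtain ⟨c, hc⟩ : ∃ c : ℕ → ℕ, ∀ i, c i = l.getD i default := ⟨_, fun _ => rfl⟩
  have hcg : ∀ i (hi : i < L), c i = l[i] := fun i hi => by
    rw [hc, List.getD_eq_getElem?_getD, List.getElem?_eq_getElem hi]; rfl
  have hcl : ∀ i < L, c i ∈ l := fun i hi => hcg i hi ▸ List.getElem_mem _
  have hcN : ∀ i < L, c i < N := fun i hi => hlN _ (hcl i hi)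
  have hcinj : ∀ i < L, ∀ j < L, c i = c j → i = j := fun i hi j hj h => by
    rw [hcg i hi, hcg j hj] at h
    exact (List.Nodup.getElem_inj_iff hlnd).1 h
  have hlc : ∀ j ∈ l, ∃ i < L, c i = j := fun j hj => by
    obtain ⟨i, hi, rfl⟩ := List.getElem_of_mem hj
    exact ⟨i, hi, hcg i hi⟩
  have hc0 : c 0 = jx := by
    rw [hcg 0 hLpos]
    rw [List.head?_eq_getElem?, List.getElem?_eq_getElem hLpos] at hlx
    simpa using hlx
  have hcr : c r = jy := by
    rw [hcg r (by omega)]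
    rw [List.getLast?_eq_getElem?, List.getElem?_eq_getElem (by omega)] at hly
    simpa using hly
  rw [breaks_eq_card] at hlR hlS
  simp only [← hc] at hlR hlS
  set Z : ℕ → Finset W := fun i => back (c i) ∩ front (c (i + 1)) with hZ
  have hRall : ∀ i < r, a ≤ #(Z i) := by
    intro i hi
    rw [card_eq_zero, filter_eq_empty_iff] at hlR
    exact not_not.1 (hlR (mem_range.2 hi))
  -- These gaps lie between rows that were consecutive and linked from the start. The spreading
  -- hypotheses on the pairs `(j, j + 1)` carry over to them along `c`.
  set St : Finset ℕ := {i ∈ range r | c (i + 1) = c i + 1 ∧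
    H.Adj (w (c i) i₃) (w (c i + 1) i₀) ∧ a ≤ #(Z i)} with hSt
  have hStr : St ⊆ range r := filter_subset _ _
  have hStcard : r ≤ #St + 44 * t := by
    have h2 : range r \ St ⊆ {i ∈ range (l.length - 1) | ¬ (c (i + 1) = c i + 1 ∧
        H.Adj (w (c i) i₃) (w (c i + 1) i₀) ∧ a ≤ #(back (c i) ∩ front (c (i + 1))))} := by
      intro i hi
      rw [mem_sdiff, hSt, mem_filter, not_and] at hi
      exact mem_filter.2 ⟨hi.1, hi.2 hi.1⟩
    have h3 := (card_le_card h2).trans ((le_of_eq (by congr!)).trans hlS)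
    rw [card_sdiff_of_subset hStr, card_range] at h3
    omega
  have hmap : ∀ (P : ℕ → Prop) [DecidablePred P], #{i ∈ St | P (c i)} ≤ #{j ∈ range (N - 1) | P j} := by
    intro P _
    refine card_le_card_of_injOn c (fun i hi => ?_) fun i hi j hj h => ?_
    · simp only [coe_filter, Set.mem_ofPred_eq, hSt, mem_filter, mem_range] at hi ⊢
      have := hcN (i + 1) (by omega)
      exact ⟨by omega, hi.2⟩
    · have hi := mem_range.1 (hStr (mem_filter.1 hi).1)
      have hj := mem_range.1 (hStr (mem_filter.1 hj).1)
      exact hcinj i (by omega) j (by omega) h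
  have hStZ : ∀ i ∈ St, Z i = back (c i) ∩ front (c i + 1) := fun i hi => by
    rw [← (mem_filter.1 hi).2.1]
  set blocks : Finset W := (l.toFinset ×ˢ (univ : Finset (Fin k))).image fun e => w e.1 e.2
    with hblocks
  set Ex : Finset W := univ.biUnion U \ blocks with hEx
  have hlm : ∀ j ∈ l, j < m := fun j hj => by have := hlN j hj; omega
  have hbcard : #blocks = L * k := by
    rw [hblocks, card_image_of_injOn, card_product, List.toFinset_card_of_nodup hlnd]
    · simp [hL]
    · rintro ⟨j, i⟩ hji ⟨j', i'⟩ hji' h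
      simp only [coe_product, Set.mem_prod, mem_coe, List.mem_toFinset] at hji hji' h
      have hi : i = i' := index_unique hU (hwU j (hlm j hji.1) i)
        (h ▸ hwU j' (hlm j' hji'.1) i')
      subst hi
      rw [hwinj i j (hlm j hji.1) j' (hlm j' hji'.1) h]
  have hbU : blocks ⊆ univ.biUnion U := by
    intro z hz
    obtain ⟨⟨j, i⟩, hji, rfl⟩ := mem_image.1 hz
    simp only [mem_product, List.mem_toFinset] at hji
    exact mem_biUnion.2 ⟨i, mem_univ _, hwU j (hlm j hji.1) i⟩
  have hUcard : #(univ.biUnion U) = k * m := by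
    rw [card_biUnion fun i _ j _ hij => hU i j hij]
    simp [hUm]
  have hExcard : #Ex + k * L = k * m := by
    rw [hEx, card_sdiff_of_subset hbU, hUcard, hbcard, mul_comm L k]
    have : k * L ≤ k * m := Nat.mul_le_mul_left k (by omega)
    omega
  -- In each part, `t` vertices lie in no block and at most `4t` in discarded blocks.
  have hEx5 : #Ex ≤ 5 * (k * t) := by
    have h2 : k * m ≤ k * (L + 5 * t) := Nat.mul_le_mul_left k (by omega)
    have h3 : k * (L + 5 * t) = k * L + 5 * (k * t) := by ring
    omega
  have hExU : ∀ u ∈ Ex, ∃ i, u ∈ U i := fun u hu => by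
    obtain ⟨i, -, hi⟩ := mem_biUnion.1 (mem_sdiff.1 hu).1
    exact ⟨i, hi⟩
  have hVne : ∃ v, v ∈ V := card_pos.1 (by omega)
  have hBN : B ≤ N - 1 := by
    obtain ⟨v, hv⟩ := hVne
    exact (hB v hv).trans ((card_filter_le _ _).trans (by simp))
  -- `D` is forced by counting `V`. The loss of `48 t` in `b` comes from the original pairs that are
  -- not in `St`: `4t` for discarded rows and `44t` for breaks.
  obtain ⟨sep, hsep, hsepmem, hsepcard⟩ := exists_separators (H := H) (V := V) (Ex := Ex)
    (Nu := nb) (r := r) (t := t) (a := a) (b := B - 48 * t) (D := n - r - 3 * #Ex) (Z := Z)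
    (St := St) hStr (fun i _ => inter_subset_left.trans (inter_subset_left.trans (hnbV _))) hRall hV
    (fun X hXV hXt => by
      refine le_trans (le_of_eq ?_) ((hmap fun j => Disjoint (back j ∩ front (j + 1)) X).trans
        (hX X hXV hXt))
      exact congrArg card (filter_congr fun i hi => by rw [hStZ i hi]))
    (fun u hu => by
      obtain ⟨i, hi⟩ := hExU u hu
      refine le_trans (le_of_eq ?_) ((hmap fun j => #(back j ∩ front (j + 1) ∩ nb u) < a).trans
        (h1 _ (hnbV u) (hdeg i u hi)))
      exact congrArg card (filter_congr fun i hi => by rw [hStZ i hi]))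
    (fun v hv => by
      have g1 := hB v hv
      have g2 : {j ∈ range (N - 1) | v ∈ back j ∩ front (j + 1)} ⊆
          ({i ∈ St | v ∈ Z i}).image c ∪ (range (N - 1) \ St.image c) := by
        intro j hj
        rw [mem_filter] at hj
        by_cases hjc : j ∈ St.image c
        · obtain ⟨i, hi, rfl⟩ := mem_image.1 hjc
          exact mem_union_left _ (mem_image.2 ⟨i, mem_filter.2 ⟨hi, by rw [hStZ i hi]; exact hj.2⟩,
            rfl⟩)
        · exact mem_union_right _ (mem_sdiff.2 ⟨hj.1, hjc⟩)
      have g3 := (card_le_card g2).trans (card_union_le _ _)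
      have g4 : St.image c ⊆ range (N - 1) := by
        intro j hj
        obtain ⟨i, hi, rfl⟩ := mem_image.1 hj
        have h2 := (mem_filter.1 hi).2.1
        have h3 := mem_range.1 (hStr hi)
        have := hcN (i + 1) (by omega)
        rw [mem_range]; omega
      have g5 : #(St.image c) = #St := card_image_of_injOn fun i hi j hj h => by
        have hi := mem_range.1 (hStr hi)
        have hj := mem_range.1 (hStr hj)
        exact hcinj i (by omega) j (by omega) h
      rw [card_sdiff_of_subset g4, g5, card_range] at g3
      have g6 := card_image_le (s := {i ∈ St | v ∈ Z i}) (f := c)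
      have g1' : B ≤ #{j ∈ range (N - 1) | v ∈ back j ∩ front (j + 1)} := g1
      omega)
    (by omega) (by omega) (by omega) (by omega) (by omega)
  have hwblock : ∀ i < L, ∀ e ∈ closePairs k, H.Adj (w (c i) e.1) (w (c i) e.2) :=
    fun i hi => hblock _ (hcN i hi)
  have hadj01 : ∀ i < L, H.Adj (w (c i) i₀) (w (c i) i₁) := fun i hi =>
    hwblock i hi (i₀, i₁) (mem_closePairs (by omega) (by omega))
  have hadj23 : ∀ i < L, H.Adj (w (c i) i₂) (w (c i) i₃) := fun i hi =>
    hwblock i hi (i₂, i₃) (mem_closePairs (by omega) (by omega))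
  have hUc : ∀ i < L, ∀ i', w (c i) i' ∈ U i' := fun i hi => hwU _ (by have := hcN i hi; omega)
  refine hasSquareHamPath_of_weave (blk := fun i => List.ofFn (w (c i))) (sep := sep)
    (f := fun i => w (c i) i₀) (f' := fun i => w (c i) i₁) (p := fun i => w (c i) i₂)
    (q := fun i => w (c i) i₃) (r := r) (k := k) (fun i => List.length_ofFn)
    (fun i => ofFn_eq_cons_cons _ hi₀ hi₁) (fun i => ofFn_eq_append _ hi₂ hi₃)
    (fun i hi => sqChain_ofFn _ (hwblock i (by omega))) ?_ ?_ ?_ ?_ ?_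
  · simpa only [hc0] using hjx
  · simpa only [hcr] using hjy
  · intro i hi
    refine sqChain_of_isSeparator (hsep i hi) (hadj23 i (by omega)) (hadj01 (i + 1) (by omega))
      (fun hs => ?_) (fun v hv => ?_) fun u hu v hv => ?_
    · have := (mem_filter.1 hs).2
      simp only [this.1]
      exact this.2.1
    · simp only [hZ, hback, hfront, mem_inter] at hv
      exact ⟨hnb _ _ (hUc i (by omega) _) v hv.1.1, hnb _ _ (hUc i (by omega) _) v hv.1.2,
        hnb _ _ (hUc (i + 1) (by omega) _) v hv.2.1, hnb _ _ (hUc (i + 1) (by omega) _) v hv.2.2⟩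
    · obtain ⟨i', hi'⟩ := hExU u hu
      exact hnb i' u hi' v hv
  · intro z hz
    simp only [List.mem_append, List.mem_cons, mem_weave, List.not_mem_nil, or_false]
    have fromSep : z ∈ V ∪ Ex → ∃ j < r, z ∈ sep j := fun h => hsepmem z h
    rcases hS z hz with h | rfl | rfl | rfl | rfl | ⟨i, hi⟩
    · exact Or.inl (Or.inr (Or.inr (Or.inr (fromSep (mem_union_left _ h)))))
    · simp
    · simp
    · simp
    · simp
    · by_cases hzb : z ∈ blocks
      · obtain ⟨⟨j, i'⟩, hji, rfl⟩ := mem_image.1 hzb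
        simp only [mem_product, List.mem_toFinset] at hji
        obtain ⟨i'', hi'', rfl⟩ := hlc j hji.1
        refine Or.inl (Or.inr (Or.inr (Or.inl ⟨i'', by omega, ?_⟩)))
        exact List.mem_ofFn.2 ⟨i', rfl⟩
      · have : z ∈ Ex := mem_sdiff.2 ⟨mem_biUnion.2 ⟨i, mem_univ _, hi⟩, hzb⟩
        exact Or.inl (Or.inr (Or.inr (Or.inr (fromSep (mem_union_right _ this)))))
  · rw [hsepcard, hScard, hVn, hrL]
    omega

end Assembly

/-! ### Covering the parts by linked blocks -/

section BlockCover

variable {W : Type*} [DecidableEq W] {k : ℕ}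

/-- All boxes in `U` with sides of size at least `t` contain a block of `S`, and all pairs of large
subsets of the last and the first part are joined by an edge of `S`. -/
structure BlockRich (S : Finset (Sym2 W)) (U : Fin k → Finset W) (t : ℕ) (i₀ i₃ : Fin k) : Prop where
  block : ∀ A : Fin k → Finset W, (∀ i, A i ⊆ U i) → (∀ i, t ≤ #(A i)) →
    ∃ a : Fin k → W, (∀ i, a i ∈ A i) ∧ blockEdges a ⊆ S
  edge : ∀ A B : Finset W, A ⊆ U i₃ → B ⊆ U i₀ → t ≤ #A → t ≤ #B → ∃ a ∈ A, ∃ b ∈ B, s(a, b) ∈ S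

/-- The rows `w j` are disjoint blocks of `S`, most of which are linked to the next row. -/
structure IsBlockCover (S : Finset (Sym2 W)) (w : ℕ → Fin k → W) (N t : ℕ) (i₀ i₃ : Fin k) :
    Prop where
  block : ∀ j < N, blockEdges (w j) ⊆ S
  link : #{j ∈ range (N - 1) | s(w j i₃, w (j + 1) i₀) ∉ S} ≤ 2 * t

/-- Greedy choice: before `m - t` blocks are found, at least `t` vertices of each part are unused
and span another block. -/
theorem BlockRich.exists_blocks {S : Finset (Sym2 W)} {U : Fin k → Finset W} {t m : ℕ}
    {i₀ i₃ : Fin k} (h : BlockRich S U t i₀ i₃) (hUm : ∀ i, #(U i) = m) (ht : 1 ≤ t) (z : W) (s : ℕ)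
    (hs : s ≤ m - t) : ∃ b : ℕ → Fin k → W, ∀ j < s, (∀ i, b j i ∈ U i) ∧ blockEdges (b j) ⊆ S ∧
      ∀ i, ∀ j' < s, b j i = b j' i → j = j' := by
  induction s with
  | zero => exact ⟨fun _ _ => z, by simp⟩
  | succ s ih =>
    obtain ⟨b, hb⟩ := ih (by omega)
    obtain ⟨a, ha, haS⟩ := h.block (fun i => U i \ (range s).image fun j => b j i)
      (fun i => sdiff_subset) fun i => by
        have h1 := le_card_sdiff ((range s).image fun j => b j i) (U i)
        have h2 := card_image_le (s := range s) (f := fun j => b j i)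
        rw [card_range] at h2
        rw [hUm] at h1
        omega
    have hnew : ∀ i, ∀ j < s, b j i ≠ a i := fun i j hj hji =>
      (mem_sdiff.1 (ha i)).2 (mem_image.2 ⟨j, mem_range.2 hj, hji⟩)
    refine ⟨fun j => if j < s then b j else a, fun j hj => ?_⟩
    by_cases hjs : j < s
    · simp only [hjs, if_true]
      refine ⟨(hb j hjs).1, (hb j hjs).2.1, fun i j' hj' hjj' => ?_⟩
      by_cases hjs' : j' < s
      · simp only [hjs', if_true] at hjj'
        exact (hb j hjs).2.2 i j' hjs' hjj'
      · simp only [hjs', if_false] at hjj'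
        exact absurd hjj' (hnew i j hjs)
    · simp only [hjs, if_false]
      refine ⟨fun i => (mem_sdiff.1 (ha i)).1, haS, fun i j' hj' hjj' => ?_⟩
      by_cases hjs' : j' < s
      · simp only [hjs', if_true] at hjj'
        exact absurd hjj'.symm (hnew i j' hjs')
      · omega

/-- The last vertices of `t` blocks and the first vertices of `t` others are joined by `edge`, which
is what `exists_perm_breaks_le` asks for. -/
theorem BlockRich.exists_cover {S : Finset (Sym2 W)} {U : Fin k → Finset W} {t m : ℕ}
    {i₀ i₃ : Fin k} (h : BlockRich S U t i₀ i₃) (hUm : ∀ i, #(U i) = m) (ht : 1 ≤ t) (z : W) :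
    ∃ b : ℕ → Fin k → W, (∀ j < m - t, (∀ i, b j i ∈ U i) ∧
      ∀ i, ∀ j' < m - t, b j i = b j' i → j = j') ∧ IsBlockCover S b (m - t) t i₀ i₃ := by
  classical
  obtain ⟨b, hb⟩ := h.exists_blocks hUm ht z (m - t) le_rfl
  set N := m - t with hN
  obtain ⟨l, hl, hlt⟩ := exists_perm_breaks_le (R := fun j j' => s(b j i₃, b j' i₀) ∈ S) (t := t)
    (List.nodup_range (n := N)) (by
      intro A B hAB hmem hA hB
      rw [List.nodup_append] at hAB
      have hAN : ∀ j ∈ A, j < N := fun j hj => by simpa using hmem j (List.mem_append_left _ hj)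
      have hBN : ∀ j ∈ B, j < N := fun j hj => by simpa using hmem j (List.mem_append_right _ hj)
      obtain ⟨a, ha, c, hc, hac⟩ := h.edge (A.toFinset.image fun j => b j i₃)
        (B.toFinset.image fun j => b j i₀)
        (fun z hz => by
          obtain ⟨j, hj, rfl⟩ := mem_image.1 hz
          exact (hb j (hAN j (List.mem_toFinset.1 hj))).1 _)
        (fun z hz => by
          obtain ⟨j, hj, rfl⟩ := mem_image.1 hz
          exact (hb j (hBN j (List.mem_toFinset.1 hj))).1 _)
        (by
          rw [card_image_of_injOn, List.toFinset_card_of_nodup hAB.1]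
          · exact hA
          · intro j hj j' hj' hjj'
            simp only [List.coe_toFinset, Set.mem_ofPred_eq] at hj hj'
            exact (hb j (hAN j hj)).2.2 i₃ j' (hAN j' hj') hjj')
        (by
          rw [card_image_of_injOn, List.toFinset_card_of_nodup hAB.2.1]
          · exact hB
          · intro j hj j' hj' hjj'
            simp only [List.coe_toFinset, Set.mem_ofPred_eq] at hj hj'
            exact (hb j (hBN j hj)).2.2 i₀ j' (hBN j' hj') hjj')
      obtain ⟨j, hj, rfl⟩ := mem_image.1 ha
      obtain ⟨j', hj', rfl⟩ := mem_image.1 hc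
      exact ⟨j, List.mem_toFinset.1 hj, j', List.mem_toFinset.1 hj', hac⟩)
  have hlen : l.length = N := by rw [hl.length_eq, List.length_range]
  have hcg : ∀ j (hj : j < N), l.getD j default = l[j]'(by omega) := fun j hj => by
    rw [List.getD_eq_getElem?_getD, List.getElem?_eq_getElem (by omega)]; rfl
  have hcN : ∀ j < N, l.getD j default < N := fun j hj => by
    rw [hcg j hj]; simpa using hl.subset (List.getElem_mem _)
  refine ⟨fun j => b (l.getD j default), fun j hj => ⟨(hb _ (hcN j hj)).1, fun i j' hj' hjj' => ?_⟩,
    fun j hj => (hb _ (hcN j hj)).2.1, ?_⟩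
  · have h1 := (hb _ (hcN j hj)).2.2 i _ (hcN j' hj') hjj'
    rw [hcg j hj, hcg j' hj'] at h1
    exact (List.Nodup.getElem_inj_iff (hl.nodup_iff.2 List.nodup_range)).1 h1
  · rw [breaks_eq_card, hlen] at hlt
    refine (le_of_eq ?_).trans hlt
    congr!

/-- The rows of the vertices of `U` that are given by the permutations `σ` of the indices. -/
def rowsOf {m : ℕ} (e : Fin k → Fin m → W) (z : W) (σ : Fin k → Equiv.Perm (Fin m)) :
    ℕ → Fin k → W :=
  fun j i => if h : j < m then e i (σ i ⟨j, h⟩) else z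

theorem IsBlockCover.congr {S : Finset (Sym2 W)} {w w' : ℕ → Fin k → W} {N t : ℕ} {i₀ i₃ : Fin k}
    (h : IsBlockCover S w N t i₀ i₃) (hw : ∀ j < N, w j = w' j) : IsBlockCover S w' N t i₀ i₃ where
  block j hj := hw j hj ▸ h.block j hj
  link := by
    refine (le_of_eq (congrArg card (filter_congr fun j hj => ?_))).trans h.link
    rw [mem_range] at hj
    rw [hw j (by omega), hw (j + 1) (by omega)]

/-- The unused vertices fill the remaining rows arbitrarily. With full permutations the cover can be
moved by the symmetry group. -/
theorem BlockRich.exists_perms {S : Finset (Sym2 W)} {U : Fin k → Finset W} {t m : ℕ}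
    {i₀ i₃ : Fin k} (h : BlockRich S U t i₀ i₃) (hUm : ∀ i, #(U i) = m) (ht : 1 ≤ t)
    (e : Fin k → Fin m → W) (heU : ∀ i j, e i j ∈ U i) (heinj : ∀ i, Function.Injective (e i))
    (z : W) : ∃ τ : Fin k → Equiv.Perm (Fin m), IsBlockCover S (rowsOf e z τ) (m - t) t i₀ i₃ := by
  obtain ⟨b, hb, hbc⟩ := h.exists_cover hUm ht z
  have key : ∀ i, ∃ τ : Equiv.Perm (Fin m), ∀ j (hj : j < m), j < m - t → e i (τ ⟨j, hj⟩) = b j i := by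
    intro i
    obtain ⟨g, hg⟩ := exists_equiv_extend_of_card_eq (α := Fin m) (t := U i)
      (by simp [hUm]) (s := {j | (j : ℕ) < m - t}) (f := fun j => b j i)
      (fun z hz => by
        obtain ⟨j, hj, rfl⟩ := mem_image.1 hz
        exact (hb j (by simpa using hj)).1 i)
      (fun j hj j' hj' hjj' => by
        simp only [coe_filter, mem_univ, true_and, Set.mem_ofPred_eq] at hj hj'
        exact Fin.ext ((hb j hj).2 i j' hj' hjj'))
    have hbij : Function.Bijective fun j : Fin m => (⟨e i j, heU i j⟩ : U i) := by
      rw [Fintype.bijective_iff_injective_and_card]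
      refine ⟨fun j j' hjj' => heinj i (by simpa using hjj'), by simp [hUm]⟩
    refine ⟨g.trans (Equiv.ofBijective _ hbij).symm, fun j hj hjt => ?_⟩
    have h1 := hg ⟨j, hj⟩ (by simpa using hjt)
    have h2 := (Equiv.ofBijective _ hbij).apply_symm_apply (g ⟨j, hj⟩)
    rw [Equiv.ofBijective_apply] at h2
    simpa [← h1] using congrArg Subtype.val h2
  choose τ hτ using key
  refine ⟨τ, hbc.congr fun j hj => ?_⟩
  funext i
  have hjm : j < m := by omega
  simp only [rowsOf, hjm, dif_pos, hτ i j hjm hj]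

end BlockCover

/-! ### Proportions in product spaces -/

section Product

variable {ι α : Type*} [Fintype ι] [DecidableEq ι] [Fintype α]

open Classical in
/-- If every line in direction `i` has at most a proportion `ε` of points in `P`, then so has the
whole space. -/
theorem card_le_of_lines (P : (ι → α) → Prop) (i : ι) {ε : ℝ}
    (h : ∀ r, (#{c | P (Function.update r i c)} : ℝ) ≤ ε * Fintype.card α) :
    (#{r | P r} : ℝ) ≤ ε * (Fintype.card α : ℝ) ^ Fintype.card ι := by
  rcases isEmpty_or_nonempty α with hα | hα
  · have : IsEmpty (ι → α) := ⟨fun r => hα.elim (r i)⟩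
    have : Nonempty ι := ⟨i⟩
    rw [eq_empty_of_isEmpty (α := ι → α) {r | P r}]
    simp
  have hpos : (0 : ℝ) < Fintype.card α := by exact_mod_cast Fintype.card_pos
  -- Exchanging the coordinate `i` with the extra entry is an involution of the pairs.
  have h1 : ∑ x : (ι → α) × α, (if P (Function.update x.1 i x.2) then (1 : ℝ) else 0) =
      ∑ x : (ι → α) × α, (if P x.1 then (1 : ℝ) else 0) := by
    refine sum_nbij' (fun x => (Function.update x.1 i x.2, x.1 i))
      (fun x => (Function.update x.1 i x.2, x.1 i)) ?_ ?_ ?_ ?_ ?_ <;> simp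
  rw [Fintype.sum_prod_type, Fintype.sum_prod_type] at h1
  have h2 : ∀ r : ι → α, ∑ c : α, (if P (Function.update r i c) then (1 : ℝ) else 0) ≤
      ε * Fintype.card α := fun r => by
    rw [sum_boole]; exact h r
  have h3 : ∑ r : ι → α, ∑ _c : α, (if P r then (1 : ℝ) else 0) =
      Fintype.card α * #{r | P r} := by
    simp only [sum_const, card_univ, nsmul_eq_mul, ← mul_sum, sum_boole]
  have h4 := sum_le_sum fun r (_ : r ∈ (univ : Finset (ι → α))) => h2 r
  rw [h1, h3, sum_const, card_univ, Fintype.card_fun, nsmul_eq_mul] at h4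
  push_cast at h4
  refine le_of_mul_le_mul_left (h4.trans (le_of_eq ?_)) hpos
  ring

/-- A proportion of at least `a ^ #T` of all points have their coordinates `i ∈ T` in sets `A i` of
density at least `a`. -/
theorem le_card_coordinates [DecidableEq α] (T : Finset ι) (A : ι → Finset α) {a : ℝ} (ha : 0 ≤ a)
    (hA : ∀ i ∈ T, a * Fintype.card α ≤ #(A i)) :
    a ^ #T * (Fintype.card α : ℝ) ^ Fintype.card ι ≤ #{r : ι → α | ∀ i ∈ T, r i ∈ A i} := by
  have h1 : ({r : ι → α | ∀ i ∈ T, r i ∈ A i} : Finset (ι → α)) =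
      Fintype.piFinset fun i => if i ∈ T then A i else univ := by
    ext r
    simp only [mem_filter, mem_univ, true_and, Fintype.mem_piFinset]
    refine forall_congr' fun i => ?_
    by_cases hi : i ∈ T <;> simp [hi]
  rw [h1, Fintype.card_piFinset, Nat.cast_prod]
  have h2 : a ^ #T * (Fintype.card α : ℝ) ^ Fintype.card ι =
      ∏ i : ι, ((if i ∈ T then a else 1) * (Fintype.card α : ℝ)) := by
    rw [prod_mul_distrib, prod_const, card_univ, prod_ite_mem, univ_inter, prod_const]
  rw [h2]
  refine prod_le_prod (fun i _ => ?_) fun i _ => ?_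
  · by_cases hi : i ∈ T
    · simp only [hi, if_true]; positivity
    · simp [hi]
  · by_cases hi : i ∈ T
    · simpa [hi] using hA i hi
    · simp [hi]

variable {W : Type*} [DecidableEq W]

/-- The intersection of `X` with the sets `N i (f i)`, for `i` in the list. -/
def interList (N : ι → α → Finset W) (X : Finset W) (f : ι → α) (l : List ι) : Finset W :=
  l.foldr (fun i Y => N i (f i) ∩ Y) X

set_option linter.unusedSectionVars false in
theorem interList_update (N : ι → α → Finset W) (X : Finset W) (f : ι → α) (i : ι) (c : α)
    {l : List ι} (hi : i ∉ l) :
    interList N X (Function.update f i c) l = interList N X f l := by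
  induction l with
  | nil => rfl
  | cons j l ih =>
    rw [List.mem_cons, not_or] at hi
    have := ih hi.2
    simp only [interList, List.foldr_cons] at this ⊢
    rw [this, Function.update_of_ne (Ne.symm hi.1)]

open Classical in
-- The sets are intersected one at a time. By `hs` a typical intermediate set still has at least `s`
-- elements, and it does not depend on the next coordinate, so every step loses a proportion of at
-- most `ε`.
theorem card_interList_lt_le (N : ι → α → Finset W) {V : Finset W} {d ε s : ℝ} (hd0 : 0 ≤ d)
    (hd1 : d ≤ 1)
    (hreg : ∀ i, ∀ Y ⊆ V, s ≤ #Y →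
      (#{c : α | (#(N i c ∩ Y) : ℝ) < d * #Y} : ℝ) ≤ ε * Fintype.card α)
    {X : Finset W} (hX : X ⊆ V) (hε : 0 ≤ ε) (l : List ι) (hl : l.Nodup)
    (hs : s ≤ d ^ (l.length - 1) * #X) :
    (#{f : ι → α | (#(interList N X f l) : ℝ) < d ^ l.length * #X} : ℝ) ≤
      l.length * ε * (Fintype.card α : ℝ) ^ Fintype.card ι := by
  induction l with
  | nil => simp [interList]
  | cons i l ih =>
    rw [List.nodup_cons] at hl
    have hs' : s ≤ d ^ l.length * #X := by simpa using hs
    have hsub : ∀ f : ι → α, ∀ l : List ι, interList N X f l ⊆ X := by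
      intro f l
      induction l with
      | nil => exact subset_rfl
      | cons j l ih => exact inter_subset_right.trans ih
    have h1 := ih hl.2 (hs'.trans (by
      gcongr ?_ * _
      exact pow_le_pow_of_le_one hd0 hd1 (Nat.sub_le _ _)))
    have h2 := card_le_of_lines (fun f : ι → α => s ≤ #(interList N X f l) ∧
      (#(N i (f i) ∩ interList N X f l) : ℝ) < d * #(interList N X f l)) i (ε := ε) (by
        intro r
        simp only [interList_update N X r i _ hl.1, Function.update_self]
        by_cases hr : s ≤ #(interList N X r l)
        · simpa only [hr, true_and] using hreg i _ ((hsub r l).trans hX) hr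
        · simp only [hr, false_and, filter_false, card_empty, Nat.cast_zero]
          positivity)
    have h3 : ({f : ι → α | (#(interList N X f (i :: l)) : ℝ) < d ^ (i :: l).length * #X} :
        Finset (ι → α)) ⊆ ({f : ι → α | (#(interList N X f l) : ℝ) < d ^ l.length * #X} : Finset (ι → α)) ∪
        ({f : ι → α | s ≤ #(interList N X f l) ∧
          (#(N i (f i) ∩ interList N X f l) : ℝ) < d * #(interList N X f l)} : Finset (ι → α)) := by
      intro f hf
      simp only [mem_union, mem_filter, mem_univ, true_and] at hf ⊢
      by_contra! hc
      refine absurd hf (not_lt.2 ?_)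
      have h4 := hc.2 (hs'.trans hc.1)
      calc d ^ (i :: l).length * (#X : ℝ) = d * (d ^ l.length * #X) := by
            rw [List.length_cons, pow_succ]; ring
        _ ≤ d * #(interList N X f l) := by gcongr; exact hc.1
        _ ≤ _ := h4
    have h5 : (#{f : ι → α | (#(interList N X f (i :: l)) : ℝ) < d ^ (i :: l).length * #X} : ℝ) ≤
        #{f : ι → α | (#(interList N X f l) : ℝ) < d ^ l.length * #X} +
        #{f : ι → α | s ≤ #(interList N X f l) ∧
          (#(N i (f i) ∩ interList N X f l) : ℝ) < d * #(interList N X f l)} := by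
      exact_mod_cast (card_le_card h3).trans (card_union_le _ _)
    have h2' : (#{f : ι → α | s ≤ #(interList N X f l) ∧
        (#(N i (f i) ∩ interList N X f l) : ℝ) < d * #(interList N X f l)} : ℝ) ≤
        ε * (Fintype.card α : ℝ) ^ Fintype.card ι := by convert h2
    refine h5.trans ((add_le_add h1 h2').trans (le_of_eq ?_))
    rw [List.length_cons]
    push_cast
    ring

end Product

/-! ### From disjoint pairs of rows to consecutive rows -/

section Rows

variable {W : Type*} [DecidableEq W] {k m : ℕ}

/-- The pairs `(2 g + o, 2 g + o + 1)`. -/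
def consecutivePairs (t o : ℕ) (h : 2 * t + o ≤ m) : Fin t × Bool ↪ Fin m where
  toFun x := ⟨2 * x.1 + o + (if x.2 then 1 else 0), by
    have := x.1.2
    split_ifs <;> omega⟩
  inj' := by
    rintro ⟨⟨g, hg⟩, b⟩ ⟨⟨g', hg'⟩, b'⟩ h
    cases b <;> cases b' <;> simp at h ⊢ <;> omega

open Classical in
theorem rowsOf_consecutive {W : Type*} (e : Fin k → Fin m → W) (z : W) (σ : Fin k → Equiv.Perm (Fin m))
    (Q : (Fin k → W) → (Fin k → W) → Prop) {t o : ℕ} (h : 2 * t + o ≤ m) :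
    pairCount (consecutivePairs t o h)
      (fun r r' => Q (fun i => e i (r i)) fun i => e i (r' i)) σ =
    #{g ∈ range t | Q (rowsOf e z σ (2 * g + o)) (rowsOf e z σ (2 * g + o + 1))} := by
  rw [pairCount]
  refine card_bij (fun g _ => (g : ℕ)) ?_ ?_ ?_
  · intro g hg
    have h1 : 2 * (g : ℕ) + o + 1 < m := by have := g.2; omega
    have h2 : 2 * (g : ℕ) + o < m := by omega
    rw [mem_filter, mem_range]
    refine ⟨g.2, ?_⟩
    have h3 := (mem_filter.1 hg).2
    unfold rowsOf
    simp only [h1, h2, dif_pos]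
    exact h3
  · intro g _ g' _ h
    exact Fin.ext h
  · intro g hg
    rw [mem_filter, mem_range] at hg
    have h1 : 2 * g + o + 1 < m := by omega
    have h2 : 2 * g + o < m := by omega
    refine ⟨⟨g, hg.1⟩, mem_filter.2 ⟨mem_univ _, ?_⟩, rfl⟩
    have h3 := hg.2
    unfold rowsOf at h3
    simp only [h1, h2, dif_pos] at h3
    exact h3

open Classical Nat in
-- For a lower bound it is enough to count the disjoint pairs `(2g, 2g + 1)` with `g < s`.
theorem card_few_rows_le (e : Fin k → Fin m → W) (z : W) (Q : (Fin k → W) → (Fin k → W) → Prop)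
    {q : ℝ} (hQ : q * ((m : ℝ) ^ k) ^ 2 ≤
      #{x : (Fin k → Fin m) × (Fin k → Fin m) | Q (fun i => e i (x.1 i)) fun i => e i (x.2 i)})
    {s B M : ℕ} (hsm : 4 * s ≤ m) (hsM : 2 * s ≤ M) (hm : 0 < m) :
    (#{σ : Fin k → Equiv.Perm (Fin m) |
      #{j ∈ range M | Q (rowsOf e z σ j) (rowsOf e z σ (j + 1))} < B} : ℝ) ≤
      ((m ! : ℕ) : ℝ) ^ k * Real.exp (8 * k * s ^ 2 / m - q * s / 2 + B) := by
  refine le_trans ?_ (card_few_pairs_le (consecutivePairs s 0 (by omega))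
    (fun r r' => Q (fun i => e i (r i)) fun i => e i (r' i)) (a := B) hQ hsm hm)
  gcongr with σ
  intro h
  rw [rowsOf_consecutive e z]
  refine le_trans ?_ h.le
  refine card_le_card_of_injOn (fun g => 2 * g) (fun g hg => ?_) (fun g _ g' _ h => by
    simpa using h)
  simp only [coe_filter, mem_range, Set.mem_ofPred_eq] at hg ⊢
  exact ⟨by omega, hg.2⟩

open Classical Nat in
-- Splitting by the parity of `j` gives two families of disjoint pairs, one of which has more than
-- half of the exceptions; hence the factor `2` and the exponent `t / 2 + 1`.
theorem card_many_rows_le (e : Fin k → Fin m → W) (z : W) (Q : (Fin k → W) → (Fin k → W) → Prop)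
    {β : ℝ} (hβ : 0 < β) (hβ1 : β ≤ 1) (hQ :
      (#{x : (Fin k → Fin m) × (Fin k → Fin m) | Q (fun i => e i (x.1 i)) fun i => e i (x.2 i)} : ℝ)
        ≤ β * ((m : ℝ) ^ k) ^ 2) (t : ℕ) :
    (#{σ : Fin k → Equiv.Perm (Fin m) |
      t < #{j ∈ range (m - 1) | Q (rowsOf e z σ j) (rowsOf e z σ (j + 1))}} : ℝ) ≤
      ((m ! : ℕ) : ℝ) ^ k * (2 * (Real.exp (k * m) * 2 ^ m * β ^ (t / 2 + 1))) := by
  set P : (Fin k → Fin m) → (Fin k → Fin m) → Prop :=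
    fun r r' => Q (fun i => e i (r i)) fun i => e i (r' i) with hP
  have hev : 2 * (m / 2) + 0 ≤ m := by omega
  have hodd : 2 * ((m - 1) / 2) + 1 ≤ m ∨ m = 0 := by omega
  rcases hodd with hodd | rfl
  swap
  · rw [filter_false_of_mem (by simp)]
    simp only [card_empty, Nat.cast_zero]
    positivity
  have h1 := card_many_pairs_le (a := t / 2 + 1) (consecutivePairs (m / 2) 0 hev) P hβ hQ hβ1
    (by omega)
  have h2 := card_many_pairs_le (a := t / 2 + 1) (consecutivePairs ((m - 1) / 2) 1 hodd) P hβ hQ hβ1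
    (by omega)
  have hpow : ∀ s ≤ m, ((m ! : ℕ) : ℝ) ^ k * (Real.exp (k * m) * 2 ^ s * β ^ (t / 2 + 1)) ≤
      ((m ! : ℕ) : ℝ) ^ k * (Real.exp (k * m) * 2 ^ m * β ^ (t / 2 + 1)) := by
    intro s hs
    gcongr
    norm_num
  have h1' := h1.trans (hpow _ (by omega))
  have h2' := h2.trans (hpow _ (by omega))
  have h3 : ({σ : Fin k → Equiv.Perm (Fin m) |
      t < #{j ∈ range (m - 1) | Q (rowsOf e z σ j) (rowsOf e z σ (j + 1))}} : Finset _) ⊆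
      ({σ | t / 2 + 1 ≤ pairCount (consecutivePairs (m / 2) 0 hev) P σ} : Finset _) ∪
      ({σ | t / 2 + 1 ≤ pairCount (consecutivePairs ((m - 1) / 2) 1 hodd) P σ} : Finset _) := by
    intro σ hσ
    simp only [mem_union, mem_filter, mem_univ, true_and] at hσ ⊢
    rw [rowsOf_consecutive e z, rowsOf_consecutive e z]
    have h4 : ({j ∈ range (m - 1) | Q (rowsOf e z σ j) (rowsOf e z σ (j + 1))} : Finset ℕ) ⊆
        ({g ∈ range (m / 2) | Q (rowsOf e z σ (2 * g + 0)) (rowsOf e z σ (2 * g + 0 + 1))} :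
          Finset ℕ).image (fun g => 2 * g) ∪
        ({g ∈ range ((m - 1) / 2) | Q (rowsOf e z σ (2 * g + 1)) (rowsOf e z σ (2 * g + 1 + 1))} :
          Finset ℕ).image (fun g => 2 * g + 1) := by
      intro j hj
      rw [mem_filter, mem_range] at hj
      rcases Nat.even_or_odd' j with ⟨g, rfl | rfl⟩
      · exact mem_union_left _ (mem_image.2 ⟨g, mem_filter.2 ⟨mem_range.2 (by omega), hj.2⟩, rfl⟩)
      · exact mem_union_right _ (mem_image.2 ⟨g, mem_filter.2 ⟨mem_range.2 (by omega), hj.2⟩, rfl⟩)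
    have h5 := (card_le_card h4).trans (card_union_le _ _)
    have h6 := Finset.card_image_le (s := ({g ∈ range (m / 2) |
      Q (rowsOf e z σ (2 * g + 0)) (rowsOf e z σ (2 * g + 0 + 1))} : Finset ℕ)) (f := fun g => 2 * g)
    have h7 := Finset.card_image_le (s := ({g ∈ range ((m - 1) / 2) |
      Q (rowsOf e z σ (2 * g + 1)) (rowsOf e z σ (2 * g + 1 + 1))} : Finset ℕ))
      (f := fun g => 2 * g + 1)
    omega
  have h8 : (#{σ : Fin k → Equiv.Perm (Fin m) |
      t < #{j ∈ range (m - 1) | Q (rowsOf e z σ j) (rowsOf e z σ (j + 1))}} : ℝ) ≤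
      #{σ | t / 2 + 1 ≤ pairCount (consecutivePairs (m / 2) 0 hev) P σ} +
      #{σ | t / 2 + 1 ≤ pairCount (consecutivePairs ((m - 1) / 2) 1 hodd) P σ} := by
    exact_mod_cast (card_le_card h3).trans (card_union_le _ _)
  linarith

end Rows

/-! ### Random rows are spread -/

section Spread

variable {W : Type*} [DecidableEq W] {k m : ℕ}

open Classical in
-- Two rows become one point with `2k` coordinates. The four vertices around a gap then sit at
-- different coordinates, even for `k = 2`.
theorem card_pairs_eq_card_sum (P : (Fin k → Fin m) → (Fin k → Fin m) → Prop) :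
    #{x : (Fin k → Fin m) × (Fin k → Fin m) | P x.1 x.2} =
      #{f : Fin k ⊕ Fin k → Fin m | P (f ∘ Sum.inl) (f ∘ Sum.inr)} := by
  refine (card_equiv (Equiv.sumArrowEquivProdArrow (Fin k) (Fin k) (Fin m)) fun f => ?_).symm
  simp only [mem_filter, mem_univ, true_and]
  exact Iff.rfl

open Classical in
theorem le_card_pairs (T : Finset (Fin k ⊕ Fin k)) (A : Fin k ⊕ Fin k → Finset (Fin m)) {a : ℝ}
    (ha : 0 ≤ a) (hA : ∀ i ∈ T, a * m ≤ #(A i))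
    (P : (Fin k → Fin m) → (Fin k → Fin m) → Prop)
    (hP : ∀ f : Fin k ⊕ Fin k → Fin m, (∀ i ∈ T, f i ∈ A i) → P (f ∘ Sum.inl) (f ∘ Sum.inr)) :
    a ^ #T * ((m : ℝ) ^ k) ^ 2 ≤ #{x : (Fin k → Fin m) × (Fin k → Fin m) | P x.1 x.2} := by
  rw [card_pairs_eq_card_sum]
  have h := le_card_coordinates T A ha (by simpa using hA)
  rw [Fintype.card_fin, Fintype.card_sum, Fintype.card_fin, ← two_mul, mul_comm 2 k, pow_mul] at h
  refine h.trans ?_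
  gcongr with f
  exact hP f

/-- The vertices that are adjacent to the last two vertices of the row `r` and to the first two
vertices of the row `r'`. -/
def sepNbrs (nb : W → Finset W) (i₀ i₁ i₂ i₃ : Fin k) (r r' : Fin k → W) : Finset W :=
  (nb (r i₂) ∩ nb (r i₃)) ∩ (nb (r' i₀) ∩ nb (r' i₁))

open Classical in
/-- In the sequence of rows `w`, few consecutive pairs have a small set `Z` in a large set `X`,
every vertex is in many sets `Z`, and many rows satisfy `Px` and `Py`. -/
structure IsSpread (V : Finset W) (Z : (Fin k → W) → (Fin k → W) → Finset W)
    (Px Py : (Fin k → W) → Prop) (m t B : ℕ) (d : ℝ) (w : ℕ → Fin k → W) : Prop where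
  large : ∀ X ⊆ V, t ≤ #X →
    #{j ∈ range (m - 1) | (#(Z (w j) (w (j + 1)) ∩ X) : ℝ) < d ^ 4 * #X} ≤ t
  mem : ∀ v ∈ V, B ≤ #{j ∈ range (m - t - 1) | v ∈ Z (w j) (w (j + 1))}
  first : B ≤ #{j ∈ range (m - t - 1) | Px (w j)}
  last : B ≤ #{j ∈ range (m - t - 1) | Py (w j)}

open Classical in
theorem card_sepNbrs_lt_le (e : Fin k → Fin m → W) (nb : W → Finset W) {i₀ i₁ i₂ i₃ : Fin k}
    (h₀₁ : i₀ ≠ i₁) (h₂₃ : i₂ ≠ i₃) {V : Finset W} {d ε s : ℝ} (hd0 : 0 ≤ d) (hd1 : d ≤ 1)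
    (hε : 0 ≤ ε)
    (hreg : ∀ i, ∀ Y ⊆ V, s ≤ #Y → (#{c : Fin m | (#(nb (e i c) ∩ Y) : ℝ) < d * #Y} : ℝ) ≤ ε * m)
    {X : Finset W} (hX : X ⊆ V) (hs : s ≤ d ^ 3 * #X) :
    (#{x : (Fin k → Fin m) × (Fin k → Fin m) |
      (#(sepNbrs nb i₀ i₁ i₂ i₃ (fun i => e i (x.1 i)) (fun i => e i (x.2 i)) ∩ X) : ℝ) <
        d ^ 4 * #X} : ℝ) ≤ 4 * ε * ((m : ℝ) ^ k) ^ 2 := by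
  rw [card_pairs_eq_card_sum fun r r' => (#(sepNbrs nb i₀ i₁ i₂ i₃ (fun i => e i (r i))
    (fun i => e i (r' i)) ∩ X) : ℝ) < d ^ 4 * #X]
  have h := card_interList_lt_le (ι := Fin k ⊕ Fin k) (α := Fin m)
    (fun i c => nb (Sum.elim (fun i => e i c) (fun i => e i c) i)) (V := V) (d := d) (ε := ε) (s := s)
    hd0 hd1 (by
      rintro (i | i) Y hY hYs
      · convert hreg i Y hY hYs <;> first | rfl | exact Fintype.card_fin m
      · convert hreg i Y hY hYs <;> first | rfl | exact Fintype.card_fin m) hX hε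
    [Sum.inl i₂, Sum.inl i₃, Sum.inr i₀, Sum.inr i₁] (by simp [h₀₁, h₂₃]) (by simpa using hs)
  rw [Fintype.card_fin, Fintype.card_sum, Fintype.card_fin, ← two_mul, mul_comm 2 k, pow_mul] at h
  refine (le_of_eq ?_).trans (h.trans (le_of_eq (by norm_num)))
  congr 2
  ext f
  simp [interList, sepNbrs, inter_assoc]

open Classical Nat in
-- A union bound over at most `2 ^ #V` sets `X`, with the strong upper tail, and over `#V + 2` lower
-- tails. A vertex fits a random pair of rows with proportion at least `d ^ 4`, by its degree at
-- four coordinates.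
theorem card_not_isSpread_le (e : Fin k → Fin m → W) (z : W) (nb : W → Finset W)
    {i₀ i₁ i₂ i₃ : Fin k} (h₀₁ : i₀ ≠ i₁) (h₂₃ : i₂ ≠ i₃) {V : Finset W} {d ε q : ℝ} (hd0 : 0 ≤ d)
    (hd1 : d ≤ 1) (hε : 0 < ε) (hε1 : 4 * ε ≤ 1) {t B s₀ : ℕ}
    (hreg : ∀ i, ∀ Y ⊆ V, d ^ 3 * t ≤ #Y →
      (#{c : Fin m | (#(nb (e i c) ∩ Y) : ℝ) < d * #Y} : ℝ) ≤ ε * m)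
    (hdeg : ∀ v ∈ V, ∀ i, d * m ≤ #{c : Fin m | v ∈ nb (e i c)})
    (hq : q ≤ d ^ 4) (Px Py : (Fin k → W) → Prop)
    (hPx : q * ((m : ℝ) ^ k) ^ 2 ≤
      #{x : (Fin k → Fin m) × (Fin k → Fin m) | Px fun i => e i (x.1 i)})
    (hPy : q * ((m : ℝ) ^ k) ^ 2 ≤
      #{x : (Fin k → Fin m) × (Fin k → Fin m) | Py fun i => e i (x.1 i)})
    (hsm : 4 * s₀ ≤ m) (hst : 2 * s₀ ≤ m - t - 1) (hm : 0 < m) :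
    (#{σ : Fin k → Equiv.Perm (Fin m) |
      ¬ IsSpread V (sepNbrs nb i₀ i₁ i₂ i₃) Px Py m t B d (rowsOf e z σ)} : ℝ) ≤
      ((m ! : ℕ) : ℝ) ^ k * (2 ^ #V * (2 * (Real.exp (k * m) * 2 ^ m * (4 * ε) ^ (t / 2 + 1))) +
        (#V + 2) * Real.exp (8 * k * s₀ ^ 2 / m - q * s₀ / 2 + B)) := by
  set Z := sepNbrs nb i₀ i₁ i₂ i₃ with hZ
  set F₁ : Finset W → Finset (Fin k → Equiv.Perm (Fin m)) := fun X =>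
    {σ | t < #{j ∈ range (m - 1) |
      (#(Z (rowsOf e z σ j) (rowsOf e z σ (j + 1)) ∩ X) : ℝ) < d ^ 4 * #X}} with hF₁
  set F₂ : W → Finset (Fin k → Equiv.Perm (Fin m)) := fun v =>
    {σ | #{j ∈ range (m - t - 1) | v ∈ Z (rowsOf e z σ j) (rowsOf e z σ (j + 1))} < B} with hF₂
  set Fx : Finset (Fin k → Equiv.Perm (Fin m)) :=
    {σ | #{j ∈ range (m - t - 1) | Px (rowsOf e z σ j)} < B} with hFx
  set Fy : Finset (Fin k → Equiv.Perm (Fin m)) :=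
    {σ | #{j ∈ range (m - t - 1) | Py (rowsOf e z σ j)} < B} with hFy
  have hsub : ({σ : Fin k → Equiv.Perm (Fin m) | ¬ IsSpread V Z Px Py m t B d (rowsOf e z σ)} :
      Finset _) ⊆ ((({X ∈ V.powerset | t ≤ #X} : Finset _).biUnion F₁) ∪ (V.biUnion F₂)) ∪
        (Fx ∪ Fy) := by
    intro σ hσ
    by_contra hc
    simp only [mem_union, mem_biUnion, mem_filter, mem_powerset, not_or, not_exists, not_and, hF₁,
      hF₂, hFx, hFy, mem_univ, true_and, not_lt] at hc
    exact (mem_filter.1 hσ).2 ⟨fun X hX hXt => hc.1.1 X ⟨hX, hXt⟩, hc.1.2, hc.2.1, hc.2.2⟩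
  have hlow := card_few_rows_le e z (q := q) (s := s₀) (B := B) (M := m - t - 1)
  have c₁ : ∀ X ∈ ({X ∈ V.powerset | t ≤ #X} : Finset _), (#(F₁ X) : ℝ) ≤
      ((m ! : ℕ) : ℝ) ^ k * (2 * (Real.exp (k * m) * 2 ^ m * (4 * ε) ^ (t / 2 + 1))) := by
    intro X hX
    rw [mem_filter, mem_powerset] at hX
    exact card_many_rows_le e z (fun r r' => (#(Z r r' ∩ X) : ℝ) < d ^ 4 * #X) (by positivity) hε1
      (card_sepNbrs_lt_le e nb h₀₁ h₂₃ hd0 hd1 hε.le hreg hX.1 (by gcongr; exact hX.2)) t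
  have c₂ : ∀ v ∈ V, (#(F₂ v) : ℝ) ≤
      ((m ! : ℕ) : ℝ) ^ k * Real.exp (8 * k * s₀ ^ 2 / m - q * s₀ / 2 + B) := by
    intro v hv
    rw [hF₂]
    convert hlow (fun r r' => v ∈ Z r r') ?_ hsm hst hm
    have h1 := le_card_pairs ({Sum.inl i₂, Sum.inl i₃, Sum.inr i₀, Sum.inr i₁} :
        Finset (Fin k ⊕ Fin k)) (Sum.elim (fun i => ({c : Fin m | v ∈ nb (e i c)} : Finset (Fin m)))
        fun i => ({c : Fin m | v ∈ nb (e i c)} : Finset (Fin m))) hd0 (by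
          rintro (i | i) -
          · exact hdeg v hv i
          · exact hdeg v hv i)
      (fun r r' => v ∈ Z (fun i => e i (r i)) fun i => e i (r' i)) (by
        intro f hf
        simp only [mem_insert, mem_singleton, forall_eq_or_imp, forall_eq, Sum.elim_inl,
          Sum.elim_inr, mem_filter, mem_univ, true_and] at hf
        simp only [hZ, sepNbrs, mem_inter, Function.comp]
        tauto)
    refine le_trans ?_ h1
    rw [card_insert_of_notMem (by simp [h₂₃]), card_insert_of_notMem (by simp),
      card_insert_of_notMem (by simp [h₀₁]), card_singleton]
    gcongr
  have cx : (#Fx : ℝ) ≤ _ := hlow (fun r _ => Px r) hPx hsm hst hm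
  have cy : (#Fy : ℝ) ≤ _ := hlow (fun r _ => Py r) hPy hsm hst hm
  have hle := (card_le_card hsub).trans ((card_union_le _ _).trans
    (Nat.add_le_add ((card_union_le _ _).trans (Nat.add_le_add card_biUnion_le card_biUnion_le))
      (card_union_le _ _)))
  have hle' : (#{σ : Fin k → Equiv.Perm (Fin m) |
      ¬ IsSpread V Z Px Py m t B d (rowsOf e z σ)} : ℝ) ≤
      (∑ X ∈ ({X ∈ V.powerset | t ≤ #X} : Finset _), (#(F₁ X) : ℝ) + ∑ v ∈ V, (#(F₂ v) : ℝ)) +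
        (#Fx + #Fy) := by exact_mod_cast hle
  have s₁ := sum_le_card_nsmul _ _ _ c₁
  have s₂ := sum_le_card_nsmul _ _ _ c₂
  rw [nsmul_eq_mul] at s₁ s₂
  have hcard : (#({X ∈ V.powerset | t ≤ #X} : Finset _) : ℝ) ≤ 2 ^ #V := by
    have := (card_filter_le V.powerset fun X => t ≤ #X).trans_eq (card_powerset V)
    exact_mod_cast this
  have s₁' := s₁.trans (mul_le_mul_of_nonneg_right hcard (by positivity))
  refine hle'.trans ((_root_.add_le_add (_root_.add_le_add s₁' s₂) (_root_.add_le_add cx cy)).trans (le_of_eq ?_))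
  ring

end Spread

/-! ### Failure probabilities of the random edges -/

section EdgeProbability

variable {W : Type*} [DecidableEq W] {k : ℕ}

theorem BlockRich.mono {S S' : Finset (Sym2 W)} {U : Fin k → Finset W} {t : ℕ} {i₀ i₃ : Fin k}
    (h : BlockRich S U t i₀ i₃) (hSS' : S ⊆ S') : BlockRich S' U t i₀ i₃ where
  block A hA hAt := by
    obtain ⟨a, ha, haS⟩ := h.block A hA hAt
    exact ⟨a, ha, haS.trans hSS'⟩
  edge A B hA hB hAt hBt := by
    obtain ⟨a, ha, b, hb, hab⟩ := h.edge A B hA hB hAt hBt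
    exact ⟨a, ha, b, hb, hSS' hab⟩

open Classical in
-- `BlockRich` is monotone, so `p` may be lowered to `q`, where `hmq` bounds the correlations. A
-- union bound over boxes and over pairs of sets does the rest.
theorem bexp_not_blockRich_le {p q : ℝ} (hq0 : 0 ≤ q) (hqp : q ≤ p) (hp1 : p ≤ 1)
    {E : Finset (Sym2 W)} {U : Fin k → Finset W} {m t : ℕ} {i₀ i₃ : Fin k} (hi : i₃ ≠ i₀)
    (hk : 2 ≤ k) (hU : ∀ i j, i ≠ j → Disjoint (U i) (U j)) (hUm : ∀ i, #(U i) = m)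
    (hE : ∀ i j, i ≠ j → ∀ a ∈ U i, ∀ b ∈ U j, s(a, b) ∈ E)
    (hmq : (1 + m * q ^ 2) ^ k ≤ 3 / 2) :
    bexp p E (fun S => if ¬ BlockRich S U t i₀ i₃ then 1 else 0) ≤
      (2 ^ m) ^ k * Real.exp (-((t : ℝ) ^ k * q ^ (2 * k - 3) / 2)) +
      (2 ^ m * 2 ^ m) * Real.exp (-((t : ℝ) * t * q)) := by
  have hq1 := hqp.trans hp1
  refine (bexp_anti hq0 hqp hp1 ?_).trans ?_
  · intro S S' hSS'
    by_cases h : BlockRich S U t i₀ i₃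
    · simp [h, h.mono hSS']
    · by_cases h' : BlockRich S' U t i₀ i₃ <;> simp [h, h']
  set I : Finset (Fin k → Finset W) :=
    Fintype.piFinset fun i => {A ∈ (U i).powerset | t ≤ #A} with hI
  set J : Finset (Finset W × Finset W) :=
    {A ∈ (U i₃).powerset | t ≤ #A} ×ˢ {A ∈ (U i₀).powerset | t ≤ #A} with hJ
  have hpow : ∀ i, (#({A ∈ (U i).powerset | t ≤ #A} : Finset _) : ℝ) ≤ 2 ^ m := fun i => by
    have := (card_filter_le (U i).powerset fun A => t ≤ #A).trans_eq (card_powerset (U i))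
    rw [hUm] at this
    exact_mod_cast this
  have hIc : (#I : ℝ) ≤ (2 ^ m) ^ k := by
    rw [hI, Fintype.card_piFinset, Nat.cast_prod]
    refine (prod_le_prod (fun i _ => Nat.cast_nonneg _) fun i _ => hpow i).trans (le_of_eq ?_)
    simp
  have hJc : (#J : ℝ) ≤ 2 ^ m * 2 ^ m := by
    rw [hJ, card_product, Nat.cast_mul]
    exact mul_le_mul (hpow _) (hpow _) (Nat.cast_nonneg _) (by positivity)
  obtain ⟨P₁, hP₁⟩ : ∃ P : (Fin k → Finset W) → Finset (Sym2 W) → Prop, P =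
    fun A S => ∀ a : Fin k → W, (∀ i, a i ∈ A i) → ¬ blockEdges a ⊆ S := ⟨_, rfl⟩
  obtain ⟨P₂, hP₂⟩ : ∃ P : Finset W × Finset W → Finset (Sym2 W) → Prop, P =
    fun A S => ∀ a ∈ A.1, ∀ b ∈ A.2, s(a, b) ∉ S := ⟨_, rfl⟩
  have h1 := bexp_union_bound hq0 hq1 (E := E) I P₁
    (c := Real.exp (-((t : ℝ) ^ k * q ^ (2 * k - 3) / 2))) (by
      intro A hA
      simp only [hI, Fintype.mem_piFinset, mem_filter, mem_powerset] at hA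
      rw [hP₁]
      refine (le_of_eq (by congr!)).trans ((bexp_no_block_le hq0 hq1 hk hU (fun i => (hA i).1)
        (fun i => (card_le_card (hA i).1).trans (hUm i).le) ?_ hmq).trans ?_)
      · intro a ha s hs
        obtain ⟨⟨i, j⟩, hij, rfl⟩ := mem_image.1 hs
        have hlt : (i : ℕ) < j := (mem_filter.1 hij).2.1
        exact hE i j (fun h => by rw [h] at hlt; omega) _ (ha i) _ (ha j)
      · refine Real.exp_le_exp.2 (neg_le_neg ?_)
        have h2 : (t : ℝ) ^ k ≤ ∏ i, (#(A i) : ℝ) := by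
          refine le_trans (le_of_eq (by simp)) (prod_le_prod (f := fun _ : Fin k => (t : ℝ))
            (fun i _ => Nat.cast_nonneg _) fun i _ => Nat.cast_le.2 (hA i).2)
        gcongr)
  have h2 := bexp_union_bound hq0 hq1 (E := E) J P₂
    (c := Real.exp (-((t : ℝ) * t * q))) (by
      intro A hA
      simp only [hJ, mem_product, mem_filter, mem_powerset] at hA
      rw [hP₂]
      refine (le_of_eq (by congr!)).trans ((bexp_no_edge_le hq0 hq1 ((hU _ _ hi).mono hA.1.1 hA.2.1) fun a ha b hb =>
        hE _ _ hi _ (hA.1.1 ha) _ (hA.2.1 hb)).trans (Real.exp_le_exp.2 (neg_le_neg ?_)))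
      gcongr
      · exact hA.1.2
      · exact hA.2.2)
  refine le_trans (bexp_mono hq0 hq1 (g := fun S =>
    (if ∃ A ∈ I, P₁ A S then (1 : ℝ) else 0) +
    (if ∃ A ∈ J, P₂ A S then (1 : ℝ) else 0)) ?_) ?_
  · intro S _
    by_cases hc₁ : ∃ A ∈ I, P₁ A S
    · rw [if_pos hc₁]
      split_ifs <;> norm_num
    by_cases hc₂ : ∃ A ∈ J, P₂ A S
    · rw [if_neg hc₁, if_pos hc₂]
      split_ifs <;> norm_num
    rw [if_neg hc₁, if_neg hc₂, if_neg, add_zero]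
    rw [not_not]
    refine ⟨fun A hA hAt => ?_, fun A B hA hB hAt hBt => ?_⟩
    · by_contra! h
      rw [hP₁] at hc₁
      exact hc₁ ⟨A, Fintype.mem_piFinset.2 fun i =>
        mem_filter.2 ⟨mem_powerset.2 (hA i), hAt i⟩, h⟩
    · by_contra! h
      rw [hP₂] at hc₂
      exact hc₂ ⟨(A, B), mem_product.2 ⟨mem_filter.2 ⟨mem_powerset.2 hA, hAt⟩,
        mem_filter.2 ⟨mem_powerset.2 hB, hBt⟩⟩, h⟩
  · rw [bexp_add]
    refine add_le_add (h1.trans ?_) (h2.trans ?_)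
    · gcongr
    · gcongr

open Classical in
theorem bexp_not_joinsLarge_le {p : ℝ} (hp0 : 0 ≤ p) (hp1 : p ≤ 1) (E : Finset (Sym2 W))
    (V : Finset W) (t : ℕ) (hE : ∀ a ∈ V, ∀ b ∈ V, a ≠ b → s(a, b) ∈ E) :
    bexp p E (fun S => if ¬ JoinsLarge (SimpleGraph.fromEdgeSet (S : Set (Sym2 W))) V t
      then 1 else 0) ≤ (2 ^ #V * 2 ^ #V) * Real.exp (-((t : ℝ) * t * p)) := by
  set J : Finset (Finset W × Finset W) := {A ∈ V.powerset ×ˢ V.powerset |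
    Disjoint A.1 A.2 ∧ t ≤ #A.1 ∧ t ≤ #A.2} with hJ
  have hJc : (#J : ℝ) ≤ 2 ^ #V * 2 ^ #V := by
    have := card_filter_le (V.powerset ×ˢ V.powerset) fun A =>
      Disjoint A.1 A.2 ∧ t ≤ #A.1 ∧ t ≤ #A.2
    rw [card_product, card_powerset] at this
    exact_mod_cast this
  obtain ⟨P₂, hP₂⟩ : ∃ P : Finset W × Finset W → Finset (Sym2 W) → Prop, P =
    fun A S => ∀ a ∈ A.1, ∀ b ∈ A.2, s(a, b) ∉ S := ⟨_, rfl⟩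
  have h2 := bexp_union_bound hp0 hp1 (E := E) J P₂
    (c := Real.exp (-((t : ℝ) * t * p))) (by
      intro A hA
      simp only [hJ, mem_product, mem_filter, mem_powerset] at hA
      rw [hP₂]
      refine (le_of_eq (by congr!)).trans ((bexp_no_edge_le hp0 hp1 hA.2.1 fun a ha b hb =>
        hE _ (hA.1.1 ha) _ (hA.1.2 hb) fun h => disjoint_left.1 hA.2.1 ha (h ▸ hb)).trans
          (Real.exp_le_exp.2 (neg_le_neg ?_)))
      gcongr
      · exact hA.2.2.1
      · exact hA.2.2.2)
  refine le_trans (bexp_mono hp0 hp1 (g := fun S =>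
    (if ∃ A ∈ J, P₂ A S then (1 : ℝ) else 0)) ?_)
    (h2.trans (by gcongr))
  intro S _
  by_cases hc₂ : ∃ A ∈ J, P₂ A S
  · rw [if_pos hc₂]
    split_ifs <;> norm_num
  rw [if_neg hc₂, if_neg]
  rw [not_not]
  intro A B hA hB hAB hAt hBt
  by_contra! h
  rw [hP₂] at hc₂
  refine hc₂ ⟨(A, B), mem_filter.2 ⟨mem_product.2 ⟨mem_powerset.2 hA, mem_powerset.2 hB⟩, hAB, hAt,
    hBt⟩, fun a ha b hb hS => h a ha b hb ?_⟩
  rw [SimpleGraph.fromEdgeSet_adj]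
  exact ⟨hS, fun h => disjoint_left.1 hAB ha (h ▸ hb)⟩

end EdgeProbability

/-! ### Symmetry: passing to random rows -/

section Averaging

variable {W : Type*} [DecidableEq W] {k m : ℕ}

/-- Index permutations become symmetries of the complete multipartite graph, under which its random
subgraph is invariant. -/
theorem exists_perm_extending {U : Fin k → Finset W} (hU : ∀ i j, i ≠ j → Disjoint (U i) (U j))
    (hUm : ∀ i, #(U i) = m) (e : Fin k → Fin m → W) (heU : ∀ i c, e i c ∈ U i)
    (heinj : ∀ i, Function.Injective (e i)) (ρ : Fin k → Equiv.Perm (Fin m)) :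
    ∃ π : Equiv.Perm W, (∀ i c, π (e i c) = e i (ρ i c)) ∧ ∀ i, ∀ u ∈ U i, π u ∈ U i := by
  have hinj : Function.Injective fun x : (_ : Fin k) × Fin m => e x.1 x.2 := by
    rintro ⟨i, c⟩ ⟨j, c'⟩ h
    obtain rfl := index_unique hU (heU i c) (by simpa [show e i c = e j c' from h] using heU j c')
    exact congrArg (Sigma.mk i) (heinj i h)
  have h1 : ∀ i c, Equiv.Perm.viaEmbedding (Equiv.sigmaCongrRight ρ)
      ⟨_, hinj⟩ (e i c) = e i (ρ i c) := fun i c =>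
    Equiv.Perm.viaEmbedding_apply _ ⟨_, hinj⟩ (⟨i, c⟩ : (_ : Fin k) × Fin m)
  refine ⟨_, h1, fun i u hu => ?_⟩
  have himg : (univ : Finset (Fin m)).image (e i) = U i :=
    eq_of_subset_of_card_le (fun u hu => by
      obtain ⟨c, -, rfl⟩ := mem_image.1 hu
      exact heU i c) (by rw [card_image_of_injective _ (heinj i), hUm]; simp)
  rw [← himg] at hu
  obtain ⟨c, -, rfl⟩ := mem_image.1 hu
  rw [h1]
  exact heU i _

/-- The action of a permutation on unordered pairs. -/
def sym2Perm (π : Equiv.Perm W) : Equiv.Perm (Sym2 W) where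
  toFun := Sym2.map π
  invFun := Sym2.map π.symm
  left_inv s := by simp [Sym2.map_map]
  right_inv s := by simp [Sym2.map_map]

theorem mk_mem_map_sym2Perm {W : Type*} (π : Equiv.Perm W) (S : Finset (Sym2 W)) (a b : W) :
    s(π a, π b) ∈ S.map (sym2Perm π).toEmbedding ↔ s(a, b) ∈ S :=
  mem_map' (f := (sym2Perm π).toEmbedding) (a := s(a, b))

theorem IsBlockCover.map {S : Finset (Sym2 W)} {w : ℕ → Fin k → W} {N t : ℕ} {i₀ i₃ : Fin k}
    (h : IsBlockCover S w N t i₀ i₃) (π : Equiv.Perm W) :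
    IsBlockCover (S.map (sym2Perm π).toEmbedding) (fun j i => π (w j i)) N t i₀ i₃ where
  block j hj s hs := by
    obtain ⟨x, hx, rfl⟩ := mem_image.1 hs
    exact (mk_mem_map_sym2Perm π S _ _).2 (h.block j hj (mem_image.2 ⟨x, hx, rfl⟩))
  link := by
    simp only [mk_mem_map_sym2Perm]
    exact h.link

open Classical Nat in
/-- The rows of a block cover may be taken to have any property that almost all permutations of the
indices have. -/
theorem bexp_not_exists_cover_le {p : ℝ} (hp0 : 0 ≤ p) (hp1 : p ≤ 1) {E : Finset (Sym2 W)}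
    {U : Fin k → Finset W} {t : ℕ} {i₀ i₃ : Fin k}
    (hU : ∀ i j, i ≠ j → Disjoint (U i) (U j)) (hUm : ∀ i, #(U i) = m)
    (hE : ∀ a b, s(a, b) ∈ E ↔ ∃ i j, i ≠ j ∧ a ∈ U i ∧ b ∈ U j) (ht : 1 ≤ t)
    (e : Fin k → Fin m → W) (heU : ∀ i c, e i c ∈ U i)
    (heinj : ∀ i, Function.Injective (e i)) (z : W) (N : (ℕ → Fin k → W) → Prop) {κ : ℝ}
    (hκ : 0 ≤ κ) (hN : (#{σ : Fin k → Equiv.Perm (Fin m) | ¬ N (rowsOf e z σ)} : ℝ) ≤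
      ((m ! : ℕ) : ℝ) ^ k * κ) :
    bexp p E (fun S => if ¬ ∃ σ : Fin k → Equiv.Perm (Fin m), N (rowsOf e z σ) ∧
      IsBlockCover S (rowsOf e z σ) (m - t) t i₀ i₃ then 1 else 0) ≤
    bexp p E (fun S => if ¬ BlockRich S U t i₀ i₃ then 1 else 0) + κ := by
  choose π hπe hπU using exists_perm_extending hU hUm e heU heinj
  have hmaps : ∀ ρ, E.map (sym2Perm (π ρ)).toEmbedding = E := by
    intro ρ
    refine eq_of_subset_of_card_le (fun s hs => ?_) (by rw [card_map])
    obtain ⟨s, hs', rfl⟩ := mem_map.1 hs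
    induction s using Sym2.ind with
    | _ a b =>
      obtain ⟨i, j, hij, ha, hb⟩ := (hE a b).1 hs'
      exact (hE _ _).2 ⟨i, j, hij, hπU ρ i a ha, hπU ρ j b hb⟩
  refine (le_of_eq (by congr!)).trans (bexp_le_of_average hp0 hp1 (fun ρ => sym2Perm (π ρ)) hmaps
    (fun S => BlockRich S U t i₀ i₃)
    (fun S => ¬ ∃ σ : Fin k → Equiv.Perm (Fin m), N (rowsOf e z σ) ∧
      IsBlockCover S (rowsOf e z σ) (m - t) t i₀ i₃) hκ ?_)
  intro S _ hS
  obtain ⟨τ, hτ⟩ := hS.exists_perms hUm ht e heU heinj z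
  have hcard : (Fintype.card (Fin k → Equiv.Perm (Fin m)) : ℝ) = ((m ! : ℕ) : ℝ) ^ k := by
    rw [Fintype.card_fun, Fintype.card_perm, Fintype.card_fin, Fintype.card_fin]
    push_cast; rfl
  rw [hcard, mul_comm]
  refine le_trans ?_ hN
  rw [Nat.cast_le]
  -- The cover with rows `τ` is moved by `ρ` to one with rows `ρ * τ`. So each `ρ` for which the
  -- moved graph is bad gives an atypical tuple `ρ * τ`, injectively.
  refine card_le_card_of_injOn (fun ρ => ρ * τ) (fun ρ hρ => ?_)
    fun ρ _ ρ' _ h => mul_right_cancel h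
  simp only [coe_filter, mem_univ, true_and, Set.mem_ofPred_eq] at hρ ⊢
  refine fun hNρ => hρ ⟨ρ * τ, hNρ, (hτ.map (π ρ)).congr fun j hj => ?_⟩
  funext i
  have hjm : j < m := by omega
  simp only [rowsOf, hjm, dif_pos, hπe, Pi.mul_apply, Equiv.Perm.mul_apply]

end Averaging

/-! ### From spread rows to the path -/

section Deterministic

theorem card_filter_range_mono {M M' : ℕ} (hM : M ≤ M') {P Q : ℕ → Prop} {_ : DecidablePred P}
    {_ : DecidablePred Q} (h : ∀ j < M, P j → Q j) : #{j ∈ range M | P j} ≤ #{j ∈ range M' | Q j} := by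
  refine card_le_card fun j hj => ?_
  rw [mem_filter, mem_range] at hj ⊢
  exact ⟨hj.1.trans_le hM, h j hj.1 hj.2⟩

variable {W : Type*} [DecidableEq W] {k m : ℕ}

theorem rowsOf_mem {W : Type*} {U : Fin k → Finset W} {e : Fin k → Fin m → W} (heU : ∀ i c, e i c ∈ U i) (z : W)
    (σ : Fin k → Equiv.Perm (Fin m)) {j : ℕ} (hj : j < m) (i : Fin k) : rowsOf e z σ j i ∈ U i := by
  simp only [rowsOf, hj, dif_pos]
  exact heU _ _

theorem rowsOf_injective {W : Type*} {e : Fin k → Fin m → W} (heinj : ∀ i, Function.Injective (e i)) (z : W)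
    (σ : Fin k → Equiv.Perm (Fin m)) (i : Fin k) {j j' : ℕ} (hj : j < m) (hj' : j' < m)
    (h : rowsOf e z σ j i = rowsOf e z σ j' i) : j = j' := by
  simp only [rowsOf, hj, hj', dif_pos] at h
  simpa using (σ i).injective (heinj i h)

open Classical in
-- All neighbourhoods are taken in `V` without the four end vertices. `IsSpread.large` is used for
-- `X` equal to this whole set, for `X` of size at least `a'`, and for `X` of size at least `t`,
-- where it gives nonempty intersections.
theorem hasSquareHamPath_of_isSpread {G Γ₁ Γ₂ : SimpleGraph W} {V : Finset W} {U : Fin k → Finset W}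
    {n t a a' B : ℕ} {d : ℝ} {x x' y y' : W}
    (hVU : ∀ i, Disjoint V (U i)) (hU : ∀ i j, i ≠ j → Disjoint (U i) (U j))
    (hVn : #V = n + 4) (hUm : ∀ i, #(U i) = m)
    (hxV : x ∈ V) (hxV' : x' ∈ V) (hyV : y ∈ V) (hyV' : y' ∈ V) (hnd : [x, x', y, y'].Nodup)
    {i₀ i₁ i₂ i₃ : Fin k} (hi₀ : (i₀ : ℕ) = 0) (hi₁ : (i₁ : ℕ) = 1) (hi₂ : (i₂ : ℕ) + 2 = k)
    (hi₃ : (i₃ : ℕ) + 1 = k) (w : ℕ → Fin k → W) (hwU : ∀ j < m, ∀ i, w j i ∈ U i)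
    (hwinj : ∀ i, ∀ j < m, ∀ j' < m, w j i = w j' i → j = j')
    (hspread : IsSpread (V \ {x, x', y, y'})
      (sepNbrs (fun u => {v ∈ V \ {x, x', y, y'} | G.Adj u v}) i₀ i₁ i₂ i₃)
      (fun r => G.Adj x' (r i₀) ∧ G.Adj x (r i₀) ∧ G.Adj x (r i₁))
      (fun r => G.Adj (r i₂) y ∧ G.Adj (r i₃) y ∧ G.Adj (r i₃) y') m t B d w)
    (hΓ₁ : JoinsLarge Γ₁ (V \ {x, x', y, y'}) t)
    (hblock : ∀ j < m - t, ∀ e ∈ closePairs k, Γ₂.Adj (w j e.1) (w j e.2))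
    (hlink : #{j ∈ range (m - t - 1) | ¬ Γ₂.Adj (w j i₃) (w (j + 1) i₀)} ≤ 2 * t)
    (hdeg : ∀ i, ∀ u ∈ U i, a' + 4 ≤ #{v ∈ V | G.Adj v u})
    (hd : 0 < d) (hd1 : d ≤ 1) (ht : 1 ≤ t) (hta : t ≤ a') (ha'n : (a' : ℝ) ≤ d ^ 4 * n)
    (haa : (a : ℝ) ≤ d ^ 4 * a') (hm : 25 * t ≤ m) (hnm : m + (15 * k + 44) * t ≤ n)
    (ha : 2 * (n - m) + (20 * k + 18) * t ≤ a) (hB : (n - m) + (5 * k + 55) * t ≤ B) :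
    HasSquareHamPath ((G ⊓ completeBetween (Fin.cons V U : Fin (k + 1) → Finset W)) ⊔ Γ₁ ⊔ Γ₂)
      (V ∪ univ.biUnion U) x x' y y' := by
  set H := (G ⊓ completeBetween (Fin.cons V U : Fin (k + 1) → Finset W)) ⊔ Γ₁ ⊔ Γ₂ with hH
  set V' := V \ {x, x', y, y'} with hV'
  set nb : W → Finset W := fun u => {v ∈ V' | G.Adj u v} with hnb
  have hfour : #({x, x', y, y'} : Finset W) = 4 := by
    have := List.toFinset_card_of_nodup hnd
    simpa using this
  have hsub4 : ({x, x', y, y'} : Finset W) ⊆ V := by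
    intro v hv
    simp only [mem_insert, mem_singleton] at hv
    rcases hv with rfl | rfl | rfl | rfl <;> assumption
  have hV'n : #V' = n := by
    rw [hV', card_sdiff_of_subset hsub4, hVn, hfour]; omega
  have hG : ∀ i, ∀ u ∈ U i, ∀ v ∈ V, G.Adj u v → H.Adj u v := by
    intro i u hu v hv huv
    refine Or.inl (Or.inl ⟨huv, huv.ne, i.succ, 0, Fin.succ_ne_zero _, ?_, ?_⟩)
    · simpa using hu
    · simpa using hv
  have hΓ₁H : ∀ u v, Γ₁.Adj u v → H.Adj u v := fun u v h => Or.inl (Or.inr h)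
  have hΓ₂H : ∀ u v, Γ₂.Adj u v → H.Adj u v := fun u v h => Or.inr h
  have hd4 : d ^ 4 ≤ 1 := pow_le_one₀ hd.le hd1
  have haa' : a ≤ a' := by
    have : (a : ℝ) ≤ a' := haa.trans (mul_le_of_le_one_left (Nat.cast_nonneg _) hd4)
    exact_mod_cast this
  have hZV : ∀ r r' : Fin k → W, sepNbrs nb i₀ i₁ i₂ i₃ r r' ⊆ V' := fun r r' =>
    inter_subset_left.trans (inter_subset_left.trans (filter_subset _ _))
  refine hasSquareHamPath_of_rows (V := V') (m := m) (n := n) (t := t) (a := a) (a' := a') (B := B)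
    (U := U) w nb hi₀ hi₁ hi₂ hi₃ hwU hwinj hUm hU hV'n ?_ ?_ (fun u => filter_subset _ _) ?_ ?_
    (fun j hj e he => hΓ₂H _ _ (hblock j hj e he)) ?_ ?_ ?_ ?_ ?_ ?_ ?_ ?_ ht haa' hm hnm ha hB
  · intro z hz
    rcases mem_union.1 hz with h | h
    · by_cases h4 : z ∈ ({x, x', y, y'} : Finset W)
      · simp only [mem_insert, mem_singleton] at h4
        tauto
      · exact Or.inl (mem_sdiff.2 ⟨h, h4⟩)
    · obtain ⟨i, -, hi⟩ := mem_biUnion.1 h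
      tauto
  · rw [card_union_of_disjoint ((disjoint_biUnion_right _ _ _).2 fun i _ => hVU i),
      card_biUnion fun i _ j _ hij => hU i j hij, hVn, sum_congr rfl fun i _ => hUm i]
    simp
  · intro i u hu v hv
    rw [hnb, mem_filter] at hv
    exact hG i u hu v (mem_sdiff.1 hv.1).1 hv.2
  · intro A A' hA hA' hdisj hAt hAt'
    obtain ⟨u, hu, v, hv, huv⟩ := hΓ₁ A A' hA hA' hdisj hAt hAt'
    exact ⟨u, hu, v, hv, hΓ₁H _ _ huv⟩
  · exact (card_filter_range_mono le_rfl fun j _ h h' => h (hΓ₂H _ _ h')).trans hlink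
  · refine le_trans (card_filter_range_mono (by omega) fun j _ hj => ?_) (hspread.large V' subset_rfl (by omega))
    rw [inter_eq_left.2 (hZV _ _), hV'n]
    exact lt_of_lt_of_le (Nat.cast_lt.2 hj) ha'n
  · intro X hX hXa
    refine le_trans (card_filter_range_mono (by omega) fun j _ hj => ?_) (hspread.large X hX (by omega))
    refine lt_of_lt_of_le (Nat.cast_lt.2 hj) (haa.trans ?_)
    gcongr
  · intro X hX hXt
    refine le_trans (card_filter_range_mono (by omega) fun j _ hj => ?_) (hspread.large X hX hXt)
    rw [sepNbrs, disjoint_iff_inter_eq_empty.1 hj, card_empty, Nat.cast_zero]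
    have : (0 : ℝ) < #X := by exact_mod_cast (by omega : 0 < #X)
    positivity
  · intro i u hu
    have h1 : ({v ∈ V | G.Adj v u} : Finset W) ⊆ nb u ∪ {x, x', y, y'} := by
      intro v hv
      rw [mem_filter] at hv
      by_cases h4 : v ∈ ({x, x', y, y'} : Finset W)
      · exact mem_union_right _ h4
      · exact mem_union_left _ (mem_filter.2 ⟨mem_sdiff.2 ⟨hv.1, h4⟩, hv.2.symm⟩)
    have h2 := (card_le_card h1).trans (card_union_le _ _)
    have h3 := hdeg i u hu
    omega
  · intro v hv
    exact (hspread.mem v hv).trans (card_filter_range_mono le_rfl fun j _ h => h)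
  · refine hspread.first.trans (card_filter_range_mono (by omega) fun j hj h => ?_)
    have h1 := hwU j (by omega)
    exact ⟨(hG _ _ (h1 _) _ hxV' h.1.symm).symm, (hG _ _ (h1 _) _ hxV h.2.1.symm).symm,
      (hG _ _ (h1 _) _ hxV h.2.2.symm).symm⟩
  · refine hspread.last.trans (card_filter_range_mono (by omega) fun j hj h => ?_)
    have h1 := hwU j (by omega)
    exact ⟨hG _ _ (h1 _) _ hyV h.1, hG _ _ (h1 _) _ hyV h.2.1, hG _ _ (h1 _) _ hyV' h.2.2⟩

end Deterministic

/-! ### Probability measures and super-regular pairs -/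

section Probability

theorem isProbabilityMeasure_randomSubgraph {W : Type*} [Fintype W] (H : SimpleGraph W)
    (p : unitInterval) : MeasureTheory.IsProbabilityMeasure (randomSubgraph H p) := by
  refine SimpleGraph.measurableEmbedding_edgeSet.isProbabilityMeasure_comap ?_
  filter_upwards [ProbabilityTheory.setBernoulli_ae_subset] with s hs
  refine ⟨.fromEdgeSet s, ?_⟩
  rw [SimpleGraph.edgeSet_fromEdgeSet, sdiff_eq_left]
  exact (Set.disjoint_left.2 fun e he he' => H.not_isDiag_of_mem_edgeSet (hs he) he')

theorem one_sub_le_prod_real {α β : Type*} [MeasurableSpace α] [MeasurableSpace β]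
    (μ : MeasureTheory.Measure α) (ν : MeasureTheory.Measure β)
    [MeasureTheory.IsProbabilityMeasure μ] [MeasureTheory.IsProbabilityMeasure ν]
    (A : α → Prop) (B : β → Prop) (C : Set (α × β)) (h : ∀ x y, A x → B y → (x, y) ∈ C) :
    1 - (μ.real {x | ¬ A x} + ν.real {y | ¬ B y}) ≤ (μ.prod ν).real C := by
  have h1 : (Set.univ : Set (α × β)) ⊆
      C ∪ ({x | ¬ A x} ×ˢ Set.univ ∪ Set.univ ×ˢ {y | ¬ B y}) := by
    rintro ⟨x, y⟩ -
    by_cases hx : A x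
    · by_cases hy : B y
      · exact Or.inl (h x y hx hy)
      · exact Or.inr (Or.inr ⟨trivial, hy⟩)
    · exact Or.inr (Or.inl ⟨hx, trivial⟩)
  have h2 := (MeasureTheory.measureReal_mono (μ := μ.prod ν) h1).trans
    ((MeasureTheory.measureReal_union_le _ _).trans
      (add_le_add le_rfl (MeasureTheory.measureReal_union_le _ _)))
  rw [MeasureTheory.measureReal_prod_prod, MeasureTheory.measureReal_prod_prod] at h2
  simp only [MeasureTheory.probReal_univ, mul_one, one_mul] at h2
  linarith

variable {W : Type*}

/-- The low-degree vertices would have density below `d` to `Y`, so regularity forbids more than `ε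
* #B` of them. -/
theorem IsSuperRegular.card_low_degree_le {G : SimpleGraph W} [DecidableRel G.Adj] {ε d : ℝ}
    {A B : Finset W} (h : IsSuperRegular G ε d A B) {Y : Finset W} (hYA : Y ⊆ A)
    (hY : ε * #A ≤ #Y) (hε : 0 ≤ ε) :
    (#{b ∈ B | (#{v ∈ Y | G.Adj b v} : ℝ) < d * #Y} : ℝ) ≤ ε * #B := by
  set D : Finset W := {b ∈ B | (#{v ∈ Y | G.Adj b v} : ℝ) < d * #Y} with hD
  by_contra! hc
  have h1 := h.density Y hYA D (filter_subset _ _) hY hc.le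
  have hD0 : (0 : ℝ) < #D := lt_of_le_of_lt (by positivity) hc
  have hDne : D.Nonempty := card_pos.1 (by exact_mod_cast hD0)
  have hY0 : (0 : ℝ) < #Y := by
    obtain ⟨b, hb⟩ := hDne
    rcases Y.eq_empty_or_nonempty with rfl | hY
    · simp [hD] at hb
    · exact_mod_cast hY.card_pos
  have h2 : (#(G.interedges Y D) : ℝ) = ∑ b ∈ D, (#{v ∈ Y | G.Adj b v} : ℝ) := by
    rw [SimpleGraph.interedges_def, card_filter, sum_product_right]
    push_cast
    refine sum_congr rfl fun b _ => ?_
    rw [card_filter]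
    push_cast
    exact sum_congr rfl fun v _ => by simp only [G.adj_comm]
  have h3 : ∑ b ∈ D, (#{v ∈ Y | G.Adj b v} : ℝ) < ∑ _b ∈ D, d * (#Y : ℝ) :=
    sum_lt_sum_of_nonempty hDne fun b hb => (mem_filter.1 hb).2
  rw [sum_const, nsmul_eq_mul, ← h2] at h3
  rw [SimpleGraph.edgeDensity_def] at h1
  push_cast at h1
  rw [le_div_iff₀ (by positivity)] at h1
  linarith

theorem card_filter_index {m : ℕ} {U : Finset W} (hU : #U = m) {e : Fin m → W} (heU : ∀ c, e c ∈ U)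
    (heinj : Function.Injective e) (P : W → Prop) {_ : DecidablePred P}
    {_ : DecidablePred fun c => P (e c)} : #{c | P (e c)} = #{u ∈ U | P u} := by
  have hmap : (univ : Finset (Fin m)).map ⟨e, heinj⟩ = U :=
    eq_of_subset_of_card_le (fun u hu => by
      obtain ⟨c, -, rfl⟩ := mem_map.1 hu
      exact heU c) (by rw [card_map, hU]; simp)
  rw [← hmap, filter_map, card_map]
  simp only [Function.comp_def, Function.Embedding.coeFn_mk]

end Probability

/-! ### The probability bound with all parameters -/

section Main

open Classical Nat in
-- The subtracted terms account, in order, for unjoined sets in `V`, boxes without a block, sets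
-- without a link, sets `X` met too rarely, and vertices or ends with too few positions.
theorem one_sub_le_real_hasSquareHamPath {W : Type*} [Fintype W] [DecidableEq W] {k : ℕ}
    (hk : 2 ≤ k) {G : SimpleGraph W} [DecidableRel G.Adj] {V : Finset W} {U : Fin k → Finset W}
    {m n t a a' B s₀ : ℕ} {x x' y y' : W} {p : unitInterval} {d ε q p₀ : ℝ}
    (hVU : ∀ i, Disjoint V (U i)) (hU : ∀ i j, i ≠ j → Disjoint (U i) (U j))
    (hVn : #V = n + 4) (hUm : ∀ i, #(U i) = m)
    (hreg : ∀ i, IsSuperRegular G ε d V (U i))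
    (hxV : x ∈ V) (hxV' : x' ∈ V) (hyV : y ∈ V) (hyV' : y' ∈ V) (hnd : [x, x', y, y'].Nodup)
    (hx : ∀ i, d ^ 2 / 2 * (n : ℝ) ≤ (#{u ∈ U i | G.Adj x u ∧ G.Adj x' u} : ℝ))
    (hy : ∀ i, d ^ 2 / 2 * (n : ℝ) ≤ (#{u ∈ U i | G.Adj y u ∧ G.Adj y' u} : ℝ))
    (hd : 0 < d) (hd1 : d ≤ 1) (hε : 0 < ε) (hε1 : 4 * ε ≤ 1) (hεt : ε * (n + 4) ≤ d ^ 3 * (d ^ 3 * t))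
    (hq : q ≤ d ^ 4 / 4)
    (hdn : (a' : ℝ) + 4 ≤ d * (n + 4)) (hmn : m ≤ n)
    (ht : 1 ≤ t) (hta : t ≤ a') (ha'n : (a' : ℝ) ≤ d ^ 4 * n)
    (haa : (a : ℝ) ≤ d ^ 4 * a') (hm : 25 * t ≤ m) (hnm : m + (15 * k + 44) * t ≤ n)
    (ha : 2 * (n - m) + (20 * k + 18) * t ≤ a) (hB : (n - m) + (5 * k + 55) * t ≤ B)
    (hsm : 4 * s₀ ≤ m) (hst : 2 * s₀ ≤ m - t - 1)
    (hp₀ : 0 ≤ p₀) (hp₀p : p₀ ≤ p) (hmp : (1 + m * p₀ ^ 2) ^ k ≤ 3 / 2) :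
    1 - ((2 ^ n * 2 ^ n) * Real.exp (-((t : ℝ) * t * p)) +
      ((2 ^ m) ^ k * Real.exp (-((t : ℝ) ^ k * p₀ ^ (2 * k - 3) / 2)) +
        (2 ^ m * 2 ^ m) * Real.exp (-((t : ℝ) * t * p₀)) +
        (2 ^ n * (2 * (Real.exp (k * m) * 2 ^ m * (4 * ε) ^ (t / 2 + 1))) +
          (n + 2) * Real.exp (8 * k * s₀ ^ 2 / m - q * s₀ / 2 + B)))) ≤
      ((randomSubgraph (completeOn V) p).prod (randomSubgraph (completeBetween U) p)).real
        {Γ : SimpleGraph W × SimpleGraph W | HasSquareHamPath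
          ((G ⊓ completeBetween (Fin.cons V U : Fin (k + 1) → Finset W)) ⊔ Γ.1 ⊔ Γ.2)
          (V ∪ univ.biUnion U) x x' y y'} := by
  set V' := V \ {x, x', y, y'} with hV'
  have hsub4 : ({x, x', y, y'} : Finset W) ⊆ V := by
    intro v hv
    simp only [mem_insert, mem_singleton] at hv
    rcases hv with rfl | rfl | rfl | rfl <;> assumption
  have hV'n : #V' = n := by
    have hfour : #({x, x', y, y'} : Finset W) = 4 := by
      simpa using List.toFinset_card_of_nodup hnd
    rw [hV', card_sdiff_of_subset hsub4, hVn, hfour]; omega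
  set nb : W → Finset W := fun u => {v ∈ V' | G.Adj u v} with hnb
  set i₀ : Fin k := ⟨0, by omega⟩ with hi₀
  set i₁ : Fin k := ⟨1, by omega⟩ with hi₁
  set i₂ : Fin k := ⟨k - 2, by omega⟩ with hi₂
  set i₃ : Fin k := ⟨k - 1, by omega⟩ with hi₃
  have h₀₁ : i₀ ≠ i₁ := by simp [hi₀, hi₁]
  have h₂₃ : i₂ ≠ i₃ := by simp only [hi₂, hi₃, ne_eq, Fin.mk.injEq]; omega
  have h₃₀ : i₃ ≠ i₀ := by simp only [hi₀, hi₃, ne_eq, Fin.mk.injEq]; omega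
  have hm0 : 0 < m := by omega
  have hp0 : (0 : ℝ) ≤ p := p.2.1
  have hp1 : (p : ℝ) ≤ 1 := p.2.2
  have hdm : ∀ i, ∃ e : Fin m → W, (∀ c, e c ∈ U i) ∧ Function.Injective e := fun i => by
    have f := (U i).equivFinOfCardEq (hUm i)
    exact ⟨fun c => f.symm c, fun c => (f.symm c).2,
      fun c c' h => f.symm.injective (Subtype.ext h)⟩
  choose e heU heinj using hdm
  have hidx : ∀ i (P : W → Prop) {_ : DecidablePred fun c => P (e i c)},
      #{c : Fin m | P (e i c)} = #{u ∈ U i | P u} := fun i P _ =>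
    card_filter_index (hUm i) (heU i) (heinj i) P
  set Px : (Fin k → W) → Prop := fun r => G.Adj x' (r i₀) ∧ G.Adj x (r i₀) ∧ G.Adj x (r i₁)
    with hPx
  set Py : (Fin k → W) → Prop := fun r => G.Adj (r i₂) y ∧ G.Adj (r i₃) y ∧ G.Adj (r i₃) y'
    with hPy
  set N : (ℕ → Fin k → W) → Prop :=
    IsSpread V' (sepNbrs nb i₀ i₁ i₂ i₃) Px Py m t B d with hN
  have hmnr : (m : ℝ) ≤ n := by exact_mod_cast hmn
  -- Common neighbours at two coordinates have proportion at least `(d ^ 2 / 2) ^ 2 = d ^ 4 / 4`,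
  -- the bound for `q`.
  have hend : ∀ (v v' : W), (∀ i, d ^ 2 / 2 * (n : ℝ) ≤ (#{u ∈ U i | G.Adj v u ∧ G.Adj v' u} : ℝ)) →
      ∀ (j j' : Fin k), j ≠ j' → ∀ P : (Fin k → W) → Prop,
      (∀ r : Fin k → W, G.Adj v (r j) ∧ G.Adj v' (r j) → G.Adj v (r j') ∧ G.Adj v' (r j') → P r) →
      q * ((m : ℝ) ^ k) ^ 2 ≤
        #{x : (Fin k → Fin m) × (Fin k → Fin m) | P fun i => e i (x.1 i)} := by
    intro v v' hv j j' hjj' P hP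
    have h1 := le_card_pairs ({Sum.inl j, Sum.inl j'} : Finset (Fin k ⊕ Fin k))
      (Sum.elim (fun i => ({c | G.Adj v (e i c) ∧ G.Adj v' (e i c)} : Finset (Fin m))) fun _ => ∅)
      (a := d ^ 2 / 2) (by positivity) (by
        intro i hi
        simp only [mem_insert, mem_singleton] at hi
        have h2 : ∀ i, d ^ 2 / 2 * (m : ℝ) ≤
            #({c | G.Adj v (e i c) ∧ G.Adj v' (e i c)} : Finset (Fin m)) := fun i => by
          rw [hidx i fun u => G.Adj v u ∧ G.Adj v' u]
          refine le_trans ?_ ((hv i).trans (le_of_eq (by congr!)))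
          gcongr
        rcases hi with rfl | rfl <;> exact h2 _)
      (fun r _ => P fun i => e i (r i)) (by
        intro f hf
        simp only [mem_insert, mem_singleton, forall_eq_or_imp, forall_eq, Sum.elim_inl, mem_filter,
          mem_univ, true_and] at hf
        exact hP _ hf.1 hf.2)
    refine le_trans ?_ h1
    rw [card_insert_of_notMem (by simpa using hjj'), card_singleton]
    gcongr
    nlinarith
  have hspread := card_not_isSpread_le (m := m) (k := k) e x nb h₀₁ h₂₃ (V := V') (d := d) (ε := ε)
    (q := q) hd.le hd1 hε hε1 (t := t) (B := B) (s₀ := s₀) (by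
      intro i Y hY hYt
      have h1 := (hreg i).card_low_degree_le (hY.trans sdiff_subset) (by
        rw [hVn]
        push_cast
        refine hεt.trans (le_trans ?_ hYt)
        exact mul_le_of_le_one_left (by positivity) (pow_le_one₀ hd.le hd1)) hε.le
      rw [hUm] at h1
      refine le_trans (le_of_eq ?_) h1
      rw [hidx i fun u => (#(nb u ∩ Y) : ℝ) < d * #Y, Nat.cast_inj]
      refine congrArg card (filter_congr fun u _ => ?_)
      have : nb u ∩ Y = {v ∈ Y | G.Adj u v} := by
        ext v
        simp only [hnb, mem_inter, mem_filter]
        exact ⟨fun h => ⟨h.2, h.1.2⟩, fun h => ⟨⟨hY h.1, h.2⟩, h.1⟩⟩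
      rw [this])
    (by
      intro v hv i
      have h1 := (hreg i).deg_left v (mem_sdiff.1 hv).1
      rw [hUm] at h1
      refine h1.trans (le_of_eq ?_)
      rw [hidx i fun u => v ∈ nb u, Nat.cast_inj]
      refine congrArg card ?_
      ext u
      simp only [hnb, mem_filter, hv, true_and, G.adj_comm v u])
    (by have : 0 < d ^ 4 := by positivity
        linarith) Px Py
    (hend x x' hx i₀ i₁ h₀₁ Px fun r h h' => ⟨h.2, h.1, h'.1⟩)
    (hend y y' hy i₂ i₃ h₂₃ Py fun r h h' => ⟨h.1.symm, h'.1.symm, h'.2.symm⟩) hsm hst hm0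
  have hE : ∀ a b, s(a, b) ∈ (completeBetween U).edgeFinset ↔
      ∃ i j, i ≠ j ∧ a ∈ U i ∧ b ∈ U j := by
    intro a b
    rw [SimpleGraph.mem_edgeFinset, SimpleGraph.mem_edgeSet]
    refine ⟨fun h => h.2, fun h => ⟨?_, h⟩⟩
    rintro rfl
    obtain ⟨i, j, hij, hi, hj⟩ := h
    exact disjoint_left.1 (hU i j hij) hi hj
  have hcover := bexp_not_exists_cover_le hp0 hp1 (E := (completeBetween U).edgeFinset) hU hUm hE ht
    e heU heinj x N (i₀ := i₀) (i₃ := i₃) (by positivity) hspread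
  have hrich := bexp_not_blockRich_le hp₀ hp₀p hp1 (E := (completeBetween U).edgeFinset) (t := t) h₃₀
    hk hU hUm (fun i j hij a ha b hb => (hE a b).2 ⟨i, j, hij, ha, hb⟩) hmp
  have hjoin := bexp_not_joinsLarge_le hp0 hp1 (completeOn V).edgeFinset V' t (by
    intro a ha b hb hab
    rw [SimpleGraph.mem_edgeFinset, SimpleGraph.mem_edgeSet]
    exact ⟨hab, (mem_sdiff.1 ha).1, (mem_sdiff.1 hb).1⟩)
  set A₁ : SimpleGraph W → Prop := fun Γ => JoinsLarge Γ V' t with hA₁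
  set A₂ : SimpleGraph W → Prop := fun Γ => ∃ σ : Fin k → Equiv.Perm (Fin m), N (rowsOf e x σ) ∧
    (∀ j < m - t, ∀ f ∈ closePairs k, Γ.Adj (rowsOf e x σ j f.1) (rowsOf e x σ j f.2)) ∧
    #{j ∈ range (m - t - 1) | ¬ Γ.Adj (rowsOf e x σ j i₃) (rowsOf e x σ (j + 1) i₀)} ≤ 2 * t with hA₂
  have := isProbabilityMeasure_randomSubgraph (completeOn V) p
  have := isProbabilityMeasure_randomSubgraph (completeBetween U) p
  refine le_trans ?_ (one_sub_le_prod_real _ _ A₁ A₂ _ ?_)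
  · refine _root_.sub_le_sub_left (_root_.add_le_add ?_ ?_) 1
    · refine (randomSubgraph_real_le _ _ _).trans ?_
      rw [hV'n] at hjoin
      exact (le_of_eq (by congr!)).trans hjoin
    · refine (randomSubgraph_real_le _ _ _).trans ?_
      rw [hV'n] at hcover
      refine le_trans (bexp_mono hp0 hp1 fun S _ => ?_) (hcover.trans
        (_root_.add_le_add (le_trans (le_of_eq (by congr!)) hrich) le_rfl))
      by_cases hc : ∃ σ : Fin k → Equiv.Perm (Fin m), N (rowsOf e x σ) ∧
        IsBlockCover S (rowsOf e x σ) (m - t) t i₀ i₃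
      · rw [if_neg]
        · split_ifs <;> norm_num
        rw [not_not]
        obtain ⟨σ, hσN, hσ⟩ := hc
        have hadj : ∀ j j' i i', j < m → j' < m → i ≠ i' →
            s(rowsOf e x σ j i, rowsOf e x σ j' i') ∈ S →
            (SimpleGraph.fromEdgeSet (S : Set (Sym2 W))).Adj (rowsOf e x σ j i)
              (rowsOf e x σ j' i') := by
          intro j j' i i' hj hj' hii' hS
          rw [SimpleGraph.fromEdgeSet_adj]
          exact ⟨hS, fun h => disjoint_left.1 (hU i i' hii') (rowsOf_mem heU x σ hj i)
            (h ▸ rowsOf_mem heU x σ hj' i')⟩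
        refine ⟨σ, hσN, fun j hj f hf => ?_, ?_⟩
        · have hlt : (f.1 : ℕ) < f.2 := (mem_filter.1 hf).2.1
          exact hadj j j _ _ (by omega) (by omega) (fun h => by rw [h] at hlt; omega)
            (hσ.block j hj (mem_image.2 ⟨f, hf, rfl⟩))
        · refine le_trans (card_filter_range_mono (Q := fun j => s(rowsOf e x σ j i₃,
            rowsOf e x σ (j + 1) i₀) ∉ S) le_rfl fun j hj h h' => h ?_) hσ.link
          exact hadj _ _ _ _ (by omega) (by omega) h₃₀ h'
      · rw [if_pos hc]
        split_ifs <;> norm_num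
  · rintro Γ₁ Γ₂ h₁ ⟨σ, hσN, hσb, hσl⟩
    exact hasSquareHamPath_of_isSpread hVU hU hVn hUm hxV hxV' hyV hyV' hnd (i₀ := i₀) (i₁ := i₁)
      (i₂ := i₂) (i₃ := i₃) rfl rfl (by simp only [hi₂]; omega) (by simp only [hi₃]; omega)
      (rowsOf e x σ) (fun j hj i => rowsOf_mem heU x σ hj i)
      (fun i j hj j' hj' h => rowsOf_injective heinj x σ i hj hj' h) (by convert hσN) h₁ hσb
      (by convert hσl) (by
        intro i u hu
        have h2 := (hreg i).deg_right u hu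
        rw [hVn] at h2
        have h3 : (a' : ℝ) + 4 ≤ #{v ∈ V | G.Adj v u} := by
          push_cast at h2
          exact hdn.trans h2
        have h4 : a' + 4 ≤ #{v ∈ V | G.Adj v u} := by exact_mod_cast h3
        convert h4) hd hd1 ht hta ha'n haa hm hnm ha hB

end Main

/-! ### Choice of parameters and asymptotics -/

section Parameters

theorem two_pow_le_exp (n : ℕ) : (2 : ℝ) ^ n ≤ Real.exp n := by
  have h : (2 : ℝ) ≤ Real.exp 1 := by
    have := Real.add_one_le_exp (1 : ℝ); linarith
  calc (2 : ℝ) ^ n ≤ Real.exp 1 ^ n := by gcongr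
    _ = Real.exp n := by rw [← Real.exp_nat_mul, mul_one]

/-- The integer constraints on the parameters of the construction. -/
theorem parameter_constraints {k m n t a a' B s₀ : ℕ} {d c δ₀ γ : ℝ} (hk : 2 ≤ k) (hd : 0 < d)
    (hd1 : d ≤ 1) (hγ : 0 < γ) (hδγ : δ₀ = 800 * k * γ) (hδc : δ₀ ≤ c)
    (hcd : 2 ^ 18 * k * c = d ^ 8) (hn : 1 ≤ γ * n) (hm₀ : (1 - δ₀) * (n : ℝ) ≤ m)
    (hm₁ : (m : ℝ) ≤ (1 - δ₀ / 4) * n) (ht : t = ⌈γ * n⌉₊) (ha : a = ⌊d ^ 8 * n / 4⌋₊)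
    (ha' : a' = ⌊d ^ 4 * n / 2⌋₊) (hB : B = ⌊8 * c * n⌋₊) (hs : s₀ = ⌊d ^ 4 / 4 / (256 * k) * n⌋₊) :
    (a' : ℝ) + 4 ≤ d * (n + 4) ∧ m ≤ n ∧ 1 ≤ t ∧ t ≤ a' ∧ (a' : ℝ) ≤ d ^ 4 * n ∧
      (a : ℝ) ≤ d ^ 4 * a' ∧ 25 * t ≤ m ∧ m + (15 * k + 44) * t ≤ n ∧
      2 * (n - m) + (20 * k + 18) * t ≤ a ∧ (n - m) + (5 * k + 55) * t ≤ B ∧ 4 * s₀ ≤ m ∧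
      2 * s₀ ≤ m - t - 1 ∧
      8 * k * (s₀ : ℝ) ^ 2 / m - d ^ 4 / 4 * s₀ / 2 + B ≤ 1 - 20 * c * n := by
  have hk' : (2 : ℝ) ≤ k := by exact_mod_cast hk
  have hn0 : (0 : ℝ) ≤ n := Nat.cast_nonneg n
  have hd4 : d ^ 4 ≤ d := by
    simpa using pow_le_pow_of_le_one hd.le hd1 (show 1 ≤ 4 by norm_num)
  have hd8 : d ^ 8 ≤ d ^ 4 := pow_le_pow_of_le_one hd.le hd1 (by norm_num)
  have hd40 : 0 < d ^ 4 := by positivity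
  have hc0 : 0 < c := lt_of_lt_of_le (by rw [hδγ]; positivity) hδc
  have hδn : 1600 ≤ δ₀ * n := by
    have : 800 * 2 * 1 ≤ 800 * (k : ℝ) * (γ * n) := by gcongr
    rw [hδγ]; linarith
  have hδcn : δ₀ * n ≤ c * n := by gcongr
  have hkc : 2 ^ 19 * c ≤ d ^ 8 := by
    rw [← hcd]; nlinarith
  have hDn : 2 ^ 19 * (c * n) ≤ d ^ 8 * n := by
    rw [← mul_assoc]; gcongr
  have hDn4 : d ^ 8 * n ≤ d ^ 4 * n := by gcongr
  have hDn1 : d ^ 4 * n ≤ d * n := by gcongr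
  have hdn : d * n ≤ n := mul_le_of_le_one_left hn0 hd1
  have ht1 : γ * n ≤ t := by rw [ht]; exact Nat.le_ceil _
  have ht2 : (t : ℝ) ≤ 2 * (γ * n) := by
    have := Nat.ceil_lt_add_one (show 0 ≤ γ * n by positivity)
    rw [ht]; linarith
  have hkt : (k : ℝ) * t ≤ δ₀ * n / 400 := by
    calc (k : ℝ) * t ≤ k * (2 * (γ * n)) := by gcongr
      _ = δ₀ * n / 400 := by rw [hδγ]; ring
  have htk : 2 * (t : ℝ) ≤ k * t := by gcongr
  have ha'1 : (a' : ℝ) ≤ d ^ 4 * n / 2 := by rw [ha']; exact Nat.floor_le (by positivity)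
  have ha'2 : d ^ 4 * n / 2 ≤ a' + 1 := by rw [ha']; exact (Nat.lt_floor_add_one _).le
  have ha1 : (a : ℝ) ≤ d ^ 8 * n / 4 := by rw [ha]; exact Nat.floor_le (by positivity)
  have ha2 : d ^ 8 * n / 4 ≤ a + 1 := by rw [ha]; exact (Nat.lt_floor_add_one _).le
  have hB1 : (B : ℝ) ≤ 8 * c * n := by rw [hB]; exact Nat.floor_le (by positivity)
  have hB2 : 8 * c * n ≤ B + 1 := by rw [hB]; exact (Nat.lt_floor_add_one _).le
  have hs1 : (s₀ : ℝ) ≤ d ^ 4 / 4 / (256 * k) * n := by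
    rw [hs]; exact Nat.floor_le (by positivity)
  have hs2 : d ^ 4 / 4 / (256 * k) * n ≤ s₀ + 1 := by rw [hs]; exact (Nat.lt_floor_add_one _).le
  have hσ : d ^ 4 / 4 / (256 * k) * n ≤ n / 2048 := by
    rw [div_div, div_mul_eq_mul_div, div_le_div_iff₀ (by positivity) (by positivity)]
    have : d ^ 4 * n ≤ 1 * n := by gcongr; linarith
    nlinarith
  have hmn : m ≤ n := by
    have : (m : ℝ) ≤ n := by nlinarith
    exact_mod_cast this
  have hsub : ((n - m : ℕ) : ℝ) = n - m := Nat.cast_sub hmn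
  have hm_half : (n : ℝ) / 2 ≤ m := by linarith
  refine ⟨by linarith, hmn, ?_, ?_, by linarith, ?_, ?_, ?_, ?_, ?_, ?_, ?_, ?_⟩
  · have : (1 : ℝ) ≤ t := by linarith
    exact_mod_cast this
  · have : (t : ℝ) ≤ a' := by linarith
    exact_mod_cast this
  · have h1 : d ^ 4 * (d ^ 4 * n / 2) ≤ d ^ 4 * (a' + 1) := by gcongr
    have h2 : d ^ 4 * (d ^ 4 * n / 2) = d ^ 8 * n / 2 := by ring
    linarith
  · have : (25 * t : ℝ) ≤ m := by linarith
    exact_mod_cast this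
  -- Here the surplus `n - m ≥ δ₀ * n / 4` is needed; the multiple of `t` is at most `37 / 400 * δ₀
  -- * n`.
  · have : (m + (15 * k + 44) * t : ℝ) ≤ n := by linarith
    exact_mod_cast this
  · have : (2 * (n - m : ℕ) + (20 * k + 18) * t : ℝ) ≤ a := by rw [hsub]; linarith
    exact_mod_cast this
  · have : ((n - m : ℕ) + (5 * k + 55) * t : ℝ) ≤ B := by rw [hsub]; linarith
    exact_mod_cast this
  · have : (4 * s₀ : ℝ) ≤ m := by linarith
    exact_mod_cast this
  · have h1 : (2 * s₀ + t + 1 : ℝ) ≤ m := by linarith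
    have h2 : 2 * s₀ + t + 1 ≤ m := by exact_mod_cast h1
    omega
  -- Put `q = d ^ 4 / 4`. The quadratic term is at most `q * s₀ / 16`, and `q * s₀` is `64 * c * n`
  -- up to an error of `q`. The exponent is therefore at most `-28 * c * n + 8 * c * n` up to a
  -- constant.
  · have hm0 : (0 : ℝ) < m := by linarith
    have h1 : 8 * k * (s₀ : ℝ) ^ 2 / m ≤ d ^ 4 / 4 * s₀ / 16 := by
      rw [div_le_iff₀ hm0]
      calc 8 * k * (s₀ : ℝ) ^ 2 = 8 * k * s₀ * s₀ := by ring
        _ ≤ 8 * k * s₀ * (d ^ 4 / 4 / (256 * k) * n) := by gcongr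
        _ = d ^ 4 / 4 * s₀ / 16 * (n / 2) := by field_simp; ring
        _ ≤ d ^ 4 / 4 * s₀ / 16 * m := by gcongr
    have h2 : d ^ 4 / 4 * (d ^ 4 / 4 / (256 * k) * n) ≤ d ^ 4 / 4 * (s₀ + 1) := by gcongr
    have h3 : d ^ 4 / 4 * (d ^ 4 / 4 / (256 * k) * n) = 64 * c * n := by
      have : d ^ 4 / 4 * (d ^ 4 / 4 / (256 * k) * n) = d ^ 8 / (4096 * k) * n := by
        field_simp; ring
      rw [this, ← hcd]
      field_simp; ring
    linarith

/-- The bounds on the failure probabilities. -/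
theorem failure_bound {k m n t B s₀ : ℕ} {c γ K ε C q p p₀ : ℝ} (hk : 2 ≤ k) (hc : 0 < c)
    (hγ : 0 < γ) (hγ1 : γ ≤ 1) (hK : K = 2 * (k + 3) / γ) (hC : C = 2 * (k + 1) / γ ^ k)
    (hε : 0 < ε) (hεK : 4 * ε ≤ Real.exp (-K)) (hn : 1 ≤ n) (ht : γ * n ≤ t) (hmn : m ≤ n)
    (hp₀ : p₀ = C * (n : ℝ) ^ (-(((k : ℝ) - 1) / (2 * (k : ℝ) - 3)))) (hp₀p : p₀ ≤ p)
    (hexp : 8 * k * (s₀ : ℝ) ^ 2 / m - q * s₀ / 2 + B ≤ 1 - 20 * c * n) :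
    (2 ^ n * 2 ^ n) * Real.exp (-((t : ℝ) * t * p)) +
      ((2 ^ m) ^ k * Real.exp (-((t : ℝ) ^ k * p₀ ^ (2 * k - 3) / 2)) +
        (2 ^ m * 2 ^ m) * Real.exp (-((t : ℝ) * t * p₀)) +
        (2 ^ n * (2 * (Real.exp (k * m) * 2 ^ m * (4 * ε) ^ (t / 2 + 1))) +
          (n + 2) * Real.exp (8 * k * s₀ ^ 2 / m - q * s₀ / 2 + B))) ≤
      3 * Real.exp (-n) + Real.exp (1 - n) +
        1 / (10 * c) * Real.exp (1 + 20 * c - 10 * c * n) := by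
  have hk' : (2 : ℝ) ≤ k := by exact_mod_cast hk
  have hn' : (1 : ℝ) ≤ n := by exact_mod_cast hn
  have hn0 : (0 : ℝ) < n := by linarith
  have hmn' : (m : ℝ) ≤ n := by exact_mod_cast hmn
  have hγk : 0 < γ ^ k := by positivity
  have hC0 : 0 < C := by rw [hC]; positivity
  have hγk1 : γ ^ k ≤ γ ^ 2 := pow_le_pow_of_le_one hγ.le hγ1 hk
  have hCγ : C * γ ^ k = 2 * (k + 1) := by rw [hC]; field_simp
  have hC1 : 1 ≤ C := by
    have : γ ^ k ≤ 1 := pow_le_one₀ hγ.le hγ1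
    rw [hC, le_div_iff₀ hγk]; linarith
  have hCγ2 : 2 * ((k : ℝ) + 1) ≤ C * γ ^ 2 := by rw [← hCγ]; gcongr
  set θ : ℝ := ((k : ℝ) - 1) / (2 * (k : ℝ) - 3) with hθ
  have h2k : (0 : ℝ) < 2 * k - 3 := by linarith
  have hθ1 : θ ≤ 1 := by rw [hθ, div_le_one h2k]; linarith
  have hp₀0 : 0 < p₀ := by rw [hp₀]; positivity
  have hedge : 2 * ((k : ℝ) + 1) * n ≤ t * t * p₀ := by
    have h1 : (n : ℝ)⁻¹ ≤ (n : ℝ) ^ (-θ) := by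
      rw [← Real.rpow_neg_one]
      exact Real.rpow_le_rpow_of_exponent_le hn' (by linarith)
    calc 2 * ((k : ℝ) + 1) * n ≤ C * γ ^ 2 * n := by gcongr
      _ = (γ * n) * (γ * n) * (C * (n : ℝ)⁻¹) := by field_simp
      _ ≤ t * t * p₀ := by rw [hp₀]; gcongr
  -- The exponent in `p₀` is the one with `n ^ k * p₀ ^ (2k - 3) = C ^ (2k - 3) * n`; `C` then beats
  -- the number of boxes.
  have hblock : ((k : ℝ) + 1) * n ≤ t ^ k * p₀ ^ (2 * k - 3) / 2 := by
    have h1 : ((n : ℝ) ^ (-θ)) ^ (2 * k - 3) * (n : ℝ) ^ k = n := by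
      rw [← Real.rpow_natCast, ← Real.rpow_natCast, ← Real.rpow_mul hn0.le, ← Real.rpow_add hn0]
      have : -θ * ((2 * k - 3 : ℕ) : ℝ) + k = 1 := by
        have h2 : θ * (2 * k - 3) = k - 1 := by rw [hθ, div_mul_cancel₀ _ h2k.ne']
        rw [Nat.cast_sub (by omega)]
        push_cast
        linarith
      rw [this, Real.rpow_one]
    have h2 : C ≤ C ^ (2 * k - 3) := le_self_pow₀ hC1 (by omega)
    calc ((k : ℝ) + 1) * n = C * γ ^ k * n / 2 := by rw [hCγ]; ring
      _ ≤ C ^ (2 * k - 3) * γ ^ k * n / 2 := by gcongr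
      _ = (γ * n) ^ k * (C * (n : ℝ) ^ (-θ)) ^ (2 * k - 3) / 2 := by
        rw [mul_pow, mul_pow]
        nth_rewrite 1 [← h1]
        ring
      _ ≤ t ^ k * p₀ ^ (2 * k - 3) / 2 := by rw [hp₀]; gcongr
  have two : ∀ N : ℕ, N ≤ n → (2 : ℝ) ^ N ≤ Real.exp n := fun N hN =>
    (two_pow_le_exp N).trans (Real.exp_le_exp.2 (by exact_mod_cast hN))
  have hE : ∀ (N : ℕ) (r : ℝ), N ≤ n → p₀ ≤ r →
      (2 : ℝ) ^ N * 2 ^ N * Real.exp (-((t : ℝ) * t * r)) ≤ Real.exp (-n) := by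
    intro N r hN hr
    have h1 : (t : ℝ) * t * p₀ ≤ t * t * r := by gcongr
    calc (2 : ℝ) ^ N * 2 ^ N * Real.exp (-((t : ℝ) * t * r))
        ≤ Real.exp n * Real.exp n * Real.exp (-((t : ℝ) * t * r)) := by
          gcongr <;> exact two N hN
      _ = Real.exp (n + n - t * t * r) := by rw [← Real.exp_add, ← Real.exp_add]; ring_nf
      _ ≤ Real.exp (-n) := Real.exp_le_exp.2 (by nlinarith)
  have e1 := hE n p le_rfl hp₀p
  have e3 := hE m p₀ hmn le_rfl
  have e2 : ((2 : ℝ) ^ m) ^ k * Real.exp (-((t : ℝ) ^ k * p₀ ^ (2 * k - 3) / 2)) ≤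
      Real.exp (-n) := by
    calc ((2 : ℝ) ^ m) ^ k * Real.exp (-((t : ℝ) ^ k * p₀ ^ (2 * k - 3) / 2))
        ≤ Real.exp n ^ k * Real.exp (-(((k : ℝ) + 1) * n)) := by
          gcongr
          exact two m hmn
      _ = Real.exp (-n) := by rw [← Real.exp_nat_mul, ← Real.exp_add]; ring_nf
  have e4 : (2 : ℝ) ^ n * (2 * (Real.exp (k * m) * 2 ^ m * (4 * ε) ^ (t / 2 + 1))) ≤
      Real.exp (1 - n) := by
    have h2 : (2 : ℝ) ≤ Real.exp 1 := by simpa using two_pow_le_exp 1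
    have hK0 : 0 < K := by rw [hK]; positivity
    -- Of `k + 3`, the summand `k` pays for relaxing the permutations, `2` for the two powers of
    -- two, and `1` is left as decay.
    have h3 : (4 * ε) ^ (t / 2 + 1) ≤ Real.exp (-(((k : ℝ) + 3) * n)) := by
      calc (4 * ε) ^ (t / 2 + 1) ≤ Real.exp (-K) ^ (t / 2 + 1) := by gcongr
        _ = Real.exp (-(K * (t / 2 + 1 : ℕ))) := by rw [← Real.exp_nat_mul]; ring_nf
        _ ≤ Real.exp (-(((k : ℝ) + 3) * n)) := by
          refine Real.exp_le_exp.2 (neg_le_neg ?_)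
          have h4 : (t : ℝ) / 2 ≤ (t / 2 + 1 : ℕ) := by
            have : t ≤ 2 * (t / 2 + 1) := by omega
            have : (t : ℝ) ≤ 2 * (t / 2 + 1 : ℕ) := by exact_mod_cast this
            linarith
          calc ((k : ℝ) + 3) * n = K * (γ * n / 2) := by rw [hK]; field_simp
            _ ≤ K * (t / 2 + 1 : ℕ) := by
              gcongr
              linarith
    calc (2 : ℝ) ^ n * (2 * (Real.exp (k * m) * 2 ^ m * (4 * ε) ^ (t / 2 + 1)))
        ≤ Real.exp n * (Real.exp 1 * (Real.exp (k * n) * Real.exp n *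
          Real.exp (-(((k : ℝ) + 3) * n)))) := by
          gcongr
          · exact two n le_rfl
          · exact two m hmn
      _ = Real.exp (1 - n) := by
        rw [← Real.exp_add, ← Real.exp_add, ← Real.exp_add, ← Real.exp_add]; ring_nf
  have e5 : ((n : ℝ) + 2) * Real.exp (8 * k * s₀ ^ 2 / m - q * s₀ / 2 + B) ≤
      1 / (10 * c) * Real.exp (1 + 20 * c - 10 * c * n) := by
    have h1 : (n : ℝ) + 2 ≤ 1 / (10 * c) * Real.exp (10 * c * (n + 2)) := by
      have := Real.add_one_le_exp (10 * c * ((n : ℝ) + 2))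
      rw [div_mul_eq_mul_div, le_div_iff₀ (by positivity)]
      linarith
    calc ((n : ℝ) + 2) * Real.exp (8 * k * s₀ ^ 2 / m - q * s₀ / 2 + B)
        ≤ (1 / (10 * c) * Real.exp (10 * c * (n + 2))) * Real.exp (1 - 20 * c * n) := by gcongr
      _ = 1 / (10 * c) * Real.exp (1 + 20 * c - 10 * c * n) := by
        rw [mul_assoc, ← Real.exp_add]; ring_nf
  linarith

open Filter Topology in
theorem tendsto_exp_sub_mul {b : ℝ} (hb : 0 < b) (u : ℝ) :
    Tendsto (fun n : ℕ => Real.exp (u - b * n)) atTop (𝓝 0) := by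
  refine Real.tendsto_exp_atBot.comp ?_
  simp only [sub_eq_add_neg]
  exact tendsto_atBot_add_const_left _ _
    (tendsto_neg_atTop_atBot.comp (tendsto_natCast_atTop_atTop.const_mul_atTop hb))

open Filter Topology in
theorem eventually_failure_le {c η : ℝ} (hc : 0 < c) (hη : 0 < η) :
    ∀ᶠ n : ℕ in atTop, 3 * Real.exp (-n) + Real.exp (1 - n) +
      1 / (10 * c) * Real.exp (1 + 20 * c - 10 * c * n) ≤ η := by
  have h := (((tendsto_exp_sub_mul one_pos 0).const_mul 3).add (tendsto_exp_sub_mul one_pos 1)).add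
    ((tendsto_exp_sub_mul (show 0 < 10 * c by positivity) (1 + 20 * c)).const_mul (1 / (10 * c)))
  simp only [mul_zero, add_zero, zero_sub, one_mul] at h
  exact (h.eventually (gt_mem_nhds hη)).mono fun n hn => hn.le

open Filter Topology in
-- At the threshold, `n * p₀ ^ 2` equals `C ^ 2 * n ^ (-1 / (2k - 3))`, which tends to `0`.
theorem eventually_sparse {k : ℕ} (hk : 2 ≤ k) (C : ℝ) :
    ∀ᶠ n : ℕ in atTop, (1 + n * (C * (n : ℝ) ^ (-(((k : ℝ) - 1) / (2 * (k : ℝ) - 3)))) ^ 2) ^ k ≤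
      3 / 2 := by
  have hk' : (2 : ℝ) ≤ k := by exact_mod_cast hk
  have h2k : (0 : ℝ) < 2 * k - 3 := by linarith
  have h0 : Tendsto (fun n : ℕ => (n : ℝ) ^ (-(1 / (2 * (k : ℝ) - 3)))) atTop (𝓝 0) :=
    (tendsto_rpow_neg_atTop (by positivity)).comp tendsto_natCast_atTop_atTop
  have h1 := ((h0.const_mul (C ^ 2)).const_add 1).pow k
  rw [mul_zero, add_zero, one_pow] at h1
  filter_upwards [h1.eventually (gt_mem_nhds (show (1 : ℝ) < 3 / 2 by norm_num)),
    eventually_ge_atTop 1] with n hn hn1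
  have hn0 : (0 : ℝ) < n := by exact_mod_cast hn1
  have h3 : (n : ℝ) * (C * (n : ℝ) ^ (-(((k : ℝ) - 1) / (2 * (k : ℝ) - 3)))) ^ 2 =
      C ^ 2 * (n : ℝ) ^ (-(1 / (2 * (k : ℝ) - 3))) := by
    rw [mul_pow, ← Real.rpow_natCast ((n : ℝ) ^ _), ← Real.rpow_mul hn0.le, mul_left_comm]
    nth_rewrite 1 [← Real.rpow_one (n : ℝ)]
    rw [← Real.rpow_add hn0]
    congr 2
    have h4 : ((k : ℝ) - 1) / (2 * k - 3) * 2 = 1 + 1 / (2 * k - 3) := by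
      rw [div_mul_eq_mul_div, eq_comm, one_add_div h2k.ne']
      ring
    push_cast
    linarith
  rw [h3]
  exact hn.le

end Parameters

/-! ### Conclusion -/

theorem lemma3p7 (k : ℕ) (hk : 2 ≤ k) (δ' d : ℝ) (hδ' : 0 < δ') (hδ'd : δ' ≤ d) (hd : d < 1) :
    ∃ δ₀ δ₁ ε C : ℝ, 0 < δ₀ ∧ 0 < δ₁ ∧ 0 < ε ∧ 0 < C ∧ δ₀ ≤ δ' ∧ 2 * δ₁ < δ₀ ∧
      ∀ η : ℝ, 0 < η → ∃ n₀ : ℕ, ∀ n : ℕ, n₀ ≤ n →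
        ∀ (W : Type*) [Fintype W] [DecidableEq W] (G : SimpleGraph W) [DecidableRel G.Adj]
          (V : Finset W) (U : Fin k → Finset W) (m : ℕ) (x x' y y' : W) (p : unitInterval),
          (∀ i, Disjoint V (U i)) →
          (∀ i j, i ≠ j → Disjoint (U i) (U j)) →
          #V = n + 4 →
          (∀ i, #(U i) = m) →
          (1 - δ₀) * (n : ℝ) ≤ (m : ℝ) →
          (m : ℝ) ≤ (1 - δ₁) * (n : ℝ) →
          (6 * (k : ℤ) - 2) ∣ ((n : ℤ) - (m : ℤ)) →
          (∀ i, IsSuperRegular G ε d V (U i)) →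
          x ∈ V → x' ∈ V → y ∈ V → y' ∈ V → [x, x', y, y'].Nodup →
          (∀ i, d ^ 2 / 2 * (n : ℝ) ≤ (#{u ∈ U i | G.Adj x u ∧ G.Adj x' u} : ℝ)) →
          (∀ i, d ^ 2 / 2 * (n : ℝ) ≤ (#{u ∈ U i | G.Adj y u ∧ G.Adj y' u} : ℝ)) →
          C * (n : ℝ) ^ (-(((k : ℝ) - 1) / (2 * (k : ℝ) - 3))) ≤ (p : ℝ) →
          1 - η ≤ ((randomSubgraph (completeOn V) p).prod
              (randomSubgraph (completeBetween U) p)).real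
            {Γ : SimpleGraph W × SimpleGraph W |
              HasSquareHamPath
                ((G ⊓ completeBetween (Fin.cons V U : Fin (k + 1) → Finset W)) ⊔ Γ.1 ⊔ Γ.2)
                (V ∪ univ.biUnion U) x x' y y'} := by
  have hd0 : 0 < d := hδ'.trans_le hδ'd
  have hk' : (2 : ℝ) ≤ k := by exact_mod_cast hk
  -- The constants form a hierarchy. `δ₀ ≤ c` keeps the surplus `n - m` below the guaranteed sizes
  -- `a` and `B`. `γ`, the ratio `t / n`, makes all multiples of `k * t` small against `δ₀ * n`. `ε`
  -- is exponentially small in `1 / γ` for the union over `X`, and below `d ^ 6 * γ / 5` so that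
  -- regularity reaches the intermediate intersections.
  obtain ⟨c, hc⟩ : ∃ c : ℝ, c = d ^ 8 / (2 ^ 18 * k) := ⟨_, rfl⟩
  obtain ⟨δ₀, hδ₀⟩ : ∃ δ₀ : ℝ, δ₀ = min δ' c := ⟨_, rfl⟩
  obtain ⟨γ, hγ⟩ : ∃ γ : ℝ, γ = δ₀ / (800 * k) := ⟨_, rfl⟩
  obtain ⟨K, hK⟩ : ∃ K : ℝ, K = 2 * (k + 3) / γ := ⟨_, rfl⟩
  obtain ⟨ε, hε⟩ : ∃ ε : ℝ, ε = min (Real.exp (-K) / 4) (d ^ 6 * γ / 5) := ⟨_, rfl⟩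
  obtain ⟨C, hC⟩ : ∃ C : ℝ, C = 2 * (k + 1) / γ ^ k := ⟨_, rfl⟩
  have hc0 : 0 < c := by rw [hc]; positivity
  have hδ₀0 : 0 < δ₀ := by rw [hδ₀]; exact lt_min hδ' hc0
  have hγ0 : 0 < γ := by rw [hγ]; positivity
  have hK0 : 0 < K := by rw [hK]; positivity
  have hε0 : 0 < ε := by rw [hε]; exact lt_min (by positivity) (by positivity)
  have hC0 : 0 < C := by rw [hC]; positivity
  have hδγ : δ₀ = 800 * k * γ := by rw [hγ]; field_simp
  have hcd : 2 ^ 18 * k * c = d ^ 8 := by rw [hc]; field_simp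
  have hδδ' : δ₀ ≤ δ' := hδ₀ ▸ min_le_left _ _
  have hδc : δ₀ ≤ c := hδ₀ ▸ min_le_right _ _
  have hγ1 : γ ≤ 1 := by nlinarith
  have hεK : 4 * ε ≤ Real.exp (-K) := by
    have : ε ≤ Real.exp (-K) / 4 := hε ▸ min_le_left _ _
    linarith
  have hεd : ε ≤ d ^ 6 * γ / 5 := hε ▸ min_le_right _ _
  refine ⟨δ₀, δ₀ / 4, ε, C, hδ₀0, by positivity, hε0, hC0, hδδ', by linarith, fun η hη => ?_⟩
  obtain ⟨n₀, hn₀⟩ := Filter.eventually_atTop.1 ((eventually_failure_le hc0 hη).and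
    ((eventually_sparse hk C).and ((Filter.eventually_ge_atTop 1).and
      (tendsto_natCast_atTop_atTop.eventually (Filter.eventually_ge_atTop (1 / γ))))))
  refine ⟨n₀, fun n hn W _ _ G _ V U m x x' y y' p hVU hU hVn hUm hm₀ hm₁ _ hreg hx hx' hy hy' hnd
    hxc hyc hp => ?_⟩
  obtain ⟨hfail, hsparse, hn1, hnγ⟩ := hn₀ n hn
  have hγn : 1 ≤ γ * n := by
    rw [div_le_iff₀ hγ0] at hnγ
    linarith
  obtain ⟨h1, h2, h3, h4, h5, h6, h7, h8, h9, h10, h11, h12, h13⟩ :=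
    parameter_constraints hk hd0 hd.le hγ0 hδγ hδc hcd hγn hm₀ hm₁ rfl rfl rfl rfl rfl
  set t := ⌈γ * (n : ℝ)⌉₊ with ht
  have hn1' : (1 : ℝ) ≤ n := by exact_mod_cast hn1
  have htγ : γ * n ≤ t := Nat.le_ceil _
  have hεt : ε * (n + 4) ≤ d ^ 3 * (d ^ 3 * t) := by
    calc ε * (n + 4) ≤ d ^ 6 * γ / 5 * (5 * n) := by gcongr; linarith
      _ = d ^ 3 * (d ^ 3 * (γ * n)) := by ring
      _ ≤ d ^ 3 * (d ^ 3 * t) := by gcongr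
  have hmain := one_sub_le_real_hasSquareHamPath hk hVU hU hVn hUm hreg hx hx' hy hy' hnd hxc hyc hd0
    hd.le hε0 (hεK.trans (Real.exp_le_one_iff.2 (by linarith))) hεt le_rfl h1 h2 h3 h4 h5 h6 h7 h8
    h9 h10 h11 h12 (p₀ := C * (n : ℝ) ^ (-(((k : ℝ) - 1) / (2 * (k : ℝ) - 3)))) (by positivity) hp
    (le_trans (by gcongr) hsparse)
  refine le_trans (sub_le_sub_left ?_ 1) hmain
  exact (failure_bound hk hc0 hγ0 hγ1 hK hC hε0 hεK hn1 htγ h2 rfl hp h13).trans hfail
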